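/- Let $\Omega=[0,1]$ with a partition (up to a Lebesgue null set) $\{I\}$ into pairwise disjoint nonempty open intervals, and let $T:\Omega\to\Omega$ be an AFU map: for each $I$, $T|_I$ is $C^2$ and strictly monotone, and (A) $T''/(T')^2$ is bounded on $\bigcup I$; (F) the set of images $\{TI\}$ is finite; (U) there is $\rho>1$ with $|T'|\ge\rho$ on $\bigcup I$. Assume that $T$ is topologically mixing: for all nonempty relatively open $U,V\subset[0,1]$ there is $N$ such that for every $n\ge N$ there is $x\in U$ with $T^kx\in\bigcup I$ for $0\le k<n$ and $T^nx\in V$. Let $\mu$ be the absolutely continuous $T$-invariant probability measure. For a function $f$ and $J\subset[0,1]$ let $\operatorname{Var}_J(f)$ be the infimum, over all $g$ equal to $f$ almost everywhere on $J$, of the total variation of $g$ on $J$; write $\operatorname{Var}=\operatorname{Var}_{[0,1]}$. Let $\mathrm{BV}\subset L^\infty(\mu)$ be the space of (classes of) functions $f:\Omega\to\mathbb C$ with $\operatorname{Var}(f)<\infty$, with norm $\|f\|=|f|_\infty+\operatorname{Var}(f)$. Let $v:\Omega\to\mathbb R$ be measurable with $\int_\Omega v^2\,d\mu=\infty$ and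 $\sup_I\operatorname{Var}_I(v)<\infty$. Fix $\alpha\in(0,1)\cup(1,2]$ and assume (H1) $\mu(v>x)=(p+o(1))\,\ell(x)x^{-\alpha}$ and $\mu(v\le -x)=(q+o(1))\,\ell(x)x^{-\alpha}$ as $x\to\infty$, where $p,q\ge 0$, $p+q=1$ and $\ell$ is slowly varying (measurable, eventually positive, $\ell(cx)/\ell(x)\to1$ for all $c>0$). Let $\ell_0=\ell$ if $\alpha\ne2$. If $\alpha=2$, assume that $\ell(u)/u$ is integrable on $[1,x]$ for every $x\geq 1$, and let $\ell_0(x)=1+\int_1^{1+x}\frac{\ell(u)}{u}\,du$. Let $R:L^1(\mu)\to L^1(\mu)$ be the transfer operator, $\int Rf\,g\,d\mu=\int f\,g\circ T\,d\mu$ for all bounded measurable $g$, and for $t\in\mathbb R$ let $R(t)f=R(e^{itv}f)$. Then $\mathrm{BV}$ is a Banach space that contains the constants and satisfies $|\phi|_\infty\le\|\phi\|$; each $R(t)$ is a bounded operator on $\mathrm{BV}$; and (H1)–(H3) hold on $\mathrm{BV}$, where (with operator norms on $\mathrm{BV}$): (H2) There are $\epsilon>0$ and $C>0$ such that, if $\alpha\in(1,2]$,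 $t\mapsto R(t)$ is differentiable in operator norm at every $t$ with $|t|<2\epsilon$, with derivative $R'(t)$, and for all $|t|,|h|<\epsilon$: (i) $\|R(t)\|\le C$, and $\|R'(t)\|\le C$ if $\alpha\in(1,2]$; (ii) if $\alpha\in(0,1)$, then $\|R(t+h)-R(t)\|\le C|h|^\alpha\,\ell(1/|h|)$; (iii) if $\alpha\in(1,2]$, then for every $\alpha'\in(1,\alpha)$ there is $C_{\alpha'}>0$, independent of $t,h$, with $\|R(t+h)-R(t)-h\,R'(0)\|\le C_{\alpha'}|h|\left(|t|^{\alpha'-1}+|h|^{\alpha'-1}\right)$; (iv) if $\alpha\in(1,2]$, then $\|R'(t+h)-R'(t)\|\le C|h|^{\alpha-1}\ell_0(1/|h|)$. For $h=0$ the right-hand sides of (ii) and (iv) are read as $0$. (H3) The eigenvalue $1$ of $R(0):\mathrm{BV}\to\mathrm{BV}$ is (algebraically) simple, and the remainder of the spectrum of $R(0)$ is contained in a disk, centred at $0$, of radius less than $1$. -/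

import Mathlib

open MeasureTheory Set Filter Topology
open scoped ENNReal NNReal

noncomputable section

/-! ### AFU interval maps

Functions and maps on `[0,1]` are represented by functions on `ℝ`; only the values on `[0,1]`
matter, since all measures below are carried by `[0,1]`. -/

/-- `T` is an AFU map of `[0,1]` with respect to the partition `𝓘`, which consists of pairwise
disjoint nonempty open intervals that cover `[0,1]` up to a Lebesgue null set. -/
structure IsAFU (T : ℝ → ℝ) (𝓘 : Set (Set ℝ)) : Prop where
  mapsTo : MapsTo T (Icc 0 1) (Icc 0 1)
  isInterval : ∀ I ∈ 𝓘, ∃ a b : ℝ, 0 ≤ a ∧ a < b ∧ b ≤ 1 ∧ I = Ioo a b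
  pairwiseDisjoint : 𝓘.PairwiseDisjoint id
  full : volume (Icc (0 : ℝ) 1 \ ⋃₀ 𝓘) = 0
  contDiffOn : ∀ I ∈ 𝓘, ContDiffOn ℝ 2 T I
  strictMonoOrAnti : ∀ I ∈ 𝓘, StrictMonoOn T I ∨ StrictAntiOn T I
  /-- (A) Adler's condition: `T'' / (T')²` is bounded on the union of the partition. -/
  adler : ∃ C : ℝ, ∀ I ∈ 𝓘, ∀ x ∈ I, |deriv (deriv T) x / (deriv T x) ^ 2| ≤ C
  /-- (F) the set of images is finite. -/
  finiteImages : ((fun I : Set ℝ => T '' I) '' 𝓘).Finite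
  /-- (U) uniform expansion. -/
  expanding : ∃ ρ : ℝ, 1 < ρ ∧ ∀ I ∈ 𝓘, ∀ x ∈ I, ρ ≤ |deriv T x|

/-- Topological mixing: for nonempty relatively open `U, V ⊆ [0,1]`, some point of `U` is mapped
into `V` by `T ^ n`, for every large `n`. Only orbits that stay in the partition intervals up to
time `n` are counted: the values of `T` at the exceptional null set are arbitrary. -/
def IsTopMixing (T : ℝ → ℝ) (𝓘 : Set (Set ℝ)) : Prop :=
  ∀ U V : Set ℝ, IsOpen U → IsOpen V → (U ∩ Icc 0 1).Nonempty → (V ∩ Icc 0 1).Nonempty →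
    ∃ N : ℕ, ∀ n : ℕ, N ≤ n →
      ∃ x ∈ U ∩ Icc 0 1, (∀ k < n, T^[k] x ∈ ⋃₀ 𝓘) ∧ T^[n] x ∈ V

/-! ### Variation and the space `BV` -/

/-- Variation on `s` of the class of `f` modulo null sets: the infimum of the variations on `s` of
all `g` that agree with `f` almost everywhere on `s`. -/
def essVar {E : Type*} [PseudoEMetricSpace E] (μ : Measure ℝ) (f : ℝ → E) (s : Set ℝ) : ℝ≥0∞ :=
  ⨅ g : {g : ℝ → E // g =ᵐ[μ.restrict s] f}, eVariationOn (g : ℝ → E) s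

section essVarLemmas

variable {E : Type*} [SeminormedAddCommGroup E] {μ : Measure ℝ} {f g : ℝ → E} {s : Set ℝ}

theorem essVar_le (h : g =ᵐ[μ.restrict s] f) : essVar μ f s ≤ eVariationOn g s :=
  iInf_le (fun g : {g : ℝ → E // g =ᵐ[μ.restrict s] f} => eVariationOn (g : ℝ → E) s) ⟨g, h⟩

theorem essVar_congr (h : f =ᵐ[μ] g) : essVar μ f s = essVar μ g s := by
  have h' : f =ᵐ[μ.restrict s] g := ae_restrict_of_ae h
  exact le_antisymm (le_iInf fun k => essVar_le (k.2.trans h'.symm))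
    (le_iInf fun k => essVar_le (k.2.trans h'))

theorem essVar_zero : essVar μ (fun _ => (0 : E)) s = 0 := by
  refine le_antisymm ((essVar_le (EventuallyEq.refl _ _)).trans ?_) zero_le
  exact (eVariationOn.constant_on (by
    rintro _ ⟨_, _, rfl⟩ _ ⟨_, _, rfl⟩; rfl)).le

theorem eVariationOn_add_le' (f g : ℝ → E) (s : Set ℝ) :
    eVariationOn (fun x => f x + g x) s ≤ eVariationOn f s + eVariationOn g s := by
  refine iSup_le fun p => ?_
  calc ∑ i ∈ Finset.range p.1,
        edist (f (p.2.1 (i + 1)) + g (p.2.1 (i + 1))) (f (p.2.1 i) + g (p.2.1 i))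
      ≤ ∑ i ∈ Finset.range p.1, (edist (f (p.2.1 (i + 1))) (f (p.2.1 i)) +
          edist (g (p.2.1 (i + 1))) (g (p.2.1 i))) :=
        Finset.sum_le_sum fun i _ => edist_add_add_le _ _ _ _
    _ = _ := Finset.sum_add_distrib
    _ ≤ _ := add_le_add (eVariationOn.sum_le p.2.2.1 (fun i => p.2.2.2 i))
        (eVariationOn.sum_le p.2.2.1 (fun i => p.2.2.2 i))

theorem essVar_add_le : essVar μ (fun x => f x + g x) s ≤ essVar μ f s + essVar μ g s := by
  unfold essVar
  refine ENNReal.le_iInf_add_iInf fun a b => ?_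
  exact (essVar_le (a.2.add b.2)).trans (eVariationOn_add_le' _ _ _)

theorem essVar_smul_le [NormedSpace ℂ E] (c : ℂ) :
    essVar μ (fun x => c • f x) s ≤ ‖c‖₊ * essVar μ f s := by
  by_cases hc : c = 0
  · subst hc
    simp only [zero_smul, nnnorm_zero, ENNReal.coe_zero, zero_mul]
    exact essVar_zero.le
  unfold essVar
  have : Nonempty {g : ℝ → E // g =ᵐ[μ.restrict s] f} := ⟨⟨f, EventuallyEq.refl _ _⟩⟩
  rw [ENNReal.mul_iInf_of_ne (by simpa using hc) ENNReal.coe_ne_top]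
  refine le_iInf fun a => (essVar_le (g := fun x => c • a.1 x) (a.2.const_smul c)).trans ?_
  exact (lipschitzWith_smul c).lipschitzOnWith.comp_eVariationOn_le (mapsTo_univ _ _)

end essVarLemmas

/-- The classes `f ∈ L^∞(μ)` of finite variation on `[0,1]`. -/
def bvSubmodule (μ : Measure ℝ) : Submodule ℂ (Lp ℂ ∞ μ) where
  carrier := {f | essVar μ (f : ℝ → ℂ) (Icc 0 1) ≠ ∞}
  zero_mem' := by
    simp only [mem_ofPred_eq]
    rw [essVar_congr (g := fun _ => (0 : ℂ)) (Lp.coeFn_zero ℂ ∞ μ), essVar_zero]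
    simp
  add_mem' := by
    intro f g hf hg
    simp only [mem_ofPred_eq] at *
    rw [essVar_congr (Lp.coeFn_add f g)]
    exact ne_top_of_le_ne_top (ENNReal.add_ne_top.2 ⟨hf, hg⟩) essVar_add_le
  smul_mem' := by
    intro c f hf
    simp only [mem_ofPred_eq] at *
    rw [essVar_congr (Lp.coeFn_smul c f)]
    exact ne_top_of_le_ne_top (ENNReal.mul_ne_top ENNReal.coe_ne_top hf) (essVar_smul_le c)

/-- The space `BV` of (complex valued) functions of bounded variation on `[0,1]`, modulo null
sets. Its norm is `|f|_∞ + Var f`. -/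
def BV (μ : Measure ℝ) : Type := bvSubmodule μ

namespace BV

variable {μ : Measure ℝ}

instance : AddCommGroup (BV μ) := inferInstanceAs (AddCommGroup (bvSubmodule μ))

instance : Module ℂ (BV μ) := inferInstanceAs (Module ℂ (bvSubmodule μ))

/-- The inclusion of `BV` in `L^∞(μ)`. -/
def incl (μ : Measure ℝ) : BV μ →ₗ[ℂ] Lp ℂ ∞ μ := (bvSubmodule μ).subtype

theorem incl_injective : Function.Injective (incl μ) := Subtype.val_injective

/-- The variation `Var f` of `f ∈ BV`. -/
def var (f : BV μ) : ℝ := (essVar μ (incl μ f : ℝ → ℂ) (Icc 0 1)).toReal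

instance : Norm (BV μ) := ⟨fun f => ‖incl μ f‖ + var f⟩

theorem norm_def (f : BV μ) : ‖f‖ = ‖incl μ f‖ + var f := rfl

theorem essVar_ne_top (f : BV μ) : essVar μ (incl μ f : ℝ → ℂ) (Icc 0 1) ≠ ∞ := f.2

theorem var_nonneg (f : BV μ) : 0 ≤ var f := ENNReal.toReal_nonneg

theorem var_add_le (f g : BV μ) : var (f + g) ≤ var f + var g := by
  unfold var
  rw [← ENNReal.toReal_add (essVar_ne_top f) (essVar_ne_top g), map_add,
    essVar_congr (Lp.coeFn_add (incl μ f) (incl μ g))]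
  exact ENNReal.toReal_mono (ENNReal.add_ne_top.2 ⟨essVar_ne_top f, essVar_ne_top g⟩)
    essVar_add_le

theorem var_smul_le (c : ℂ) (f : BV μ) : var (c • f) ≤ ‖c‖ * var f := by
  unfold var
  rw [map_smul, essVar_congr (Lp.coeFn_smul c (incl μ f))]
  have h := ENNReal.toReal_mono (ENNReal.mul_ne_top ENNReal.coe_ne_top (essVar_ne_top f))
    (essVar_smul_le (μ := μ) (f := (incl μ f : ℝ → ℂ)) (s := Icc 0 1) c)
  rw [ENNReal.toReal_mul] at h
  exact h

theorem var_smul (c : ℂ) (f : BV μ) : var (c • f) = ‖c‖ * var f := by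
  refine le_antisymm (var_smul_le c f) ?_
  by_cases hc : c = 0
  · subst hc; simpa using var_nonneg _
  · have h := var_smul_le c⁻¹ (c • f)
    rw [smul_smul, inv_mul_cancel₀ hc, one_smul, norm_inv] at h
    have hc' : 0 < ‖c‖ := norm_pos_iff.2 hc
    calc ‖c‖ * var f ≤ ‖c‖ * (‖c‖⁻¹ * var (c • f)) := by gcongr
      _ = var (c • f) := by field_simp

theorem normCore : NormedSpace.Core ℂ (BV μ) where
  norm_nonneg f := add_nonneg (norm_nonneg _) (var_nonneg f)
  norm_smul c f := by
    rw [norm_def, norm_def, map_smul, var_smul, norm_smul, mul_add]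
  norm_triangle f g := by
    rw [norm_def, norm_def, norm_def, map_add]
    linarith [norm_add_le (incl μ f) (incl μ g), var_add_le f g]
  norm_eq_zero_iff f := by
    constructor
    · intro h
      have h1 : ‖incl μ f‖ = 0 := by
        rw [norm_def] at h
        linarith [norm_nonneg (incl μ f), var_nonneg f]
      exact incl_injective (by rw [norm_eq_zero.1 h1, map_zero])
    · rintro rfl
      have := var_smul (0 : ℂ) (0 : BV μ)
      rw [zero_smul, norm_zero, zero_mul] at this
      rw [norm_def, map_zero, norm_zero, this, add_zero]

instance : NormedAddCommGroup (BV μ) := NormedAddCommGroup.ofCore normCore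

instance : NormedSpace ℂ (BV μ) := NormedSpace.ofCore normCore

end BV

/-! ### Tails of the observable -/

/-- `ℓ` is slowly varying at infinity. -/
def IsSlowlyVarying (ℓ : ℝ → ℝ) : Prop :=
  Measurable ℓ ∧ (∀ᶠ x in atTop, 0 < ℓ x) ∧
    ∀ c : ℝ, 0 < c → Tendsto (fun x => ℓ (c * x) / ℓ x) atTop (𝓝 1)

/-- (H1): `μ(v > x) = (p + o(1)) ℓ(x) x^{-α}` and `μ(v ≤ -x) = (q + o(1)) ℓ(x) x^{-α}` as
`x → ∞`, with `ℓ` slowly varying and `p + q = 1`. -/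
def HypH1 {Ω : Type*} [MeasurableSpace Ω] (μ : Measure Ω) (v : Ω → ℝ) (α p q : ℝ) (ℓ : ℝ → ℝ) :
    Prop :=
  IsSlowlyVarying ℓ ∧ 0 ≤ p ∧ 0 ≤ q ∧ p + q = 1 ∧
    Tendsto (fun x : ℝ => μ.real {y | x < v y} / (ℓ x * x ^ (-α))) atTop (𝓝 p) ∧
    Tendsto (fun x : ℝ => μ.real {y | v y ≤ -x} / (ℓ x * x ^ (-α))) atTop (𝓝 q)

/-- `ℓ̂(x) = 1 + ∫_1^{1+x} ℓ(u)/u du`. -/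
def ellHat (ℓ : ℝ → ℝ) (x : ℝ) : ℝ := 1 + ∫ u in (1 : ℝ)..(1 + x), ℓ u / u

/-- `ℓ₀ = ℓ̂` if `α = 2`, and `ℓ₀ = ℓ` otherwise. -/
def ellZero (α : ℝ) (ℓ : ℝ → ℝ) : ℝ → ℝ := open Classical in if α = 2 then ellHat ℓ else ℓ

/-! ### Transfer operators and the abstract hypotheses -/

section Abstract

variable {Ω : Type*} [MeasurableSpace Ω]

/-- `k = R f`, where `R : L¹(μ) → L¹(μ)` is the transfer operator of `T`, that is,
`∫ (R f) g dμ = ∫ f (g ∘ T) dμ` for all bounded measurable `g`. -/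
def IsTransferOf (μ : Measure Ω) (T : Ω → Ω) (f k : Ω → ℂ) : Prop :=
  Integrable k μ ∧ ∀ g : Ω → ℂ, Measurable g → (∃ C : ℝ, ∀ x, ‖g x‖ ≤ C) →
    ∫ x, k x * g x ∂μ = ∫ x, f x * g (T x) ∂μ

/-- The defining formula determines `R f` almost everywhere. -/
theorem IsTransferOf.unique {μ : Measure Ω} {T : Ω → Ω} {f k k' : Ω → ℂ}
    (h : IsTransferOf μ T f k) (h' : IsTransferOf μ T f k') : k =ᵐ[μ] k' := by
  refine h.1.ae_eq_of_forall_setIntegral_eq _ _ h'.1 fun s hs _ => ?_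
  have key : ∀ w : Ω → ℂ, ∫ x in s, w x ∂μ = ∫ x, w x * s.indicator (fun _ => (1 : ℂ)) x ∂μ := by
    intro w
    rw [← integral_indicator hs]
    congr 1
    ext x
    by_cases hx : x ∈ s <;> simp [hx]
  have hg : Measurable (s.indicator (fun _ => (1 : ℂ))) := measurable_const.indicator hs
  have hb : ∃ C : ℝ, ∀ x, ‖s.indicator (fun _ => (1 : ℂ)) x‖ ≤ C :=
    ⟨1, fun x => by by_cases hx : x ∈ s <;> simp [hx]⟩
  rw [key k, key k', h.2 _ hg hb, h'.2 _ hg hb]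

variable {B : Type*} [NormedAddCommGroup B] [NormedSpace ℂ B]

/-- `B` is, through `ι`, a Banach space of elements of `L^∞(μ)` that contains the constant
functions and satisfies `|φ|_∞ ≤ ‖φ‖`. -/
def IsBanachInLinfty (μ : Measure Ω) (ι : B →ₗ[ℂ] Lp ℂ ∞ μ) : Prop :=
  CompleteSpace B ∧ Function.Injective ι ∧
    (∀ c : ℂ, ∃ φ : B, (ι φ : Ω → ℂ) =ᵐ[μ] fun _ => c) ∧ ∀ φ : B, ‖ι φ‖ ≤ ‖φ‖

/-- The bounded operators `R t` on `B` are given by `R(t) f = R (e^{itv} f)`, with `R` the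
transfer operator of `T`. -/
def IsPerturbedTransfer (μ : Measure Ω) (T : Ω → Ω) (v : Ω → ℝ) (ι : B →ₗ[ℂ] Lp ℂ ∞ μ)
    (R : ℝ → B →L[ℂ] B) : Prop :=
  ∀ (t : ℝ) (f : B),
    IsTransferOf μ T (fun x => Complex.exp (Complex.I * (t * v x)) * (ι f : Ω → ℂ) x)
      (ι (R t f) : Ω → ℂ)

/-- (H2). For `α ∈ (1,2]`, `R'(t)` is the derivative of `t ↦ R(t)` in the operator norm, whose
existence is part of the claim at all the points `t`, `t + h` that occur. The constant in (iii) may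
depend on `α'`. -/
def HypH2 (α : ℝ) (ℓ : ℝ → ℝ) (R : ℝ → B →L[ℂ] B) : Prop :=
  ∃ ε : ℝ, 0 < ε ∧
    (1 < α → ∀ t : ℝ, |t| < 2 * ε → DifferentiableAt ℝ R t) ∧
    (∃ C : ℝ, 0 < C ∧ ∀ t h : ℝ, |t| < ε → |h| < ε →
      ‖R t‖ ≤ C ∧
      (1 < α → ‖deriv R t‖ ≤ C) ∧
      (α < 1 → ‖R (t + h) - R t‖ ≤ C * (|h| ^ α * ℓ (1 / |h|))) ∧
      (1 < α → ‖deriv R (t + h) - deriv R t‖ ≤ C * (|h| ^ (α - 1) * ellZero α ℓ (1 / |h|)))) ∧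
    (1 < α → ∀ α' : ℝ, 1 < α' → α' < α → ∃ C : ℝ, 0 < C ∧ ∀ t h : ℝ, |t| < ε → |h| < ε →
      ‖R (t + h) - R t - h • deriv R 0‖ ≤ C * (|h| * (|t| ^ (α' - 1) + |h| ^ (α' - 1))))

/-- `1` is an (algebraically) simple eigenvalue of `A`: the space splits as
`ker (A - 1) ⊕ ran (A - 1)` and the first summand is one-dimensional. -/
def IsSimpleEigenvalueOne (A : B →L[ℂ] B) : Prop :=
  Module.finrank ℂ (LinearMap.ker ((A - 1 : B →L[ℂ] B) : B →ₗ[ℂ] B)) = 1 ∧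
    IsCompl (LinearMap.ker ((A - 1 : B →L[ℂ] B) : B →ₗ[ℂ] B))
      (LinearMap.range ((A - 1 : B →L[ℂ] B) : B →ₗ[ℂ] B))

/-- (H3): the eigenvalue `1` of `A = R(0)` is simple and the rest of the spectrum lies in a disk
(centred at `0`) of radius less than `1`. -/
def HypH3 (A : B →L[ℂ] B) : Prop :=
  IsSimpleEigenvalueOne A ∧ ∃ r : ℝ, r < 1 ∧ ∀ z ∈ spectrum ℂ A, z ≠ 1 → ‖z‖ ≤ r

end Abstract

end

noncomputable section

/-! ### Variation of functions on the line -/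

section Variation

variable {E : Type*} [NormedAddCommGroup E]

/-! The theorem rests on three facts: a spectral gap for the transfer operator with respect to
Lebesgue measure, a lower bound for the invariant density, and a bound for multipliers that turns
every estimate of (H2) into a moment estimate for `v`.

Spectral gap. Adler's condition integrated along a branch reads `|T'x| ≤ exp(C|Tx - Ty|) |T'y|`.
Since distance is measured in the image, the property survives composition, with a constant common
to all iterates (`PiecewiseExpanding.iterate`). Together with the finiteness of the images it gives
`1/|T'| ≤ D|I|` on `I`. A Lasota–Yorke inequality follows, with variation coefficient at most 1/4
for a suitable iterate (`exists_iterate_essVar_le`). The gap then comes from a direct argument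
instead of a compactness theorem. If `u` has mean zero and its variation is controlled by its
L¹-norm, the parts `u⁺` and `u⁻` are large on intervals of a fixed grid; mixing brings a definite
share of one part to an interval where the transferred other part is large, and there they cancel
(`exists_integral_abs_le`). Together the two inequalities contract a norm `Var + B|·|₁` on functions
of mean zero (`exists_contraction`), and a rank one perturbation argument gives (H3)
(`hypH3_of_contraction`).

Density. Passing from Lebesgue measure to `μ` means conjugating by the density `g`, so both `g` and
`1/g` must be of bounded variation. That `g` is so follows from Lasota–Yorke and lower
semicontinuity. For the lower bound, consider the points near which `μ` does not dominate Lebesgue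
measure, together with the ends of the images. Short gaps between such points, and one-sided
neighbourhoods of the bad points, pull back to shorter ones by expansion. By invariance their union
has the measure of arbitrarily small unions, hence measure zero, whereas it is open and mixing gives
every open set meeting `[0,1]` positive measure. So bad points do not exist even from one side, and
compactness concludes (`boundedBelowOn_Icc`).

Perturbation. If `v` varies by at most `V₁` on each `I`, a growth bound `a(|v x|)` at a point of `I`
is at most the average over `I` of `a(|v| + V₁)`. The branch weights `D|I|` turn the sum of these
averages into an integral, so `f ↦ R(F(v) f)` has norm at most `C₀ ∫ a(|v| + V₁) dμ` as soon as `F`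
and `F'` are dominated by `a` (`exists_multiplier_operator`). Applied to increments of `e^{itx}` and
of `ixe^{itx}`, this reduces (H2) to `∫ min(1, |hv|)`, to `∫ |v| min(1, |hv|)` and to moments of
order below `α`. These are estimated by dyadic recursion from the tails. -/

theorem eVariationOn_le_of_tendsto {ι : Type*} {F : ι → ℝ → E} {p : Filter ι} [p.NeBot]
    {f : ℝ → E} {s : Set ℝ} (h : ∀ x ∈ s, Tendsto (fun i => F i x) p (𝓝 (f x))) {V : ℝ≥0∞}
    (hV : ∀ᶠ i in p, eVariationOn (F i) s ≤ V) : eVariationOn f s ≤ V := by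
  by_contra! hlt
  obtain ⟨i, hi, hi'⟩ := ((eVariationOn.lowerSemicontinuous_aux h hlt).and hV).exists
  exact absurd hi' (not_le.2 hi)

theorem norm_le_add_of_eVariationOn_le {f : ℝ → E} {s : Set ℝ} {V : ℝ} (hV : 0 ≤ V)
    (h : eVariationOn f s ≤ ENNReal.ofReal V) {x y : ℝ} (hx : x ∈ s) (hy : y ∈ s) :
    ‖f x‖ ≤ ‖f y‖ + V := by
  have h1 := (eVariationOn.edist_le f hx hy).trans h
  rw [edist_dist, ENNReal.ofReal_le_ofReal_iff hV, dist_eq_norm] at h1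
  have h2 : ‖f x‖ ≤ ‖f y‖ + ‖f x - f y‖ := norm_le_norm_add_norm_sub' _ _
  linarith

/-- The monotone retraction of the line onto a finite set. -/
def finsetRetract (F : Finset ℝ) (hF : F.Nonempty) (x : ℝ) : ℝ :=
  if h : (F.filter (· ≤ x)).Nonempty then (F.filter (· ≤ x)).max' h else F.min' hF

theorem finsetRetract_mem (F : Finset ℝ) (hF : F.Nonempty) (x : ℝ) :
    finsetRetract F hF x ∈ F := by
  unfold finsetRetract
  split_ifs with h
  · exact (Finset.mem_filter.1 (Finset.max'_mem _ h)).1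
  · exact Finset.min'_mem _ _

theorem finsetRetract_of_mem (F : Finset ℝ) (hF : F.Nonempty) {x : ℝ} (hx : x ∈ F) :
    finsetRetract F hF x = x := by
  have h : (F.filter (· ≤ x)).Nonempty := ⟨x, by simp [hx]⟩
  unfold finsetRetract
  rw [dif_pos h]
  exact le_antisymm (Finset.mem_filter.1 (Finset.max'_mem _ h)).2
    (Finset.le_max' _ _ (by simp [hx]))

theorem finsetRetract_monotone (F : Finset ℝ) (hF : F.Nonempty) :
    Monotone (finsetRetract F hF) := by
  intro x y hxy
  by_cases h : (F.filter (· ≤ x)).Nonempty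
  · have hsub : F.filter (· ≤ x) ⊆ F.filter (· ≤ y) := fun z hz => by
      simp only [Finset.mem_filter] at hz ⊢
      exact ⟨hz.1, hz.2.trans hxy⟩
    have h' := h.mono hsub
    unfold finsetRetract
    rw [dif_pos h, dif_pos h']
    exact Finset.max'_subset h hsub
  · have : finsetRetract F hF x = F.min' hF := dif_neg h
    rw [this]
    exact Finset.min'_le _ _ (finsetRetract_mem F hF y)

/-- A bounded function on a subset of the line extends to the line without increasing its variation
or its sup norm. -/
theorem exists_extension_eVariationOn_le [ProperSpace E] (f : ℝ → E) {S : Set ℝ}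
    (hS : S.Nonempty) {M : ℝ} (hM : ∀ x ∈ S, ‖f x‖ ≤ M) :
    ∃ g : ℝ → E, EqOn g f S ∧ eVariationOn g univ ≤ eVariationOn f S ∧ ∀ x, ‖g x‖ ≤ M := by
  classical
  obtain ⟨x₀, hx₀⟩ := hS
  let F : Finset S → Finset ℝ := fun A => insert x₀ (A.image Subtype.val)
  have hF : ∀ A, (F A).Nonempty := fun A => ⟨x₀, Finset.mem_insert_self _ _⟩
  have hFS : ∀ A, ∀ y ∈ F A, y ∈ S := by
    intro A y hy
    rcases Finset.mem_insert.1 hy with rfl | hy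
    · exact hx₀
    · obtain ⟨z, _, rfl⟩ := Finset.mem_image.1 hy
      exact z.2
  let r : Finset S → ℝ → ℝ := fun A => finsetRetract (F A) (hF A)
  have hr : ∀ A x, r A x ∈ S := fun A x => hFS A _ (finsetRetract_mem _ _ _)
  -- The functions `f ∘ r A` have variation at most that of `f` and values in a compact ball. An
  -- ultrafilter finer than `atTop` makes them converge at every point simultaneously.
  let p : Ultrafilter (Finset S) := Ultrafilter.of atTop
  have hp : (p : Filter (Finset S)) ≤ atTop := Ultrafilter.of_le _
  have hlim : ∀ x, ∃ y ∈ Metric.closedBall (0 : E) M, Tendsto (fun A => f (r A x)) p (𝓝 y) := by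
    intro x
    have hK : IsCompact (Metric.closedBall (0 : E) M) := isCompact_closedBall _ _
    have := hK.ultrafilter_le_nhds (p.map fun A => f (r A x)) (le_principal_iff.2
      (show (fun A => f (r A x)) ⁻¹' Metric.closedBall 0 M ∈ (p : Filter (Finset S)) from
        univ_mem' fun A => by simpa using hM _ (hr A x)))
    obtain ⟨y, hy, h⟩ := this
    exact ⟨y, hy, h⟩
  choose g hgM hg using hlim
  refine ⟨g, ?_, ?_, fun x => by simpa using hgM x⟩
  · intro x hx
    refine tendsto_nhds_unique (hg x) ?_
    refine tendsto_const_nhds.congr' ?_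
    have : ∀ᶠ A in (p : Filter (Finset S)), {(⟨x, hx⟩ : S)} ≤ A := hp (eventually_ge_atTop _)
    filter_upwards [this] with A hA
    have : x ∈ F A := Finset.mem_insert_of_mem (Finset.mem_image.2 ⟨⟨x, hx⟩, by simpa using hA, rfl⟩)
    change f x = f (finsetRetract (F A) (hF A) x)
    rw [finsetRetract_of_mem _ _ this]
  · refine eVariationOn_le_of_tendsto (F := fun A x => f (r A x)) (p := p) (fun x _ => hg x) ?_
    exact Eventually.of_forall fun A => eVariationOn.comp_le_of_monotoneOn f (r A)
      ((finsetRetract_monotone _ _).monotoneOn _) fun x _ => hr A x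

theorem eVariationOn_smul_le_ofReal {𝕜 : Type*} [NormedRing 𝕜] [NormedAlgebra ℝ 𝕜] [NormedSpace ℝ E]
    [Module 𝕜 E] [IsScalarTower ℝ 𝕜 E] [NormSMulClass 𝕜 E] {a : ℝ → 𝕜} {f : ℝ → E} {s : Set ℝ} {A M W V : ℝ} (hA0 : 0 ≤ A) (hM0 : 0 ≤ M)
    (hA : ∀ x ∈ s, ‖a x‖ ≤ A) (hM : ∀ x ∈ s, ‖f x‖ ≤ M) (hW0 : 0 ≤ W) (hV0 : 0 ≤ V)
    (hW : eVariationOn a s ≤ ENNReal.ofReal W) (hV : eVariationOn f s ≤ ENNReal.ofReal V) :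
    eVariationOn (fun x => a x • f x) s ≤ ENNReal.ofReal (A * V + M * W) := by
  have hA' : ∀ x ∈ s, ‖a x‖ₑ ≤ ENNReal.ofReal A := fun x hx => by
    rw [← ofReal_norm]; exact ENNReal.ofReal_le_ofReal (hA x hx)
  have hM' : ∀ x ∈ s, ‖f x‖ₑ ≤ ENNReal.ofReal M := fun x hx => by
    rw [← ofReal_norm]; exact ENNReal.ofReal_le_ofReal (hM x hx)
  refine (eVariationOn_smul_le hA' hM').trans ?_
  rw [ENNReal.ofReal_add (by positivity) (by positivity), ENNReal.ofReal_mul hA0,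
    ENNReal.ofReal_mul hM0]
  gcongr

theorem eVariationOn_monotone_le {f : ℝ → ℝ} (hf : Monotone f) {a b : ℝ} (ha : ∀ x, a ≤ f x)
    (hb : ∀ x, f x ≤ b) : eVariationOn f univ ≤ ENNReal.ofReal (b - a) := by
  rw [eVariationOn.eq_biSup_inter_Icc]
  refine iSup₂_le fun q _ => ((hf.monotoneOn _).eVariationOn_eq (mem_univ _) (mem_univ _)).le.trans ?_
  exact ENNReal.ofReal_le_ofReal (by linarith [ha q.1, hb q.2])

theorem eVariationOn_neg (f : ℝ → E) (s : Set ℝ) :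
    eVariationOn (fun x => -f x) s = eVariationOn f s := by
  unfold eVariationOn
  simp only [edist_neg_neg]

theorem eVariationOn_indicator_one_Ioo_le (c d : ℝ) :
    eVariationOn ((Ioo c d).indicator fun _ => (1 : ℝ)) univ ≤ ENNReal.ofReal 2 := by
  rcases le_or_gt d c with h | hcd
  · rw [Ioo_eq_empty (not_lt.2 h), eVariationOn.constant_on]
    · simp
    · rintro _ ⟨_, _, rfl⟩ _ ⟨_, _, rfl⟩; simp
  have h1 : eVariationOn ((Ioi c).indicator fun _ => (1 : ℝ)) univ ≤ ENNReal.ofReal (1 - 0) := by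
    refine eVariationOn_monotone_le (fun x y hxy => ?_) (fun x => ?_) fun x => ?_ <;>
      simp only [indicator, mem_Ioi] <;> split_ifs <;> linarith
  have h2 : eVariationOn ((Ici d).indicator fun _ => (1 : ℝ)) univ ≤ ENNReal.ofReal (1 - 0) := by
    refine eVariationOn_monotone_le (fun x y hxy => ?_) (fun x => ?_) fun x => ?_ <;>
      simp only [indicator, mem_Ici] <;> split_ifs <;> linarith
  have h3 : ((Ioo c d).indicator fun _ => (1 : ℝ)) = fun x =>
      (Ioi c).indicator (fun _ => (1 : ℝ)) x + -(Ici d).indicator (fun _ => (1 : ℝ)) x := by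
    ext x
    simp only [indicator, mem_Ioo, mem_Ioi, mem_Ici]
    split_ifs <;> grind
  rw [h3]
  refine (eVariationOn_add_le' _ _ _).trans ?_
  rw [eVariationOn_neg]
  refine (add_le_add h1 h2).trans ?_
  rw [← ENNReal.ofReal_add] <;> norm_num

/-- Off the interval `f` is first replaced by an extension of no larger variation or supremum, so
that the product rule applies on the whole line; each of the two jumps of the indicator then costs
at most `M`. -/
theorem eVariationOn_indicator_Ioo_le [NormedSpace ℝ E] [ProperSpace E] {f : ℝ → E} {c d M V : ℝ}
    (hcd : c < d) (hM : ∀ x ∈ Ioo c d, ‖f x‖ ≤ M) (hV0 : 0 ≤ V)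
    (hV : eVariationOn f (Ioo c d) ≤ ENNReal.ofReal V) :
    eVariationOn ((Ioo c d).indicator f) univ ≤ ENNReal.ofReal (V + 2 * M) := by
  have hne : (Ioo c d).Nonempty := nonempty_Ioo.2 hcd
  obtain ⟨g, hgf, hgV, hgM⟩ := exists_extension_eVariationOn_le f hne hM
  have hM0 : 0 ≤ M := (norm_nonneg _).trans (hgM 0)
  have h1 : (Ioo c d).indicator f = fun x => (Ioo c d).indicator (fun _ => (1 : ℝ)) x • g x := by
    ext x
    by_cases hx : x ∈ Ioo c d
    · simp [hx, hgf hx]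
    · simp [hx]
  rw [h1]
  refine (eVariationOn_smul_le_ofReal (A := 1) (M := M) (W := 2) (V := V) (by norm_num) hM0
    (fun x _ => ?_) (fun x _ => hgM x) (by norm_num) hV0
    (eVariationOn_indicator_one_Ioo_le c d) (hgV.trans hV)).trans ?_
  · by_cases hx : x ∈ Ioo c d <;> simp [hx]
  · exact ENNReal.ofReal_le_ofReal (by linarith)

theorem edist_tsum_le {ι : Type*} {a b : ι → E} (ha : Summable a) (hb : Summable b) :
    edist (∑' i, a i) (∑' i, b i) ≤ ∑' i, edist (a i) (b i) := by
  have h : Tendsto (fun A : Finset ι => edist (∑ i ∈ A, a i) (∑ i ∈ A, b i)) atTop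
      (𝓝 (edist (∑' i, a i) (∑' i, b i))) := Filter.Tendsto.edist ha.hasSum hb.hasSum
  refine le_of_tendsto' h fun A => ?_
  refine le_trans ?_ (ENNReal.sum_le_tsum A)
  classical
  induction A using Finset.induction_on with
  | empty => simp
  | insert i A hi ih =>
    rw [Finset.sum_insert hi, Finset.sum_insert hi, Finset.sum_insert hi]
    exact (edist_add_add_le _ _ _ _).trans (add_le_add le_rfl ih)

theorem eVariationOn_tsum_le {ι : Type*} {f : ι → ℝ → E} {s : Set ℝ}
    (hf : ∀ x ∈ s, Summable fun i => f i x) :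
    eVariationOn (fun x => ∑' i, f i x) s ≤ ∑' i, eVariationOn (f i) s := by
  refine iSup_le fun q => ?_
  have hu := q.2.2.2
  calc ∑ j ∈ Finset.range q.1, edist (∑' i, f i (q.2.1 (j + 1))) (∑' i, f i (q.2.1 j))
      ≤ ∑ j ∈ Finset.range q.1, ∑' i, edist (f i (q.2.1 (j + 1))) (f i (q.2.1 j)) :=
        Finset.sum_le_sum fun j _ => edist_tsum_le (hf _ (hu _)) (hf _ (hu _))
    _ = ∑' i, ∑ j ∈ Finset.range q.1, edist (f i (q.2.1 (j + 1))) (f i (q.2.1 j)) :=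
        (Summable.tsum_finsetSum fun _ _ => ENNReal.summable).symm
    _ ≤ _ := ENNReal.tsum_le_tsum fun i => eVariationOn.sum_le q.2.2.1 fun j => q.2.2.2 j

/-- Variation is superadditive over sets lying one after the other. Adding the interval with the
largest left end last puts the disjoint intervals in order. -/
theorem sum_eVariationOn_Ioo_le {ι : Type*} (f : ℝ → E) (a b : ι → ℝ) (A : Finset ι)
    (hab : ∀ i ∈ A, a i < b i)
    (hd : ∀ i ∈ A, ∀ j ∈ A, i ≠ j → Disjoint (Ioo (a i) (b i)) (Ioo (a j) (b j))) :
    ∑ i ∈ A, eVariationOn f (Ioo (a i) (b i)) ≤ eVariationOn f (⋃ i ∈ A, Ioo (a i) (b i)) := by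
  classical
  induction A using Finset.induction_on_max_value a with
  | empty => simp
  | insert i A hi hmax ih =>
    rw [Finset.sum_insert hi, Finset.set_biUnion_insert, union_comm, add_comm]
    refine (add_le_add (ih (fun j hj => hab j (Finset.mem_insert_of_mem hj))
      fun j hj k hk => hd j (Finset.mem_insert_of_mem hj) k (Finset.mem_insert_of_mem hk))
      le_rfl).trans (eVariationOn.add_le_union f ?_)
    intro x hx y hy
    simp only [mem_iUnion, exists_prop] at hx
    obtain ⟨j, hj, hx⟩ := hx
    have hdis := hd j (Finset.mem_insert_of_mem hj) i (Finset.mem_insert_self _ _)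
      (fun h => hi (h ▸ hj))
    have haj := hmax j hj
    have hib := hab i (Finset.mem_insert_self _ _)
    rw [Ioo_disjoint_Ioo, max_eq_right haj] at hdis
    by_contra! hlt
    rcases min_le_iff.1 hdis with h | h
    · linarith [hx.2, hy.1]
    · linarith

theorem tsum_eVariationOn_le (f : ℝ → E) {𝓘 : Set (Set ℝ)} {s : Set ℝ}
    (hI : ∀ I ∈ 𝓘, ∃ a b : ℝ, a < b ∧ I = Ioo a b) (hs : ∀ I ∈ 𝓘, I ⊆ s)
    (hd : 𝓘.PairwiseDisjoint id) : ∑' I : 𝓘, eVariationOn f I ≤ eVariationOn f s := by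
  choose! a b hab hIab using hI
  rw [ENNReal.tsum_eq_iSup_sum]
  refine iSup_le fun A => ?_
  have h := sum_eVariationOn_Ioo_le f (fun I : 𝓘 => a I) (fun I : 𝓘 => b I) A
    (fun I _ => hab I I.2) (fun I _ J _ hIJ => by
      rw [← hIab I I.2, ← hIab J J.2]
      exact hd I.2 J.2 fun h => hIJ (Subtype.ext h))
  have h2 : ∑ I ∈ A, eVariationOn f (I : Set ℝ) = ∑ I ∈ A, eVariationOn f (Ioo (a I) (b I)) :=
    Finset.sum_congr rfl fun I _ => by rw [← hIab I I.2]
  rw [h2]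
  refine h.trans (eVariationOn.mono f ?_)
  simp only [iUnion_subset_iff]
  intro I _
  rw [← hIab I I.2]
  exact hs I I.2

theorem LipschitzOnWith.eVariationOn_le_mul {f : ℝ → E} {s : Set ℝ} {a b K : ℝ} (hK : 0 ≤ K)
    (hs : s ⊆ Icc a b) (h : ∀ x ∈ s, ∀ y ∈ s, ‖f x - f y‖ ≤ K * |x - y|) :
    eVariationOn f s ≤ ENNReal.ofReal (K * (b - a)) := by
  have hL : LipschitzOnWith K.toNNReal f s := LipschitzOnWith.of_dist_le_mul fun x hx y hy => by
    rw [dist_eq_norm, Real.dist_eq, Real.coe_toNNReal _ hK]; exact h x hx y hy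
  have h1 := hL.comp_eVariationOn_le (g := id) (s := s) (mapsTo_id s)
  refine h1.trans ?_
  rw [ENNReal.ofReal_mul hK]
  refine mul_le_mul' le_rfl ((eVariationOn.mono _ hs).trans (eVariationOn_id_Icc a b).le)

theorem eVariationOn_max_zero_le (f : ℝ → ℝ) (s : Set ℝ) :
    eVariationOn (fun x => max (f x) 0) s ≤ eVariationOn f s := by
  have hL : LipschitzOnWith 1 (fun x : ℝ => max x 0) univ :=
    LipschitzOnWith.of_dist_le_mul fun x _ y _ => by
      simp only [Real.dist_eq, NNReal.coe_one, one_mul]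
      have := abs_max_sub_max_le_abs x y 0
      simpa using this
  simpa [Function.comp_def] using hL.comp_eVariationOn_le (g := f) (s := s) (mapsTo_univ _ _)

/-- `‖f x‖` exceeds every other `‖f y‖` by at most `V`, hence exceeds their average by at most `V`.
This is how the L¹-norm enters the Lasota–Yorke inequality. -/
theorem norm_le_add_average {f : ℝ → E} {a b V : ℝ} (hab : a < b) (hV0 : 0 ≤ V)
    (hV : eVariationOn f (Ioo a b) ≤ ENNReal.ofReal V) (hf : IntegrableOn f (Ioo a b)) {x : ℝ}
    (hx : x ∈ Ioo a b) : ‖f x‖ ≤ V + (b - a)⁻¹ * ∫ y in Ioo a b, ‖f y‖ := by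
  have h1 : ∫ y in Ioo a b, (‖f x‖ - V) ≤ ∫ y in Ioo a b, ‖f y‖ := by
    refine setIntegral_mono_on (by simp) hf.norm measurableSet_Ioo fun y hy => ?_
    linarith [norm_le_add_of_eVariationOn_le hV0 hV hx hy]
  rw [setIntegral_const, measureReal_def, Real.volume_Ioo, ENNReal.toReal_ofReal (by linarith),
    smul_eq_mul] at h1
  have hba : 0 < b - a := by linarith
  have h2 : ‖f x‖ - V ≤ (b - a)⁻¹ * ∫ y in Ioo a b, ‖f y‖ := by
    rw [← div_eq_inv_mul, le_div_iff₀ hba, mul_comm]; exact h1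
  linarith

end Variation

/-! ### Essential variation -/

section EssVar

variable {E : Type*} [NormedAddCommGroup E] {μ : Measure ℝ} {f g : ℝ → E} {s : Set ℝ}

theorem exists_ae_eq_eVariationOn_lt {V : ℝ≥0∞} (h : essVar μ f s < V) :
    ∃ g : ℝ → E, g =ᵐ[μ.restrict s] f ∧ eVariationOn g s < V := by
  obtain ⟨g, hg⟩ := iInf_lt_iff.1 h
  exact ⟨g.1, g.2, hg⟩

theorem essVar_congr_restrict (h : f =ᵐ[μ.restrict s] g) : essVar μ f s = essVar μ g s :=
  le_antisymm (le_iInf fun k => essVar_le (k.2.trans h.symm))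
    (le_iInf fun k => essVar_le (k.2.trans h))

/-- Lower semicontinuity of the essential variation under almost everywhere convergence. -/
theorem essVar_le_of_tendsto_ae [ProperSpace E] {ι : Type*} [Countable ι] {p : Filter ι} [p.NeBot]
    {F : ι → ℝ → E} (h : ∀ᵐ x ∂μ.restrict s, Tendsto (fun i => F i x) p (𝓝 (f x)))
    (hs : MeasurableSet s) {V : ℝ} (hV : ∀ i, essVar μ (F i) s ≤ ENNReal.ofReal V) :
    essVar μ f s ≤ ENNReal.ofReal V := by
  wlog hV0 : 0 ≤ V generalizing V
  · rw [← ENNReal.ofReal_zero.trans (ENNReal.ofReal_of_nonpos (not_le.1 hV0).le).symm]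
    rw [(ENNReal.ofReal_of_nonpos (not_le.1 hV0).le)] at hV
    exact this (V := 0) (by simpa using hV) le_rfl
  refine ENNReal.le_of_forall_pos_le_add fun δ hδ _ => ?_
  have h2 : ∀ i, ∃ G : ℝ → E, G =ᵐ[μ.restrict s] F i ∧
      eVariationOn G s < ENNReal.ofReal V + δ := fun i =>
    exists_ae_eq_eVariationOn_lt ((hV i).trans_lt
      (ENNReal.lt_add_right ENNReal.ofReal_ne_top (by simpa using hδ.ne')))
  choose G hG hGV using h2
  have hall : ∀ᵐ x ∂μ.restrict s, x ∈ s ∧ Tendsto (fun i => G i x) p (𝓝 (f x)) := by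
    filter_upwards [h, ae_all_iff.2 hG, ae_restrict_mem hs] with x hx hxG hxs
    exact ⟨hxs, by simpa only [hxG] using hx⟩
  -- The chosen versions converge to `f` on `S` only, a set of full measure, and `f` has variation
  -- at most `V + δ` there. The required version is an extension of `f` from `S`; the values of `f`
  -- off `S` play no role.
  set S := {x | x ∈ s ∧ Tendsto (fun i => G i x) p (𝓝 (f x))} with hS
  have hfS : eVariationOn f S ≤ ENNReal.ofReal V + δ :=
    eVariationOn_le_of_tendsto (F := G) (p := p) (fun x hx => hx.2)
      (Eventually.of_forall fun i => (eVariationOn.mono _ fun x hx => hx.1).trans (hGV i).le)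
  rcases S.eq_empty_or_nonempty with hemp | ⟨x₀, hx₀⟩
  · have hz : ∀ᵐ x ∂μ.restrict s, False := by
      filter_upwards [hall] with x hx
      have : x ∈ S := hx
      simp [hemp] at this
    have hfz : f =ᵐ[μ.restrict s] fun _ => 0 := by
      filter_upwards [hz] with x hx
      exact hx.elim
    rw [essVar_congr_restrict hfz, essVar_zero]
    exact zero_le
  · have hfS' : eVariationOn f S ≤ ENNReal.ofReal (V + δ) := by
      rwa [ENNReal.ofReal_add hV0 (NNReal.coe_nonneg δ), ENNReal.ofReal_coe_nnreal]
    obtain ⟨g, hgf, hgV, -⟩ := exists_extension_eVariationOn_le f ⟨x₀, hx₀⟩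
      (fun x hx => norm_le_add_of_eVariationOn_le (add_nonneg hV0 δ.2) hfS' hx hx₀)
    refine (essVar_le (g := g) ?_).trans ((eVariationOn.mono _ (subset_univ _)).trans
      (hgV.trans hfS))
    filter_upwards [hall] with x hx
    exact hgf hx

end EssVar
end

noncomputable section

/-! ### Piecewise expanding maps -/

section Intervals

theorem eq_Ioo_of_isOpen_of_ordConnected {S : Set ℝ} (ho : IsOpen S) (hc : S.OrdConnected)
    (hne : S.Nonempty) (hsub : S ⊆ Icc 0 1) : ∃ a b : ℝ, 0 ≤ a ∧ a < b ∧ b ≤ 1 ∧ S = Ioo a b := by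
  have hbb : BddBelow S := ⟨0, fun x hx => (hsub hx).1⟩
  have hba : BddAbove S := ⟨1, fun x hx => (hsub hx).2⟩
  have key : S = Ioo (sInf S) (sSup S) := by
    refine Subset.antisymm (fun x hx => ?_) fun x hx => ?_
    swap
    · obtain ⟨y, hy, hyx⟩ := exists_lt_of_csInf_lt hne hx.1
      obtain ⟨z, hz, hxz⟩ := exists_lt_of_lt_csSup hne hx.2
      exact hc.out hy hz ⟨hyx.le, hxz.le⟩
    obtain ⟨ε, hε, hball⟩ := Metric.isOpen_iff.1 ho x hx
    have h1 : x - ε / 2 ∈ S := hball (by rw [Metric.mem_ball, Real.dist_eq, abs_lt]; constructor <;> linarith)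
    have h2 : x + ε / 2 ∈ S := hball (by rw [Metric.mem_ball, Real.dist_eq, abs_lt]; constructor <;> linarith)
    exact ⟨by linarith [csInf_le hbb h1], by linarith [le_csSup hba h2]⟩
  have hlt : sInf S < sSup S := by
    rw [key] at hne
    exact nonempty_Ioo.1 hne
  exact ⟨sInf S, sSup S, le_csInf hne fun x hx => (hsub hx).1, hlt,
    csSup_le hne fun x hx => (hsub hx).2, key⟩

theorem isOpen_image_of_strictMonoOn {f : ℝ → ℝ} {U : Set ℝ} (hU : IsOpen U)
    (hf : ContinuousOn f U) (hm : StrictMonoOn f U ∨ StrictAntiOn f U) : IsOpen (f '' U) := by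
  rw [isOpen_iff_mem_nhds]
  rintro _ ⟨x, hx, rfl⟩
  obtain ⟨ε, hε, hball⟩ := Metric.isOpen_iff.1 hU x hx
  have hsub : Icc (x - ε / 2) (x + ε / 2) ⊆ U := fun y hy => hball (by
    rw [Metric.mem_ball, Real.dist_eq, abs_lt]; constructor <;> linarith [hy.1, hy.2])
  have h1 : x - ε / 2 ∈ U := hsub ⟨le_rfl, by linarith⟩
  have h2 : x + ε / 2 ∈ U := hsub ⟨by linarith, le_rfl⟩
  rcases hm with hm | hm
  · refine Filter.mem_of_superset (Ioo_mem_nhds (hm h1 hx (by linarith)) (hm hx h2 (by linarith))) ?_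
    exact (intermediate_value_Ioo (by linarith) (hf.mono hsub)).trans
      (image_mono (Ioo_subset_Icc_self.trans hsub))
  · refine Filter.mem_of_superset (Ioo_mem_nhds (hm hx h2 (by linarith)) (hm h1 hx (by linarith))) ?_
    exact (intermediate_value_Ioo' (by linarith) (hf.mono hsub)).trans
      (image_mono (Ioo_subset_Icc_self.trans hsub))

theorem ordConnected_inter_preimage {f : ℝ → ℝ} {U V : Set ℝ} (hU : U.OrdConnected)
    (hV : V.OrdConnected) (hm : StrictMonoOn f U ∨ StrictAntiOn f U) :
    (U ∩ f ⁻¹' V).OrdConnected := by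
  refine ⟨fun x hx y hy z hz => ?_⟩
  have hzU : z ∈ U := hU.out hx.1 hy.1 hz
  refine ⟨hzU, ?_⟩
  rcases hm with hm | hm
  · exact hV.out hx.2 hy.2 ⟨hm.monotoneOn hx.1 hzU hz.1, hm.monotoneOn hzU hy.1 hz.2⟩
  · exact hV.out hy.2 hx.2 ⟨hm.antitoneOn hzU hy.1 hz.2, hm.antitoneOn hx.1 hzU hz.1⟩

end Intervals

/-- Piecewise expanding interval maps with bounded distortion and finitely many images: a
class of maps that contains the AFU maps and is stable under composition. -/
structure PiecewiseExpanding (T : ℝ → ℝ) (𝓘 : Set (Set ℝ)) (ρ C : ℝ) : Prop where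
  mapsTo : MapsTo T (Icc 0 1) (Icc 0 1)
  isInterval : ∀ I ∈ 𝓘, ∃ a b : ℝ, 0 ≤ a ∧ a < b ∧ b ≤ 1 ∧ I = Ioo a b
  pairwiseDisjoint : 𝓘.PairwiseDisjoint id
  full : volume (Icc (0 : ℝ) 1 \ ⋃₀ 𝓘) = 0
  differentiableAt : ∀ I ∈ 𝓘, ∀ x ∈ I, DifferentiableAt ℝ T x
  strictMonoOrAnti : ∀ I ∈ 𝓘, StrictMonoOn T I ∨ StrictAntiOn T I
  finiteImages : ((fun I : Set ℝ => T '' I) '' 𝓘).Finite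
  rho_pos : 0 < ρ
  const_nonneg : 0 ≤ C
  expanding : ∀ I ∈ 𝓘, ∀ x ∈ I, ρ ≤ |deriv T x|
  distortion : ∀ I ∈ 𝓘, ∀ x ∈ I, ∀ y ∈ I,
    |deriv T x| ≤ Real.exp (C * |T x - T y|) * |deriv T y|

/-- The partition for a composition `S ∘ T`. -/
def joinPartition (T : ℝ → ℝ) (𝓘 𝓙 : Set (Set ℝ)) : Set (Set ℝ) :=
  {K | K.Nonempty ∧ ∃ I ∈ 𝓘, ∃ J ∈ 𝓙, K = I ∩ T ⁻¹' J}

namespace PiecewiseExpanding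

variable {T : ℝ → ℝ} {𝓘 : Set (Set ℝ)} {ρ C : ℝ} {I : Set ℝ}

section
variable (h : PiecewiseExpanding T 𝓘 ρ C)
include h

theorem isOpen (hI : I ∈ 𝓘) : IsOpen I := by
  obtain ⟨a, b, -, -, -, rfl⟩ := h.isInterval I hI; exact isOpen_Ioo

theorem measurableSet (hI : I ∈ 𝓘) : MeasurableSet I := (h.isOpen hI).measurableSet

theorem nonempty (hI : I ∈ 𝓘) : I.Nonempty := by
  obtain ⟨a, b, -, hab, -, rfl⟩ := h.isInterval I hI; exact nonempty_Ioo.2 hab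

theorem ordConnected (hI : I ∈ 𝓘) : I.OrdConnected := by
  obtain ⟨a, b, -, -, -, rfl⟩ := h.isInterval I hI; exact ordConnected_Ioo

theorem subset_Icc (hI : I ∈ 𝓘) : I ⊆ Icc 0 1 := by
  obtain ⟨a, b, h0, -, h1, rfl⟩ := h.isInterval I hI
  exact fun x hx => ⟨h0.trans hx.1.le, hx.2.le.trans h1⟩

theorem countable : 𝓘.Countable :=
  h.pairwiseDisjoint.countable_of_isOpen (fun _ hI => h.isOpen hI) fun _ hI => h.nonempty hI

theorem continuousOn (hI : I ∈ 𝓘) : ContinuousOn T I := fun x hx =>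
  (h.differentiableAt I hI x hx).continuousAt.continuousWithinAt

theorem injOn (hI : I ∈ 𝓘) : InjOn T I := by
  rcases h.strictMonoOrAnti I hI with hm | hm
  exacts [hm.injOn, hm.injOn]

theorem isOpen_inter_preimage (hI : I ∈ 𝓘) {V : Set ℝ} (hV : IsOpen V) : IsOpen (I ∩ T ⁻¹' V) :=
  (h.continuousOn hI).isOpen_inter_preimage (h.isOpen hI) hV

theorem isOpen_image {U : Set ℝ} (hI : I ∈ 𝓘) (hU : IsOpen U) (hUI : U ⊆ I) :
    IsOpen (T '' U) :=
  isOpen_image_of_strictMonoOn hU ((h.continuousOn hI).mono hUI)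
    ((h.strictMonoOrAnti I hI).imp (fun hm => hm.mono hUI) fun hm => hm.mono hUI)

theorem image_eq_Ioo (hI : I ∈ 𝓘) : ∃ c d : ℝ, 0 ≤ c ∧ c < d ∧ d ≤ 1 ∧ T '' I = Ioo c d :=
  eq_Ioo_of_isOpen_of_ordConnected (h.isOpen_image hI (h.isOpen hI) Subset.rfl)
    (((h.ordConnected hI).isPreconnected.image T (h.continuousOn hI)).ordConnected)
    ((h.nonempty hI).image T) (by
      rintro _ ⟨x, hx, rfl⟩
      exact h.mapsTo (h.subset_Icc hI hx))

theorem exists_slope (hI : I ∈ 𝓘) {x y : ℝ} (hx : x ∈ I) (hy : y ∈ I) :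
    ∃ z ∈ I, T x - T y = deriv T z * (x - y) := by
  wlog hxy : x ≤ y generalizing x y
  · obtain ⟨z, hz, hz'⟩ := this hy hx (le_of_not_ge hxy)
    exact ⟨z, hz, by linarith⟩
  rcases hxy.eq_or_lt with rfl | hlt
  · exact ⟨x, hx, by simp⟩
  have hsub : Icc x y ⊆ I := (h.ordConnected hI).out hx hy
  obtain ⟨z, hz, hz'⟩ := exists_deriv_eq_slope T hlt ((h.continuousOn hI).mono hsub)
    fun w hw => (h.differentiableAt I hI w (hsub (Ioo_subset_Icc_self hw))).differentiableWithinAt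
  refine ⟨z, hsub (Ioo_subset_Icc_self hz), ?_⟩
  rw [hz']
  have : y - x ≠ 0 := by linarith
  field_simp
  ring

theorem mul_abs_sub_le (hI : I ∈ 𝓘) {x y : ℝ} (hx : x ∈ I) (hy : y ∈ I) :
    ρ * |x - y| ≤ |T x - T y| := by
  obtain ⟨z, hz, hz'⟩ := h.exists_slope hI hx hy
  rw [hz', abs_mul]
  gcongr
  exact h.expanding I hI z hz

theorem deriv_pos (hI : I ∈ 𝓘) {x : ℝ} (hx : x ∈ I) : 0 < |deriv T x| :=
  h.rho_pos.trans_le (h.expanding I hI x hx)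

theorem abs_sub_le_one (hI : I ∈ 𝓘) {x y : ℝ} (hx : x ∈ I) (hy : y ∈ I) : |T x - T y| ≤ 1 := by
  have h1 := h.mapsTo (h.subset_Icc hI hx)
  have h2 := h.mapsTo (h.subset_Icc hI hy)
  rw [abs_le]; constructor <;> linarith [h1.1, h1.2, h2.1, h2.2]

theorem distortion' (hI : I ∈ 𝓘) {x y : ℝ} (hx : x ∈ I) (hy : y ∈ I) :
    |deriv T x| ≤ Real.exp C * |deriv T y| := by
  refine (h.distortion I hI x hx y hy).trans ?_
  gcongr
  have := h.abs_sub_le_one hI hx hy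
  nlinarith [h.const_nonneg]

/-- By the mean value theorem two image points differ by at most `sup |T'|` times the length of `I`,
and distortion compares this supremum with `|T' x|`. -/
theorem volume_image_le (hI : I ∈ 𝓘) {x : ℝ} (hx : x ∈ I) :
    volume.real (T '' I) ≤ Real.exp C * |deriv T x| * volume.real I := by
  obtain ⟨c, d, -, hcd, -, him⟩ := h.image_eq_Ioo hI
  obtain ⟨a, b, -, hab, -, hIab⟩ := h.isInterval I hI
  have hvI : volume.real I = b - a := by
    rw [hIab, measureReal_def, Real.volume_Ioo, ENNReal.toReal_ofReal (by linarith)]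
  have hvT : volume.real (T '' I) = d - c := by
    rw [him, measureReal_def, Real.volume_Ioo, ENNReal.toReal_ofReal (by linarith)]
  rw [hvI, hvT]
  set K := Real.exp C * |deriv T x| * (b - a) with hK
  by_contra! hlt
  have hK0 : 0 ≤ K := by
    have : 0 < b - a := by linarith
    positivity
  -- With a third of the excess cut off at both ends, the points `c + η` and `d - η` of the image
  -- are still at distance `K + η`.
  set η := (d - c - K) / 3 with hη
  have hηp : 0 < η := by rw [hη]; linarith
  have h1 : c + η ∈ T '' I := by rw [him]; constructor <;> linarith
  have h2 : d - η ∈ T '' I := by rw [him]; constructor <;> linarith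
  obtain ⟨u, hu, hu'⟩ := h1
  obtain ⟨w, hw, hw'⟩ := h2
  obtain ⟨z, hz, hz'⟩ := h.exists_slope hI hw hu
  have h3 : |T w - T u| ≤ K := by
    rw [hz', abs_mul, hK]
    gcongr
    · exact h.distortion' hI hz hx
    · rw [hIab] at hw hu
      rw [abs_le]; constructor <;> linarith [hw.1, hw.2, hu.1, hu.2]
  have h4 := (le_abs_self _).trans h3
  rw [hu', hw'] at h4
  linarith

/-- The inverse branches have derivative at most a constant times the length of the interval. -/
theorem exists_inv_deriv_le :
    ∃ D : ℝ, 0 ≤ D ∧ ∀ I ∈ 𝓘, ∀ x ∈ I, |deriv T x|⁻¹ ≤ D * volume.real I := by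
  -- Finitely many images have a positive minimal length `δ`; since `|TI| ≤ e^C |T'x| |I|`, a short
  -- interval must be strongly expanded.
  obtain ⟨δ, hδ, hδ'⟩ : ∃ δ : ℝ, 0 < δ ∧ ∀ I ∈ 𝓘, δ ≤ volume.real (T '' I) := by
    rcases 𝓘.eq_empty_or_nonempty with hemp | hne
    · exact ⟨1, one_pos, by simp [hemp]⟩
    obtain ⟨K, ⟨I, hI, rfl⟩, hmin⟩ := Set.exists_min_image _ (fun K => volume.real K) h.finiteImages
      (hne.image _)
    refine ⟨_, ?_, fun J hJ => hmin _ ⟨J, hJ, rfl⟩⟩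
    obtain ⟨c, d, -, hcd, -, him⟩ := h.image_eq_Ioo hI
    simp only [him]
    rw [measureReal_def, Real.volume_Ioo, ENNReal.toReal_ofReal (by linarith)]
    linarith
  refine ⟨Real.exp C / δ, by positivity, fun I hI x hx => ?_⟩
  have hp := h.deriv_pos hI hx
  have h1 := (hδ' I hI).trans (h.volume_image_le hI hx)
  rw [inv_le_iff_one_le_mul₀ hp]
  rw [div_mul_eq_mul_div, div_mul_eq_mul_div, le_div_iff₀ hδ]
  linarith

theorem lintegral_image (hI : I ∈ 𝓘) {s : Set ℝ} (hs : MeasurableSet s) (hsI : s ⊆ I)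
    (g : ℝ → ℝ≥0∞) :
    ∫⁻ x in T '' s, g x = ∫⁻ x in s, ENNReal.ofReal |deriv T x| * g (T x) :=
  lintegral_image_eq_lintegral_abs_deriv_mul hs
    (fun x hx => (h.differentiableAt I hI x (hsI hx)).hasDerivAt.hasDerivWithinAt)
    ((h.injOn hI).mono hsI) g

theorem mul_volume_le (hI : I ∈ 𝓘) {s : Set ℝ} (hs : MeasurableSet s) (hsI : s ⊆ I) :
    ENNReal.ofReal ρ * volume s ≤ volume (T '' s) := by
  have h1 := h.lintegral_image hI hs hsI fun _ => 1
  simp only [mul_one, lintegral_const, one_mul, Measure.restrict_apply_univ] at h1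
  rw [h1, ← setLIntegral_const]
  exact setLIntegral_mono_ae' hs (Eventually.of_forall fun x hx =>
    ENNReal.ofReal_le_ofReal (h.expanding I hI x (hsI hx)))

/-- A branch expands Lebesgue measure by at least `ρ > 0`, so only null sets have null images. The
measurable superset is needed because that comparison is for measurable sets. -/
theorem volume_inter_preimage_eq_zero (hI : I ∈ 𝓘) {N : Set ℝ} (hN : volume N = 0) :
    volume (I ∩ T ⁻¹' N) = 0 := by
  obtain ⟨N', hNN', hN', hN'0⟩ := exists_measurable_superset_of_null hN
  have hcont := h.continuousOn hI
  have hm : MeasurableSet (I ∩ T ⁻¹' N') := by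
    have : I ∩ T ⁻¹' N' = Subtype.val '' (I.domRestrict T ⁻¹' N') := by
      ext x; simp [and_comm, Set.domRestrict]
    rw [this]
    exact (MeasurableEmbedding.subtype_coe (h.measurableSet hI)).measurableSet_image.2
      (hcont.domRestrict.measurable hN')
  have h1 := h.mul_volume_le hI hm inter_subset_left
  have h2 : volume (T '' (I ∩ T ⁻¹' N')) = 0 := by
    refine measure_mono_null ?_ hN'0
    rintro _ ⟨x, hx, rfl⟩
    exact hx.2
  rw [h2, nonpos_iff_eq_zero, mul_eq_zero] at h1
  rcases h1 with h1 | h1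
  · exact absurd (ENNReal.ofReal_eq_zero.1 h1) (not_le.2 h.rho_pos)
  · exact measure_mono_null (inter_subset_inter_right _ (preimage_mono hNN')) h1

theorem mono_const {C' : ℝ} (hC : C ≤ C') : PiecewiseExpanding T 𝓘 ρ C' :=
  { h with
    const_nonneg := h.const_nonneg.trans hC
    distortion := fun I hI x hx y hy => (h.distortion I hI x hx y hy).trans (by gcongr) }

end

/-- Let `(c, d)` be one of the finitely many images of `T`. An interval `J` of `S` that meets it
either lies inside, and then contributes a full image `S(J)`, or contains `c` or `d`, which happens
for at most two `J`. -/
theorem finite_join_images {S : ℝ → ℝ} {𝓙 : Set (Set ℝ)} {ρS CS : ℝ}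
    (hS : PiecewiseExpanding S 𝓙 ρS CS) (h : PiecewiseExpanding T 𝓘 ρ C) :
    ((fun K : Set ℝ => (S ∘ T) '' K) '' joinPartition T 𝓘 𝓙).Finite := by
  have key : ∀ K ∈ (fun I : Set ℝ => T '' I) '' 𝓘,
      ((fun J => S '' (K ∩ J)) '' {J | J ∈ 𝓙 ∧ (K ∩ J).Nonempty}).Finite := by
    rintro _ ⟨I, hI, rfl⟩
    obtain ⟨c, d, -, -, -, him⟩ := h.image_eq_Ioo hI
    simp only [him]
    have hsub : ∀ x : ℝ, {J | J ∈ 𝓙 ∧ x ∈ J}.Subsingleton := fun x J hJ J' hJ' => by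
      by_contra hne
      exact Set.disjoint_left.1 (hS.pairwiseDisjoint hJ.1 hJ'.1 hne) hJ.2 hJ'.2
    refine (hS.finiteImages.union
      (((hsub c).finite.union (hsub d).finite).image fun J => S '' (Ioo c d ∩ J))).subset ?_
    rintro _ ⟨J, ⟨hJ, x, hx, hxJ⟩, rfl⟩
    obtain ⟨a, b, -, hab, -, rfl⟩ := hS.isInterval J hJ
    by_cases hc : c ∈ Ioo a b
    · exact Or.inr ⟨_, Or.inl ⟨hJ, hc⟩, rfl⟩
    by_cases hd : d ∈ Ioo a b
    · exact Or.inr ⟨_, Or.inr ⟨hJ, hd⟩, rfl⟩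
    refine Or.inl ⟨_, hJ, ?_⟩
    have : Ioo a b ⊆ Ioo c d := by
      intro y hy
      simp only [mem_Ioo, not_and_or, not_lt] at *
      constructor
      · rcases hc with hc | hc <;> linarith
      · rcases hd with hd | hd <;> linarith
    simp only [inter_eq_self_of_subset_right this]
  refine (h.finiteImages.biUnion key).subset ?_
  rintro _ ⟨K, ⟨hne, I, hI, J, hJ, rfl⟩, rfl⟩
  refine mem_biUnion (mem_image_of_mem _ hI) ⟨J, ⟨hJ, ?_⟩, ?_⟩
  · obtain ⟨x, hx⟩ := hne
    exact ⟨T x, mem_image_of_mem _ hx.1, hx.2⟩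
  · simp only [image_comp, image_inter_preimage]

/-- Distortions multiply. That of `S` is already expressed by `|STx - STy|`; that of `T` is
expressed by `|Tx - Ty|`, which is at most `|STx - STy| / ρS`. Hence the constant `CS + C / ρS`. -/
theorem comp {S : ℝ → ℝ} {𝓙 : Set (Set ℝ)} {ρS CS : ℝ} (hS : PiecewiseExpanding S 𝓙 ρS CS)
    (h : PiecewiseExpanding T 𝓘 ρ C) :
    PiecewiseExpanding (S ∘ T) (joinPartition T 𝓘 𝓙) (ρS * ρ) (CS + C / ρS) where
  mapsTo := hS.mapsTo.comp h.mapsTo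
  isInterval := by
    rintro K ⟨hne, I, hI, J, hJ, rfl⟩
    exact eq_Ioo_of_isOpen_of_ordConnected (h.isOpen_inter_preimage hI (hS.isOpen hJ))
      (ordConnected_inter_preimage (h.ordConnected hI) (hS.ordConnected hJ)
        (h.strictMonoOrAnti I hI)) hne (inter_subset_left.trans (h.subset_Icc hI))
  pairwiseDisjoint := by
    rintro K ⟨hne, I, hI, J, hJ, rfl⟩ K' ⟨hne', I', hI', J', hJ', rfl⟩ hKK
    by_cases hII : I = I'
    · subst hII
      have hJJ : J ≠ J' := fun hJJ => hKK (by rw [hJJ])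
      refine Set.disjoint_left.2 fun x hx hx' => ?_
      exact Set.disjoint_left.1 (hS.pairwiseDisjoint hJ hJ' hJJ) hx.2 hx'.2
    · refine Set.disjoint_left.2 fun x hx hx' => ?_
      exact Set.disjoint_left.1 (h.pairwiseDisjoint hI hI' hII) hx.1 hx'.1
  full := by
    have : Icc (0 : ℝ) 1 \ ⋃₀ joinPartition T 𝓘 𝓙 ⊆ (Icc (0 : ℝ) 1 \ ⋃₀ 𝓘) ∪
        ⋃ I ∈ 𝓘, I ∩ T ⁻¹' (Icc (0 : ℝ) 1 \ ⋃₀ 𝓙) := by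
      rintro x ⟨hx, hx'⟩
      by_cases hxI : x ∈ ⋃₀ 𝓘
      · right
        obtain ⟨I, hI, hxI⟩ := hxI
        refine mem_biUnion hI ⟨hxI, h.mapsTo hx, ?_⟩
        rintro ⟨J, hJ, hxJ⟩
        exact hx' ⟨I ∩ T ⁻¹' J, ⟨⟨x, hxI, hxJ⟩, I, hI, J, hJ, rfl⟩, hxI, hxJ⟩
      · exact Or.inl ⟨hx, hxI⟩
    refine measure_mono_null this (measure_union_null h.full ?_)
    exact (measure_biUnion_null_iff h.countable).2 fun I hI =>
      h.volume_inter_preimage_eq_zero hI hS.full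
  differentiableAt := by
    rintro K ⟨hne, I, hI, J, hJ, rfl⟩ x hx
    exact (hS.differentiableAt J hJ _ hx.2).comp x (h.differentiableAt I hI x hx.1)
  strictMonoOrAnti := by
    rintro K ⟨hne, I, hI, J, hJ, rfl⟩
    have hmaps : MapsTo T (I ∩ T ⁻¹' J) J := fun x hx => hx.2
    rcases h.strictMonoOrAnti I hI with hm | hm <;>
      rcases hS.strictMonoOrAnti J hJ with hm' | hm'
    · exact Or.inl (hm'.comp (hm.mono inter_subset_left) hmaps)
    · exact Or.inr (hm'.comp_strictMonoOn (hm.mono inter_subset_left) hmaps)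
    · exact Or.inr (hm'.comp_strictAntiOn (hm.mono inter_subset_left) hmaps)
    · exact Or.inl (hm'.comp (hm.mono inter_subset_left) hmaps)
  finiteImages := finite_join_images hS h
  rho_pos := mul_pos hS.rho_pos h.rho_pos
  const_nonneg := add_nonneg hS.const_nonneg (div_nonneg h.const_nonneg hS.rho_pos.le)
  expanding := by
    rintro K ⟨hne, I, hI, J, hJ, rfl⟩ x hx
    rw [deriv_comp x (hS.differentiableAt J hJ _ hx.2) (h.differentiableAt I hI x hx.1), abs_mul]
    have h1 := hS.rho_pos
    have h2 := h.rho_pos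
    exact mul_le_mul (hS.expanding J hJ _ hx.2) (h.expanding I hI x hx.1) h2.le (abs_nonneg _)
  distortion := by
    rintro K ⟨hne, I, hI, J, hJ, rfl⟩ x hx y hy
    rw [deriv_comp x (hS.differentiableAt J hJ _ hx.2) (h.differentiableAt I hI x hx.1), abs_mul,
      deriv_comp y (hS.differentiableAt J hJ _ hy.2) (h.differentiableAt I hI y hy.1), abs_mul]
    have h1 := hS.distortion J hJ _ hx.2 _ hy.2
    have h2 := h.distortion I hI x hx.1 y hy.1
    have h3 : |T x - T y| ≤ |S (T x) - S (T y)| / ρS := by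
      rw [le_div_iff₀ hS.rho_pos, mul_comm]
      exact hS.mul_abs_sub_le hJ hx.2 hy.2
    have h4 : C * |T x - T y| ≤ C / ρS * |S (T x) - S (T y)| := by
      calc C * |T x - T y| ≤ C * (|S (T x) - S (T y)| / ρS) := by
            gcongr; exact h.const_nonneg
        _ = _ := by ring
    calc |deriv S (T x)| * |deriv T x|
        ≤ (Real.exp (CS * |S (T x) - S (T y)|) * |deriv S (T y)|) *
          (Real.exp (C / ρS * |S (T x) - S (T y)|) * |deriv T y|) := by
          gcongr
          exact h2.trans (by gcongr)
      _ = _ := by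
          rw [Function.comp_apply, Function.comp_apply, add_mul, Real.exp_add]; ring

theorem id_unit : PiecewiseExpanding id {Ioo (0 : ℝ) 1} 1 0 where
  mapsTo := mapsTo_id _
  isInterval := by rintro I rfl; exact ⟨0, 1, le_rfl, one_pos, le_rfl, rfl⟩
  pairwiseDisjoint := pairwiseDisjoint_singleton _ _
  full := by
    rw [sUnion_singleton]
    refine measure_mono_null (t := {0, 1}) ?_ ((Set.toFinite _).measure_zero _)
    rintro x ⟨hx, hx'⟩
    simp only [mem_Icc, mem_Ioo, not_and_or, not_lt] at hx hx'
    rcases hx' with hx' | hx'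
    · left; linarith
    · right; simp only [mem_singleton_iff]; linarith
  differentiableAt := fun _ _ _ _ => differentiableAt_id
  strictMonoOrAnti := fun _ _ => Or.inl (strictMono_id.strictMonoOn _)
  finiteImages := (finite_singleton _).image _
  rho_pos := one_pos
  const_nonneg := le_rfl
  expanding := by intro I _ x _; simp
  distortion := by intro I _ x _ y _; simp

theorem iterate (h : PiecewiseExpanding T 𝓘 ρ C) (hρ : 1 < ρ) (n : ℕ) :
    ∃ 𝓙, PiecewiseExpanding T^[n] 𝓙 (ρ ^ n) (C * ρ / (ρ - 1)) := by
  have hρ1 : 0 < ρ - 1 := by linarith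
  -- The constants of the iterates are the partial sums `C(1 + ρ⁻¹ + ⋯ + ρ^{-(n-1)})` of a geometric
  -- series; only their closed form reproduces itself in the induction.
  have key : ∃ 𝓙, PiecewiseExpanding T^[n] 𝓙 (ρ ^ n) (C * ρ / (ρ - 1) * (1 - (ρ ^ n)⁻¹)) := by
    induction n with
    | zero => exact ⟨_, by simpa using id_unit⟩
    | succ n ih =>
      obtain ⟨𝓙, hJ⟩ := ih
      refine ⟨joinPartition T 𝓘 𝓙, ?_⟩
      have := hJ.comp h
      rw [← Function.iterate_succ, ← pow_succ] at this
      convert this using 1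
      have h1 : ρ ^ n ≠ 0 := by positivity
      have h2 : ρ ≠ 0 := by positivity
      rw [pow_succ]
      field_simp
      ring
  obtain ⟨𝓙, hJ⟩ := key
  refine ⟨𝓙, hJ.mono_const ?_⟩
  have h1 : 0 ≤ C * ρ / (ρ - 1) := div_nonneg (mul_nonneg h.const_nonneg (by linarith)) hρ1.le
  have h2 : 0 ≤ (ρ ^ n)⁻¹ := by positivity
  nlinarith

end PiecewiseExpanding

/-- The derivative of `log |T'|` with respect to the variable `Tx` is `T''/(T')²`, which is bounded
by Adler's condition. Cauchy's mean value theorem for the pair `log T'`, `T` thus bounds the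
increment of the logarithm by a multiple of `|Tx - Ty|`. -/
theorem IsAFU.exists_piecewiseExpanding {T : ℝ → ℝ} {𝓘 : Set (Set ℝ)} (h : IsAFU T 𝓘) :
    ∃ ρ C : ℝ, 1 < ρ ∧ PiecewiseExpanding T 𝓘 ρ C := by
  obtain ⟨ρ, hρ, hexp⟩ := h.expanding
  obtain ⟨C₀, hC₀⟩ := h.adler
  have hopen : ∀ I ∈ 𝓘, IsOpen I := fun I hI => by
    obtain ⟨a, b, -, -, -, rfl⟩ := h.isInterval I hI; exact isOpen_Ioo
  have hconn : ∀ I ∈ 𝓘, I.OrdConnected := fun I hI => by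
    obtain ⟨a, b, -, -, -, rfl⟩ := h.isInterval I hI; exact ordConnected_Ioo
  have hdiff : ∀ I ∈ 𝓘, ∀ x ∈ I, DifferentiableAt ℝ T x := fun I hI x hx =>
    ((h.contDiffOn I hI).differentiableOn (by norm_num)).differentiableAt ((hopen I hI).mem_nhds hx)
  have hdiff2 : ∀ I ∈ 𝓘, ∀ x ∈ I, DifferentiableAt ℝ (deriv T) x := fun I hI x hx => by
    have h1 : ContDiffOn ℝ 1 (deriv T) I :=
      (h.contDiffOn I hI).deriv_of_isOpen (hopen I hI) (by norm_num)
    exact (h1.differentiableOn (by norm_num)).differentiableAt ((hopen I hI).mem_nhds hx)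
  refine ⟨ρ, max C₀ 0, hρ, ⟨h.mapsTo, h.isInterval, h.pairwiseDisjoint, h.full, hdiff,
    h.strictMonoOrAnti, h.finiteImages, by linarith, le_max_right _ _, hexp, ?_⟩⟩
  intro I hI
  have hpos : ∀ x ∈ I, 0 < |deriv T x| := fun x hx => by linarith [hexp I hI x hx]
  have key : ∀ x ∈ I, ∀ y ∈ I, x < y →
      |Real.log (deriv T y) - Real.log (deriv T x)| ≤ max C₀ 0 * |T y - T x| := by
    intro x hx y hy hxy
    have hsub : Icc x y ⊆ I := (hconn I hI).out hx hy
    have hne : ∀ z ∈ I, deriv T z ≠ 0 := fun z hz => abs_pos.1 (hpos z hz)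
    have hd : ∀ z ∈ I, HasDerivAt (fun w => Real.log (deriv T w)) (deriv (deriv T) z / deriv T z) z :=
      fun z hz => (hdiff2 I hI z hz).hasDerivAt.log (hne z hz)
    obtain ⟨z, hz, hz'⟩ := exists_ratio_deriv_eq_ratio_slope (fun w => Real.log (deriv T w)) hxy
      (fun w hw => (hd w (hsub hw)).continuousAt.continuousWithinAt)
      (fun w hw => (hd w (hsub (Ioo_subset_Icc_self hw))).differentiableAt.differentiableWithinAt)
      T (fun w hw => (hdiff I hI w (hsub hw)).continuousAt.continuousWithinAt)
      (fun w hw => (hdiff I hI w (hsub (Ioo_subset_Icc_self hw))).differentiableWithinAt)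
    have hzI := hsub (Ioo_subset_Icc_self hz)
    rw [(hd z hzI).deriv] at hz'
    have h3 : Real.log (deriv T y) - Real.log (deriv T x) =
        deriv (deriv T) z / deriv T z ^ 2 * (T y - T x) := by
      have h4 := hne z hzI
      rw [eq_comm, ← mul_right_inj' h4]
      rw [mul_comm (deriv T z) (_ - _), ← hz']
      field_simp
    rw [h3, abs_mul]
    gcongr
    exact (hC₀ I hI z hzI).trans (le_max_left _ _)
  intro x hx y hy
  have hlog : Real.log |deriv T x| - Real.log |deriv T y| ≤ max C₀ 0 * |T x - T y| := by
    rw [Real.log_abs, Real.log_abs]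
    rcases lt_trichotomy x y with hxy | rfl | hxy
    · have := key x hx y hy hxy
      rw [abs_sub_comm, abs_sub_comm (T y)] at this
      exact (le_abs_self _).trans this
    · simp
    · exact (le_abs_self _).trans (key y hy x hx hxy)
  rw [← Real.exp_log (hpos x hx)]
  conv_rhs => rw [← Real.exp_log (hpos y hy)]
  rw [← Real.exp_add]
  exact Real.exp_le_exp.2 (by linarith)
end

noncomputable section

/-! ### The transfer operator of a piecewise expanding map -/

/-- Lebesgue measure on `[0,1]`. -/
abbrev unitLebesgue : Measure ℝ := volume.restrict (Icc 0 1)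

theorem integrable_tsum_of_summable_integral_norm {ι X E : Type*} [Countable ι] [MeasurableSpace X]
    {μ : Measure X} [NormedAddCommGroup E] [NormedSpace ℝ E] [CompleteSpace E] {F : ι → X → E}
    (hF : ∀ i, Integrable (F i) μ) (hs : Summable fun i => ∫ a, ‖F i a‖ ∂μ) :
    Integrable (fun x => ∑' i, F i x) μ := by
  have hl : ∑' i, ∫⁻ x, ‖F i x‖ₑ ∂μ ≠ ∞ := by
    have h1 : ∀ i, ∫⁻ x, ‖F i x‖ₑ ∂μ = ENNReal.ofReal (∫ a, ‖F i a‖ ∂μ) := fun i =>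
      (ofReal_integral_norm_eq_lintegral_enorm (hF i)).symm
    simp only [h1]
    exact hs.tsum_ofReal_ne_top
  have hae : ∀ᵐ x ∂μ, Summable fun i => ‖F i x‖ :=
    summable_norm_of_tsum_eLpNorm_ne_top le_rfl (fun i => (hF i).1)
      (by simpa only [eLpNorm_one_eq_lintegral_enorm] using hl)
  refine ⟨?_, ?_⟩
  · refine aestronglyMeasurable_of_tendsto_ae (atTop : Filter (Finset ι))
      (f := fun A x => ∑ i ∈ A, F i x)
      (fun A => Finset.aestronglyMeasurable_fun_sum _ fun i _ => (hF i).1) ?_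
    filter_upwards [hae] with x hx
    exact hx.of_norm.hasSum
  · refine lt_of_le_of_lt (lintegral_mono fun x => enorm_tsum_le_tsum_enorm) ?_
    rw [lintegral_tsum fun i => (hF i).1.enorm]
    exact hl.lt_top

section Branches

variable {E : Type*} [NormedAddCommGroup E] [NormedSpace ℝ E]

/-- The contribution of the branch of `T` on `I` to the transfer operator. -/
def branchTerm (T : ℝ → ℝ) (I : Set ℝ) (f : ℝ → E) : ℝ → E :=
  (T '' I).indicator fun x =>
    |deriv T (Function.invFunOn T I x)|⁻¹ • f (Function.invFunOn T I x)

/-- The transfer operator of `T` with respect to Lebesgue measure. -/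
def transfer (T : ℝ → ℝ) (𝓘 : Set (Set ℝ)) (f : ℝ → E) (x : ℝ) : E :=
  ∑' I : 𝓘, branchTerm T I f x

theorem branchTerm_of_mem {T : ℝ → ℝ} {I : Set ℝ} (f : ℝ → E) {x : ℝ} (hx : x ∈ T '' I) :
    branchTerm T I f x =
      |deriv T (Function.invFunOn T I x)|⁻¹ • f (Function.invFunOn T I x) :=
  indicator_of_mem hx _

theorem branchTerm_of_notMem {T : ℝ → ℝ} {I : Set ℝ} (f : ℝ → E) {x : ℝ} (hx : x ∉ T '' I) :
    branchTerm T I f x = 0 :=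
  indicator_of_notMem hx _

/-- A factor `g ∘ T` is constant along the fibres of `T` and comes out of the sum over branches.
Through this the duality relations below reduce to the preservation of integrals. -/
theorem branchTerm_smul_comp {𝕜 : Type*} [NormedField 𝕜] [NormedSpace 𝕜 E]
    [SMulCommClass ℝ 𝕜 E] (T : ℝ → ℝ) (I : Set ℝ) (f : ℝ → E) (g : ℝ → 𝕜) (x : ℝ) :
    branchTerm T I (fun y => g (T y) • f y) x = g x • branchTerm T I f x := by
  by_cases hx : x ∈ T '' I
  · rw [branchTerm_of_mem _ hx, branchTerm_of_mem _ hx, Function.invFunOn_eq hx, smul_comm]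
  · rw [branchTerm_of_notMem _ hx, branchTerm_of_notMem _ hx, smul_zero]

theorem norm_branchTerm (T : ℝ → ℝ) (I : Set ℝ) (f : ℝ → E) (x : ℝ) :
    ‖branchTerm T I f x‖ = branchTerm T I (fun y => ‖f y‖) x := by
  by_cases hx : x ∈ T '' I
  · rw [branchTerm_of_mem _ hx, branchTerm_of_mem _ hx, norm_smul, norm_inv, Real.norm_eq_abs,
      abs_abs, smul_eq_mul]
  · rw [branchTerm_of_notMem _ hx, branchTerm_of_notMem _ hx, norm_zero]

namespace PiecewiseExpanding

variable {T : ℝ → ℝ} {𝓘 : Set (Set ℝ)} {ρ C : ℝ} {I : Set ℝ}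

section
variable (h : PiecewiseExpanding T 𝓘 ρ C)
include h

theorem measurableSet_image (hI : I ∈ 𝓘) : MeasurableSet (T '' I) :=
  (h.isOpen_image hI (h.isOpen hI) Subset.rfl).measurableSet

theorem image_subset_Icc (hI : I ∈ 𝓘) : T '' I ⊆ Icc 0 1 := by
  rintro _ ⟨x, hx, rfl⟩
  exact h.mapsTo (h.subset_Icc hI hx)

theorem smul_branchTerm (hI : I ∈ 𝓘) (f : ℝ → E) {x : ℝ} (hx : x ∈ I) :
    |deriv T x| • branchTerm T I f (T x) = f x := by
  rw [branchTerm_of_mem _ (mem_image_of_mem T hx), (h.injOn hI).leftInvOn_invFunOn hx, smul_smul,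
    mul_inv_cancel₀ (h.deriv_pos hI hx).ne', one_smul]

theorem integrable_branchTerm (hI : I ∈ 𝓘) {f : ℝ → E} (hf : IntegrableOn f I) :
    Integrable (branchTerm T I f) unitLebesgue := by
  have h1 : IntegrableOn (branchTerm T I f) (T '' I) := by
    rw [integrableOn_image_iff_integrableOn_abs_deriv_smul (h.measurableSet hI)
      (fun x hx => (h.differentiableAt I hI x hx).hasDerivAt.hasDerivWithinAt) (h.injOn hI)]
    exact hf.congr_fun (fun x hx => (h.smul_branchTerm hI f hx).symm) (h.measurableSet hI)
  have h2 : Integrable ((T '' I).indicator (branchTerm T I f)) :=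
    (integrable_indicator_iff (h.measurableSet_image hI)).2 h1
  have h3 : (T '' I).indicator (branchTerm T I f) = branchTerm T I f := by
    unfold branchTerm; rw [indicator_indicator, inter_self]
  rw [h3] at h2
  exact h2.restrict

theorem integral_branchTerm (hI : I ∈ 𝓘) (f : ℝ → E) :
    ∫ x, branchTerm T I f x ∂unitLebesgue = ∫ x in I, f x := by
  have h3 : (T '' I).indicator (branchTerm T I f) = branchTerm T I f := by
    unfold branchTerm; rw [indicator_indicator, inter_self]
  rw [← h3, setIntegral_indicator (h.measurableSet_image hI),
    inter_eq_self_of_subset_right (h.image_subset_Icc hI),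
    integral_image_eq_integral_abs_deriv_smul (h.measurableSet hI)
      (fun x hx => (h.differentiableAt I hI x hx).hasDerivAt.hasDerivWithinAt) (h.injOn hI)]
  exact setIntegral_congr_fun (h.measurableSet hI) fun x hx => h.smul_branchTerm hI f hx

theorem restrict_iUnion : volume.restrict (⋃ I : 𝓘, (I : Set ℝ)) = unitLebesgue := by
  refine Measure.restrict_congr_set ?_
  rw [← sUnion_eq_iUnion]
  refine (LE.le.eventuallyLE ?_).antisymm ?_
  · exact sUnion_subset fun I hI => h.subset_Icc hI
  · rw [ae_le_set]; exact h.full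

theorem hasSum_integral {f : ℝ → E} (hf : Integrable f unitLebesgue) :
    HasSum (fun I : 𝓘 => ∫ x in I, f x) (∫ x, f x ∂unitLebesgue) := by
  have := h.countable.to_subtype
  rw [← h.restrict_iUnion]
  refine hasSum_integral_iUnion (fun I => h.measurableSet I.2) (fun I J hIJ =>
    h.pairwiseDisjoint I.2 J.2 fun hh => hIJ (Subtype.ext hh)) ?_
  rw [IntegrableOn, h.restrict_iUnion]
  exact hf

omit [NormedSpace ℝ E] in
theorem integrableOn {f : ℝ → E} (hf : Integrable f unitLebesgue) (hI : I ∈ 𝓘) :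
    IntegrableOn f I := IntegrableOn.mono_set hf (h.subset_Icc hI)

theorem summable_integral_norm_branchTerm {f : ℝ → E} (hf : Integrable f unitLebesgue) :
    Summable fun I : 𝓘 => ∫ x, ‖branchTerm T I f x‖ ∂unitLebesgue := by
  refine (h.hasSum_integral hf.norm).summable.congr fun I => ?_
  simp only [norm_branchTerm]
  exact (h.integral_branchTerm I.2 _).symm

theorem integrable_transfer [CompleteSpace E] {f : ℝ → E} (hf : Integrable f unitLebesgue) :
    Integrable (transfer T 𝓘 f) unitLebesgue := by
  have := h.countable.to_subtype
  exact integrable_tsum_of_summable_integral_norm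
    (fun I : 𝓘 => h.integrable_branchTerm I.2 (h.integrableOn hf I.2))
    (h.summable_integral_norm_branchTerm hf)

theorem integral_transfer [CompleteSpace E] {f : ℝ → E} (hf : Integrable f unitLebesgue) :
    ∫ x, transfer T 𝓘 f x ∂unitLebesgue = ∫ x, f x ∂unitLebesgue := by
  have := h.countable.to_subtype
  have h1 := hasSum_integral_of_summable_integral_norm
    (fun I : 𝓘 => h.integrable_branchTerm I.2 (h.integrableOn hf I.2))
    (h.summable_integral_norm_branchTerm hf)
  have h2 := h.hasSum_integral hf
  simp only [h.integral_branchTerm (Subtype.coe_prop _)] at h1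
  exact h1.unique h2

theorem isTransferOf_transfer (hTm : Measurable T) {f : ℝ → ℂ} (hf : Integrable f unitLebesgue) :
    IsTransferOf unitLebesgue T f (transfer T 𝓘 f) := by
  refine ⟨h.integrable_transfer hf, fun g hg ⟨K, hK⟩ => ?_⟩
  have h1 : ∀ x, transfer T 𝓘 f x * g x = transfer T 𝓘 (fun y => g (T y) • f y) x := by
    intro x
    simp only [transfer, branchTerm_smul_comp]
    rw [mul_comm, ← smul_eq_mul, ← tsum_const_smul'']
  simp only [h1]
  rw [h.integral_transfer]
  · simp only [smul_eq_mul, mul_comm]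
  · exact hf.bdd_smul K (hg.comp hTm).aestronglyMeasurable (Eventually.of_forall fun x => hK _)

theorem setIntegral_transfer [CompleteSpace E] (hTm : Measurable T) {f : ℝ → E}
    (hf : Integrable f unitLebesgue) {A : Set ℝ} (hA : MeasurableSet A) :
    ∫ x in A, transfer T 𝓘 f x ∂unitLebesgue = ∫ x in T ⁻¹' A, f x ∂unitLebesgue := by
  have h1 : A.indicator (transfer T 𝓘 f) =
      transfer T 𝓘 (fun y => A.indicator (fun _ => (1 : ℝ)) (T y) • f y) := by
    ext x
    simp only [transfer, branchTerm_smul_comp]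
    by_cases hx : x ∈ A <;> simp [hx, transfer]
  have h2 : (fun y => A.indicator (fun _ => (1 : ℝ)) (T y) • f y) = (T ⁻¹' A).indicator f := by
    ext x
    by_cases hx : T x ∈ A
    · simp [hx]
    · simp [hx]
  rw [← integral_indicator hA, h1, h2, h.integral_transfer (hf.indicator (hTm hA)),
    integral_indicator (hTm hA)]

/-! ### Variation of the image -/

theorem eVariationOn_branchTerm_le [ProperSpace E] (hI : I ∈ 𝓘) {f : ℝ → E} {s M V : ℝ}
    (hs : ∀ x ∈ I, |deriv T x|⁻¹ ≤ s) (hM : ∀ x ∈ I, ‖f x‖ ≤ M) (hV0 : 0 ≤ V)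
    (hV : eVariationOn f I ≤ ENNReal.ofReal V) :
    eVariationOn (branchTerm T I f) univ ≤
      ENNReal.ofReal (s * V + (C * Real.exp C + 2) * (s * M)) := by
  obtain ⟨c, d, hc, hcd, hd, him⟩ := h.image_eq_Ioo hI
  obtain ⟨x₀, hx₀⟩ := h.nonempty hI
  have hs0 : 0 ≤ s := (inv_nonneg.2 (abs_nonneg _)).trans (hs x₀ hx₀)
  have hM0 : 0 ≤ M := (norm_nonneg _).trans (hM x₀ hx₀)
  have hC0 := h.const_nonneg
  set y := Function.invFunOn T I with hy
  have hyI : ∀ x ∈ Ioo c d, y x ∈ I := fun x hx => Function.invFunOn_mem (him.symm ▸ hx : x ∈ T '' I)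
  have hTy : ∀ x ∈ Ioo c d, T (y x) = x := fun x hx => Function.invFunOn_eq (him.symm ▸ hx : x ∈ T '' I)
  have hfy : eVariationOn (f ∘ y) (Ioo c d) ≤ ENNReal.ofReal V := by
    refine le_trans ?_ hV
    rcases h.strictMonoOrAnti I hI with hm | hm
    · refine eVariationOn.comp_le_of_monotoneOn f y (fun u hu w hw huw => ?_) hyI
      by_contra! hlt
      have := hm (hyI w hw) (hyI u hu) hlt
      rw [hTy u hu, hTy w hw] at this
      linarith
    · refine eVariationOn.comp_le_of_antitoneOn f y (fun u hu w hw huw => ?_) hyI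
      by_contra! hlt
      have := hm (hyI u hu) (hyI w hw) hlt
      rw [hTy u hu, hTy w hw] at this
      linarith
  -- By distortion the ratio of the two weights is at most `exp t` with `t = C|u - w| ≤ C`, and `exp
  -- t - 1 ≤ t exp t ≤ t exp C`. So the weight is Lipschitz on the image with constant `C e^C s`.
  have hw1 : ∀ u ∈ Ioo c d, ∀ w ∈ Ioo c d, |deriv T (y u)|⁻¹ - |deriv T (y w)|⁻¹ ≤
      C * Real.exp C * s * |u - w| := by
    intro u hu w hw
    have h1 := h.distortion I hI _ (hyI w hw) _ (hyI u hu)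
    rw [hTy u hu, hTy w hw, abs_sub_comm] at h1
    have hp := h.deriv_pos hI (hyI w hw)
    have hp' := h.deriv_pos hI (hyI u hu)
    set t := C * |u - w| with ht
    have h2 : |deriv T (y u)|⁻¹ ≤ Real.exp t * |deriv T (y w)|⁻¹ := by
      rw [inv_le_iff_one_le_mul₀ hp', mul_assoc, mul_comm, mul_assoc, inv_mul_eq_div,
        le_div_iff₀ hp, one_mul, mul_comm]
      exact h1
    have habs : |u - w| ≤ 1 := by
      rw [abs_le]; constructor <;> linarith [hu.1, hu.2, hw.1, hw.2]
    have htC : t ≤ C := by rw [ht]; nlinarith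
    have ht0 : 0 ≤ t := by positivity
    have h3 : Real.exp t - 1 ≤ t * Real.exp t := by
      have := Real.add_one_le_exp (-t)
      have h5 : Real.exp t * Real.exp (-t) = 1 := by rw [← Real.exp_add]; simp
      nlinarith [Real.exp_pos t]
    have h4 : Real.exp t - 1 ≤ t * Real.exp C :=
      h3.trans (by gcongr)
    have h6 := hs _ (hyI w hw)
    have h7 : 0 ≤ Real.exp t - 1 := by linarith [Real.add_one_le_exp t]
    calc |deriv T (y u)|⁻¹ - |deriv T (y w)|⁻¹ ≤ (Real.exp t - 1) * |deriv T (y w)|⁻¹ := by linarith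
      _ ≤ (t * Real.exp C) * s := by gcongr
      _ = _ := by rw [ht]; ring
  have hw : eVariationOn (fun x => |deriv T (y x)|⁻¹) (Ioo c d) ≤
      ENNReal.ofReal (C * Real.exp C * s) := by
    refine (LipschitzOnWith.eVariationOn_le_mul (K := C * Real.exp C * s) (a := 0) (b := 1)
      (by positivity) (fun x hx => ⟨by linarith [hx.1], by linarith [hx.2]⟩) ?_).trans (by simp)
    intro u hu w hw
    rw [Real.norm_eq_abs, abs_le]
    have h1 := hw1 u hu w hw
    have h2 := hw1 w hw u hu
    rw [abs_sub_comm w u] at h2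
    constructor <;> linarith
  have hprod := eVariationOn_smul_le_ofReal (s := Ioo c d) (a := fun x => |deriv T (y x)|⁻¹)
    (f := f ∘ y) hs0 hM0 (fun x hx => by
      rw [Real.norm_eq_abs, abs_inv, abs_abs]; exact hs _ (hyI x hx))
    (fun x hx => hM _ (hyI x hx)) (by positivity) hV0 hw hfy
  -- Extension by zero outside the image adds twice the supremum `s * M`; this is the `2` in the
  -- constant.
  have hind := eVariationOn_indicator_Ioo_le hcd (M := s * M) (fun x hx => by
      rw [norm_smul, Real.norm_eq_abs, abs_inv, abs_abs]
      exact mul_le_mul (hs _ (hyI x hx)) (hM _ (hyI x hx)) (norm_nonneg _) hs0)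
    (by positivity) hprod
  rw [branchTerm, him]
  refine hind.trans (ENNReal.ofReal_le_ofReal (le_of_eq ?_))
  ring

theorem norm_branchTerm_le (hI : I ∈ 𝓘) {f : ℝ → E} {s M : ℝ}
    (hs : ∀ x ∈ I, |deriv T x|⁻¹ ≤ s) (hM : ∀ x ∈ I, ‖f x‖ ≤ M) (x : ℝ) :
    ‖branchTerm T I f x‖ ≤ s * M := by
  obtain ⟨x₀, hx₀⟩ := h.nonempty hI
  have hs0 : 0 ≤ s := (inv_nonneg.2 (abs_nonneg _)).trans (hs x₀ hx₀)
  have hM0 : 0 ≤ M := (norm_nonneg _).trans (hM x₀ hx₀)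
  by_cases hx : x ∈ T '' I
  · have hyI : Function.invFunOn T I x ∈ I := Function.invFunOn_mem hx
    rw [branchTerm_of_mem _ hx, norm_smul, Real.norm_eq_abs, abs_inv, abs_abs]
    exact mul_le_mul (hs _ hyI) (hM _ hyI) (norm_nonneg _) hs0
  · rw [branchTerm_of_notMem _ hx, norm_zero]; positivity

theorem norm_transfer_le {f : ℝ → E} {s M : Set ℝ → ℝ}
    (hs : ∀ I ∈ 𝓘, ∀ x ∈ I, |deriv T x|⁻¹ ≤ s I) (hM : ∀ I ∈ 𝓘, ∀ x ∈ I, ‖f x‖ ≤ M I)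
    (hsum : Summable fun I : 𝓘 => s I * M I) (x : ℝ) :
    ‖transfer T 𝓘 f x‖ ≤ ∑' I : 𝓘, s I * M I :=
  tsum_of_norm_bounded hsum.hasSum fun I =>
    h.norm_branchTerm_le I.2 (hs I I.2) (hM I I.2) x

theorem eVariationOn_transfer_le [ProperSpace E] {f : ℝ → E} {s M V : Set ℝ → ℝ}
    (hs : ∀ I ∈ 𝓘, ∀ x ∈ I, |deriv T x|⁻¹ ≤ s I) (hM : ∀ I ∈ 𝓘, ∀ x ∈ I, ‖f x‖ ≤ M I)
    (hV0 : ∀ I ∈ 𝓘, 0 ≤ V I) (hV : ∀ I ∈ 𝓘, eVariationOn f I ≤ ENNReal.ofReal (V I))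
    (hsum : Summable fun I : 𝓘 => s I * M I) :
    eVariationOn (transfer T 𝓘 f) univ ≤
      ∑' I : 𝓘, ENNReal.ofReal (s I * V I + (C * Real.exp C + 2) * (s I * M I)) := by
  refine (eVariationOn_tsum_le fun x _ => ?_).trans (ENNReal.tsum_le_tsum fun I => ?_)
  · exact Summable.of_norm_bounded hsum fun I =>
      h.norm_branchTerm_le I.2 (hs I I.2) (hM I I.2) x
  · exact h.eVariationOn_branchTerm_le I.2 (hs I I.2) (hM I I.2) (hV0 I I.2) (hV I I.2)

/-- The Lasota–Yorke inequality. -/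
theorem exists_eVariationOn_transfer_le [ProperSpace E] :
    ∃ K : ℝ, 0 ≤ K ∧ ∀ (f : ℝ → E) (V : ℝ), Integrable f unitLebesgue → 0 ≤ V →
      eVariationOn f (Icc 0 1) ≤ ENNReal.ofReal V →
      eVariationOn (transfer T 𝓘 f) univ ≤ ENNReal.ofReal
        ((C * Real.exp C + 3) / ρ * V + K * ∫ x, ‖f x‖ ∂unitLebesgue) := by
  obtain ⟨D, hD0, hD⟩ := h.exists_inv_deriv_le
  have hC0 := h.const_nonneg
  have hρ := h.rho_pos
  set B := C * Real.exp C + 2 with hB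
  have hB0 : 0 ≤ B := by positivity
  refine ⟨B * D, by positivity, fun f V hf hV0 hV => ?_⟩
  have hvol : ∀ I ∈ 𝓘, 0 < volume.real I := fun I hI => by
    obtain ⟨a, b, -, hab, -, rfl⟩ := h.isInterval I hI
    rw [measureReal_def, Real.volume_Ioo, ENNReal.toReal_ofReal] <;> linarith
  have hVI : ∀ I ∈ 𝓘, eVariationOn f I ≠ ∞ := fun I hI =>
    ne_top_of_le_ne_top ENNReal.ofReal_ne_top
      ((eVariationOn.mono f (h.subset_Icc hI)).trans hV)
  set W : Set ℝ → ℝ := fun I => (eVariationOn f I).toReal with hW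
  set J : Set ℝ → ℝ := fun I => ∫ y in I, ‖f y‖ with hJ
  have hJ0 : ∀ I, 0 ≤ J I := fun I => integral_nonneg fun _ => norm_nonneg _
  -- Both bounds for the weight are used. The supremum of `‖f‖` on `I` is at most its variation plus
  -- its average: against the variation the bound `ρ⁻¹` gives the coefficient that becomes small for
  -- iterates, against the average `D|I|` cancels `1/|I|` and leaves the integral over `I`.
  set s : Set ℝ → ℝ := fun I => min ρ⁻¹ (D * volume.real I) with hs
  have hs0 : ∀ I, 0 ≤ s I := fun I => by
    rw [hs]; exact le_min (by positivity) (by positivity)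
  set M : Set ℝ → ℝ := fun I => W I + (volume.real I)⁻¹ * J I with hMdef
  have hW0 : ∀ I, 0 ≤ W I := fun I => ENNReal.toReal_nonneg
  have hM : ∀ I ∈ 𝓘, ∀ x ∈ I, ‖f x‖ ≤ M I := by
    intro I hI x hx
    have hfi := h.integrableOn hf hI
    have hv := (ENNReal.ofReal_toReal (hVI I hI)).ge
    obtain ⟨a, b, -, hab, -, hIab⟩ := h.isInterval I hI
    have hvI : volume.real I = b - a := by
      rw [hIab, measureReal_def, Real.volume_Ioo, ENNReal.toReal_ofReal (by linarith)]
    rw [hMdef]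
    simp only [hvI, hJ, hW]
    rw [hIab] at hx hv hfi ⊢
    exact norm_le_add_average hab ENNReal.toReal_nonneg hv hfi hx
  have hsM : ∀ I ∈ 𝓘, s I * M I ≤ ρ⁻¹ * W I + D * J I := by
    intro I hI
    rw [hMdef]
    simp only [mul_add]
    refine add_le_add (mul_le_mul_of_nonneg_right (min_le_left _ _) (hW0 I)) ?_
    calc s I * ((volume.real I)⁻¹ * J I) ≤ (D * volume.real I) * ((volume.real I)⁻¹ * J I) :=
          mul_le_mul_of_nonneg_right (min_le_right _ _)
            (mul_nonneg (inv_nonneg.2 (hvol I hI).le) (hJ0 I))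
      _ = D * J I := by
          have := (hvol I hI).ne'
          field_simp
  have hWsum : ∑' I : 𝓘, ENNReal.ofReal (W I) ≤ ENNReal.ofReal V := by
    refine le_trans ?_ hV
    refine le_trans (ENNReal.tsum_le_tsum fun I => ENNReal.ofReal_toReal_le) ?_
    refine tsum_eVariationOn_le f (fun I hI => ?_) (fun I hI => h.subset_Icc hI)
      h.pairwiseDisjoint
    obtain ⟨a, b, -, hab, -, rfl⟩ := h.isInterval I hI
    exact ⟨a, b, hab, rfl⟩
  have hJs := h.hasSum_integral hf.norm
  have hJsum : ∑' I : 𝓘, ENNReal.ofReal (J I) =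
      ENNReal.ofReal (∫ x, ‖f x‖ ∂unitLebesgue) := by
    rw [← hJs.tsum_eq, ENNReal.ofReal_tsum_of_nonneg (fun I => hJ0 _) hJs.summable]
  have hWs : Summable fun I : 𝓘 => W I := by
    have h1 := ENNReal.summable_toReal (ne_top_of_le_ne_top ENNReal.ofReal_ne_top hWsum)
    exact h1.congr fun I => ENNReal.toReal_ofReal (hW0 I)
  have hsum : Summable fun I : 𝓘 => s I * M I :=
    Summable.of_nonneg_of_le
      (fun I => mul_nonneg (hs0 I) (by
        rw [hMdef]; exact add_nonneg (hW0 I) (mul_nonneg (inv_nonneg.2 (hvol I I.2).le) (hJ0 I))))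
      (fun I => hsM I I.2) ((hWs.mul_left _).add (hJs.summable.mul_left _))
  refine (h.eVariationOn_transfer_le (s := s) (M := M) (V := W) (fun I hI x hx => ?_) hM
    (fun I _ => hW0 I) (fun I hI => (ENNReal.ofReal_toReal (hVI I hI)).ge) hsum).trans ?_
  · refine le_min ?_ (hD I hI x hx)
    gcongr
    exact h.expanding I hI x hx
  · calc ∑' I : 𝓘, ENNReal.ofReal (s I * W I + B * (s I * M I))
        ≤ ∑' I : 𝓘, (ENNReal.ofReal ((B + 1) / ρ) * ENNReal.ofReal (W I) +
            ENNReal.ofReal (B * D) * ENNReal.ofReal (J I)) := by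
          refine ENNReal.tsum_le_tsum fun I => ?_
          rw [← ENNReal.ofReal_mul (by positivity), ← ENNReal.ofReal_mul (by positivity),
            ← ENNReal.ofReal_add (mul_nonneg (by positivity) (hW0 I))
              (mul_nonneg (by positivity) (hJ0 I))]
          refine ENNReal.ofReal_le_ofReal ?_
          have h1 : s I * W I ≤ ρ⁻¹ * W I := mul_le_mul_of_nonneg_right (min_le_left _ _) (hW0 I)
          have h2 := mul_le_mul_of_nonneg_left (hsM I I.2) hB0
          calc _ ≤ ρ⁻¹ * W I + B * (ρ⁻¹ * W I + D * J I) := add_le_add h1 h2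
            _ = _ := by rw [div_eq_mul_inv]; ring
      _ ≤ ENNReal.ofReal ((B + 1) / ρ) * ENNReal.ofReal V +
            ENNReal.ofReal (B * D) * ENNReal.ofReal (∫ x, ‖f x‖ ∂unitLebesgue) := by
          rw [ENNReal.tsum_add, ENNReal.tsum_mul_left, ENNReal.tsum_mul_left, hJsum]
          gcongr
      _ = _ := by
          rw [← ENNReal.ofReal_mul (by positivity), ← ENNReal.ofReal_mul (by positivity),
            ← ENNReal.ofReal_add (by positivity)
              (mul_nonneg (by positivity) (integral_nonneg fun _ => norm_nonneg _)), hB]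
          congr 3
          ring

end

end PiecewiseExpanding

end Branches
end

noncomputable section

/-! ### The transfer relation for real functions -/

/-- `k` is the image of the real function `f` under the transfer operator of `T` with respect to
Lebesgue measure. -/
structure IsRealTransfer (T : ℝ → ℝ) (f k : ℝ → ℝ) : Prop where
  integrable_left : Integrable f unitLebesgue
  integrable_right : Integrable k unitLebesgue
  setIntegral_eq : ∀ A, MeasurableSet A →
    ∫ x in A, k x ∂unitLebesgue = ∫ x in T ⁻¹' A, f x ∂unitLebesgue

namespace IsRealTransfer

variable {T S : ℝ → ℝ} {f f' k k' l : ℝ → ℝ}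

theorem unique (h : IsRealTransfer T f k) (h' : IsRealTransfer T f k') :
    k =ᵐ[unitLebesgue] k' :=
  h.integrable_right.ae_eq_of_forall_setIntegral_eq _ _ h'.integrable_right fun A hA _ => by
    rw [h.setIntegral_eq A hA, h'.setIntegral_eq A hA]

theorem congr_left (h : IsRealTransfer T f k) (hf : f =ᵐ[unitLebesgue] f') :
    IsRealTransfer T f' k :=
  ⟨h.integrable_left.congr hf, h.integrable_right, fun A hA => by
    rw [h.setIntegral_eq A hA]; exact integral_congr_ae (ae_restrict_of_ae hf)⟩

theorem integral_eq (h : IsRealTransfer T f k) :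
    ∫ x, k x ∂unitLebesgue = ∫ x, f x ∂unitLebesgue := by
  simpa using h.setIntegral_eq univ MeasurableSet.univ

theorem sub (h : IsRealTransfer T f k) (h' : IsRealTransfer T f' k') :
    IsRealTransfer T (fun x => f x - f' x) (fun x => k x - k' x) :=
  ⟨h.integrable_left.sub h'.integrable_left, h.integrable_right.sub h'.integrable_right,
    fun A hA => by
      rw [integral_sub h.integrable_right.restrict h'.integrable_right.restrict,
        integral_sub h.integrable_left.restrict h'.integrable_left.restrict,
        h.setIntegral_eq A hA, h'.setIntegral_eq A hA]⟩

theorem comp (hS : Measurable S) (h : IsRealTransfer T f k) (h' : IsRealTransfer S k l) :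
    IsRealTransfer (S ∘ T) f l :=
  ⟨h.integrable_left, h'.integrable_right, fun A hA => by
    rw [h'.setIntegral_eq A hA, h.setIntegral_eq _ (hS hA), preimage_comp]⟩

theorem nonneg (h : IsRealTransfer T f k) (hf : ∀ x, 0 ≤ f x) : 0 ≤ᵐ[unitLebesgue] k :=
  ae_nonneg_of_forall_setIntegral_nonneg h.integrable_right fun A hA _ => by
    rw [h.setIntegral_eq A hA]; exact integral_nonneg hf

/-- Where `k ≥ 0` the integral of `|k|` is that of `f` over the preimage, and where `k < 0` that of
`-f`; both are dominated by integrals of `|f|`. A measurable version of `k` makes the two sets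
measurable. -/
theorem integral_abs_le (hT : Measurable T) (h : IsRealTransfer T f k) :
    ∫ x, |k x| ∂unitLebesgue ≤ ∫ x, |f x| ∂unitLebesgue := by
  obtain ⟨k', hk'm, hkk'⟩ := h.integrable_right.1
  have hk' : Measurable k' := hk'm.measurable
  have hk'i : Integrable k' unitLebesgue := h.integrable_right.congr hkk'
  set A := {x | 0 ≤ k' x} with hA
  have hAm : MeasurableSet A := measurableSet_le measurable_const hk'
  have e1 : ∫ x, |k x| ∂unitLebesgue = ∫ x, |k' x| ∂unitLebesgue :=
    integral_congr_ae (hkk'.mono fun x hx => by simp only [hx])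
  have hset : ∀ B, MeasurableSet B → ∫ x in B, k' x ∂unitLebesgue =
      ∫ x in T ⁻¹' B, f x ∂unitLebesgue := fun B hB => by
    rw [← h.setIntegral_eq B hB]
    exact integral_congr_ae (ae_restrict_of_ae hkk'.symm)
  rw [e1, ← integral_add_compl hAm hk'i.abs, ← integral_add_compl (hT hAm) h.integrable_left.abs]
  have e2 : ∫ x in A, |k' x| ∂unitLebesgue = ∫ x in A, k' x ∂unitLebesgue :=
    setIntegral_congr_fun hAm fun x hx => abs_of_nonneg hx
  have e3 : ∫ x in Aᶜ, |k' x| ∂unitLebesgue = ∫ x in Aᶜ, -k' x ∂unitLebesgue :=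
    setIntegral_congr_fun hAm.compl fun x hx => abs_of_neg (not_le.1 hx)
  rw [e2, e3, integral_neg, hset A hAm, hset _ hAm.compl, preimage_compl, ← integral_neg]
  refine add_le_add ?_ ?_
  · exact integral_mono h.integrable_left.restrict h.integrable_left.abs.restrict
      fun x => le_abs_self _
  · exact integral_mono h.integrable_left.neg.restrict h.integrable_left.abs.restrict
      fun x => neg_le_abs _

end IsRealTransfer

theorem unitLebesgue_restrict_Icc : unitLebesgue.restrict (Icc 0 1) = unitLebesgue := by
  rw [Measure.restrict_restrict measurableSet_Icc, inter_self]

namespace PiecewiseExpanding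

variable {T : ℝ → ℝ} {𝓘 : Set (Set ℝ)} {ρ C : ℝ}

theorem isRealTransfer (h : PiecewiseExpanding T 𝓘 ρ C) (hTm : Measurable T) {f : ℝ → ℝ}
    (hf : Integrable f unitLebesgue) : IsRealTransfer T f (transfer T 𝓘 f) :=
  ⟨hf, h.integrable_transfer hf, fun _ hA => h.setIntegral_transfer hTm hf hA⟩

/-- The Lasota–Yorke inequality for classes of functions. -/
theorem exists_essVar_le (h : PiecewiseExpanding T 𝓘 ρ C) (hTm : Measurable T) :
    ∃ K : ℝ, 0 ≤ K ∧ ∀ (f k : ℝ → ℝ) (V : ℝ), IsRealTransfer T f k → 0 ≤ V →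
      essVar unitLebesgue f (Icc 0 1) ≤ ENNReal.ofReal V →
      essVar unitLebesgue k (Icc 0 1) ≤ ENNReal.ofReal
        ((C * Real.exp C + 3) / ρ * V + K * ∫ x, |f x| ∂unitLebesgue) := by
  obtain ⟨K, hK0, hK⟩ := h.exists_eVariationOn_transfer_le (E := ℝ)
  have hC0 := h.const_nonneg
  have hρ := h.rho_pos
  refine ⟨K, hK0, fun f k V hfk hV0 hV => ?_⟩
  -- The infimum in the essential variation need not be attained, so a version of variation at most
  -- `V + δ` is used and `δ` tends to `0` afterwards.
  have key : ∀ δ : ℝ, 0 < δ → essVar unitLebesgue k (Icc 0 1) ≤ ENNReal.ofReal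
      ((C * Real.exp C + 3) / ρ * (V + δ) + K * ∫ x, |f x| ∂unitLebesgue) := by
    intro δ hδ
    obtain ⟨g, hgf, hgV⟩ := exists_ae_eq_eVariationOn_lt (hV.trans_lt
      ((ENNReal.ofReal_lt_ofReal_iff (by linarith)).2 (by linarith : V < V + δ)))
    rw [unitLebesgue_restrict_Icc] at hgf
    have hg : Integrable g unitLebesgue := hfk.integrable_left.congr hgf.symm
    have h1 := hK g (V + δ) hg (by linarith) hgV.le
    have h2 : transfer T 𝓘 g =ᵐ[unitLebesgue] k :=
      (h.isRealTransfer hTm hg).unique (hfk.congr_left hgf.symm)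
    have h3 : ∫ x, ‖g x‖ ∂unitLebesgue = ∫ x, |f x| ∂unitLebesgue :=
      integral_congr_ae (hgf.mono fun x hx => by simp only [hx, Real.norm_eq_abs])
    rw [← h3]
    exact (essVar_le (ae_restrict_of_ae h2)).trans
      ((eVariationOn.mono _ (subset_univ _)).trans h1)
  have hlim : Tendsto (fun δ : ℝ => ENNReal.ofReal
      ((C * Real.exp C + 3) / ρ * (V + δ) + K * ∫ x, |f x| ∂unitLebesgue)) (𝓝[>] 0)
      (𝓝 (ENNReal.ofReal ((C * Real.exp C + 3) / ρ * V + K * ∫ x, |f x| ∂unitLebesgue))) := by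
    refine (ENNReal.continuous_ofReal.tendsto _).comp (Tendsto.mono_left ?_ nhdsWithin_le_nhds)
    have : Continuous fun δ : ℝ =>
        (C * Real.exp C + 3) / ρ * (V + δ) + K * ∫ x, |f x| ∂unitLebesgue := by fun_prop
    simpa using this.tendsto 0
  exact ge_of_tendsto hlim (eventually_nhdsWithin_of_forall fun δ hδ => key δ hδ)

/-- All iterates share the distortion constant `C'`, so `(C' e^{C'} + 3)/ρⁿ ≤ 1/4` for some `n`.
When this inequality is iterated, the L¹-terms form a geometric series, because the L¹-norm does not
grow; the constant `2K` reproduces itself since `2K/4 + K ≤ 2K`. -/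
theorem exists_iterate_essVar_le (h : PiecewiseExpanding T 𝓘 ρ C) (hρ : 1 < ρ)
    (hTm : Measurable T) :
    ∃ n : ℕ, 0 < n ∧ ∃ K : ℝ, 0 ≤ K ∧ ∀ (m : ℕ) (f k : ℝ → ℝ) (V : ℝ),
      IsRealTransfer T^[n * m] f k → 0 ≤ V →
      essVar unitLebesgue f (Icc 0 1) ≤ ENNReal.ofReal V →
      essVar unitLebesgue k (Icc 0 1) ≤ ENNReal.ofReal
        (V / 4 ^ m + K * ∫ x, |f x| ∂unitLebesgue) := by
  set C' := C * ρ / (ρ - 1) with hC'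
  have hC'0 : 0 ≤ C' := div_nonneg (mul_nonneg h.const_nonneg (by linarith)) (by linarith)
  obtain ⟨n, hn⟩ := ((tendsto_pow_atTop_atTop_of_one_lt hρ).eventually
    (eventually_ge_atTop (4 * (C' * Real.exp C' + 3)))).and (eventually_gt_atTop 0) |>.exists
  obtain ⟨𝓙, hJ⟩ := h.iterate hρ n
  obtain ⟨K, hK0, hK⟩ := hJ.exists_essVar_le (hTm.iterate n)
  refine ⟨n, hn.2, 2 * K, by positivity, fun m => ?_⟩
  have hpos : 0 < ρ ^ n := by positivity
  have hquot : (C' * Real.exp C' + 3) / ρ ^ n ≤ 1 / 4 := by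
    rw [div_le_div_iff₀ hpos (by norm_num)]; linarith [hn.1]
  induction m with
  | zero =>
    intro f k V hfk hV0 hV
    have hid : IsRealTransfer T^[n * 0] f f := ⟨hfk.integrable_left, hfk.integrable_left, by simp⟩
    rw [essVar_congr (hfk.unique hid)]
    refine hV.trans (ENNReal.ofReal_le_ofReal ?_)
    have : 0 ≤ ∫ x, |f x| ∂unitLebesgue := integral_nonneg fun _ => abs_nonneg _
    simp only [pow_zero, div_one]
    nlinarith
  | succ m ih =>
    intro f k V hfk hV0 hV
    obtain ⟨𝓙', hJ'⟩ := h.iterate hρ (n * m)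
    have hg := hJ'.isRealTransfer (hTm.iterate _) hfk.integrable_left
    set g := transfer T^[n * m] 𝓙' f
    have h1 := ih f g V hg hV0 hV
    have hcomp := hg.comp (hTm.iterate n) (hJ.isRealTransfer (hTm.iterate n) hg.integrable_right)
    rw [← Function.iterate_add, show n + n * m = n * (m + 1) by ring] at hcomp
    rw [essVar_congr (hfk.unique hcomp)]
    set s := ∫ x, |f x| ∂unitLebesgue
    have hs0 : 0 ≤ s := integral_nonneg fun _ => abs_nonneg _
    have hgs : ∫ x, |g x| ∂unitLebesgue ≤ s := hg.integral_abs_le (hTm.iterate _)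
    have hV1 : 0 ≤ V / 4 ^ m + 2 * K * s := by positivity
    refine (hK g _ _ (hJ.isRealTransfer (hTm.iterate n) hg.integrable_right) hV1 h1).trans
      (ENNReal.ofReal_le_ofReal ?_)
    have h2 := mul_le_mul_of_nonneg_right hquot hV1
    have h3 := mul_le_mul_of_nonneg_left hgs hK0
    have h4 : V / 4 ^ (m + 1) = 1 / 4 * (V / 4 ^ m) := by
      rw [pow_succ]; field_simp
    rw [h4]
    nlinarith [mul_nonneg hK0 hs0]

end PiecewiseExpanding

/-! ### Approximation in `L¹` and intervals on which a function is large -/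

/-- Continuous functions are dense in L¹, and polynomials approximate them uniformly on `[0,1]`,
where they are Lipschitz and so of bounded variation. -/
theorem exists_essVar_ne_top_integral_sub_le {f : ℝ → ℝ} (hf : Integrable f unitLebesgue) {ε : ℝ}
    (hε : 0 < ε) : ∃ g : ℝ → ℝ, Integrable g unitLebesgue ∧
      (∃ V : ℝ, 0 ≤ V ∧ essVar unitLebesgue g (Icc 0 1) ≤ ENNReal.ofReal V) ∧
      ∫ x, |f x - g x| ∂unitLebesgue ≤ ε := by
  obtain ⟨g, -, hg, hgc, hgi⟩ := hf.exists_hasCompactSupport_integral_sub_le (half_pos hε)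
  obtain ⟨P, hP⟩ := exists_polynomial_near_of_continuousOn 0 1 g hgc.continuousOn _ (half_pos hε)
  have hPi : Integrable (fun x => P.eval x) unitLebesgue :=
    P.continuous.continuousOn.integrableOn_compact isCompact_Icc
  obtain ⟨K, hK⟩ := isCompact_Icc.exists_bound_of_continuousOn
    (f := fun x => P.derivative.eval x) (s := Icc (0 : ℝ) 1) P.derivative.continuous.continuousOn
  have hK0 : 0 ≤ K := (norm_nonneg _).trans (hK 0 (by simp))
  refine ⟨fun x => P.eval x, hPi, ⟨K * (1 - 0), by simpa using hK0, ?_⟩, ?_⟩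
  · refine (essVar_le (EventuallyEq.refl _ _)).trans
      (LipschitzOnWith.eVariationOn_le_mul hK0 Subset.rfl fun x hx y hy => ?_)
    exact (convex_Icc (0 : ℝ) 1).norm_image_sub_le_of_norm_hasDerivWithin_le
      (fun z hz => (P.hasDerivAt z).hasDerivWithinAt) hK hy hx
  · have h1 : ∫ x, |g x - P.eval x| ∂unitLebesgue ≤ ε / 2 := by
      calc ∫ x, |g x - P.eval x| ∂unitLebesgue ≤ ∫ x in Icc (0 : ℝ) 1, ε / 2 := by
            refine setIntegral_mono_on (hgi.sub hPi).abs (by simp) measurableSet_Icc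
              fun x hx => ?_
            rw [abs_sub_comm]; exact (hP x hx).le
        _ = ε / 2 := by simp
    calc ∫ x, |f x - P.eval x| ∂unitLebesgue
        ≤ ∫ x, (|f x - g x| + |g x - P.eval x|) ∂unitLebesgue :=
          integral_mono (hf.sub hPi).abs ((hf.sub hgi).abs.add (hgi.sub hPi).abs)
            fun x => abs_sub_le _ _ _
      _ ≤ ε := by
          refine (integral_add (hf.sub hgi).abs (hgi.sub hPi).abs).le.trans ?_
          exact (add_le_add hg h1).trans (by linarith)

/-- A function of bounded variation is at least half its mean on one of the intervals of a
sufficiently fine subdivision. -/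
theorem exists_interval_half_le {u : ℝ → ℝ} (hu : Integrable u unitLebesgue) {V A : ℝ} (hV0 : 0 ≤ V)
    (hV : eVariationOn u (Icc 0 1) ≤ ENNReal.ofReal V) (hA : A ≤ ∫ x, u x ∂unitLebesgue)
    {m : ℕ} (hm : 0 < m) (hVm : V < m * (A / 2)) :
    ∃ i < m, ∀ x ∈ Ioo ((i : ℝ) / m) ((i + 1 : ℕ) / m), A / 2 ≤ u x := by
  by_contra! hcon
  have hm0 : (0 : ℝ) < m := by exact_mod_cast hm
  set a : ℕ → ℝ := fun i => (i : ℝ) / m with ha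
  have hamono : Monotone a := fun i j hij => by
    simp only [ha]; gcongr
  have hasucc : ∀ i, a (i + 1) - a i = 1 / m := fun i => by
    simp only [ha]; push_cast; field_simp; ring
  have halt : ∀ i, a i < a (i + 1) := fun i => by
    have := hasucc i
    have : 0 < 1 / (m : ℝ) := by positivity
    linarith
  have hJsub : ∀ i < m, Ioo (a i) (a (i + 1)) ⊆ Icc 0 1 := fun i hi x hx => by
    have h1 : 0 ≤ a i := by simp only [ha]; positivity
    have h2 : a (i + 1) ≤ 1 := by
      simp only [ha]; rw [div_le_one hm0]; exact_mod_cast hi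
    exact ⟨h1.trans hx.1.le, hx.2.le.trans h2⟩
  set W : ℕ → ℝ := fun i => (eVariationOn u (Ioo (a i) (a (i + 1)))).toReal with hW
  have hWfin : ∀ i < m, eVariationOn u (Ioo (a i) (a (i + 1))) ≠ ∞ := fun i hi =>
    ne_top_of_le_ne_top ENNReal.ofReal_ne_top ((eVariationOn.mono u (hJsub i hi)).trans hV)
  have hWsum : ∑ i ∈ Finset.range m, W i ≤ V := by
    have h1 := sum_eVariationOn_Ioo_le u a (fun i => a (i + 1)) (Finset.range m)
      (fun i _ => halt i) (fun i _ j _ hij => by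
        rw [Ioo_disjoint_Ioo]
        rcases lt_or_gt_of_ne hij with h | h
        · exact (min_le_left _ _).trans ((hamono h).trans (le_max_right _ _))
        · exact (min_le_right _ _).trans ((hamono h).trans (le_max_left _ _)))
    have h2 : eVariationOn u (⋃ i ∈ Finset.range m, Ioo (a i) (a (i + 1))) ≤ ENNReal.ofReal V :=
      (eVariationOn.mono u (iUnion₂_subset fun i hi => hJsub i (Finset.mem_range.1 hi))).trans hV
    have h3 := ENNReal.toReal_mono ENNReal.ofReal_ne_top (h1.trans h2)
    rw [ENNReal.toReal_sum (fun i hi => hWfin i (Finset.mem_range.1 hi)),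
      ENNReal.toReal_ofReal hV0] at h3
    exact h3
  have hint : ∀ i < m, IntervalIntegrable u volume (a i) (a (i + 1)) := fun i hi => by
    rw [intervalIntegrable_iff_integrableOn_Ioo_of_le (halt i).le]
    exact IntegrableOn.mono_set hu (hJsub i hi)
  -- If every interval contained a point where `u < A/2`, then `u ≤ A/2 + W i` on the `i`-th
  -- interval. Summation would bound the integral by `A/2 + V/m`, less than `A`.
  have hle : ∀ i < m, ∫ x in a i..a (i + 1), u x ≤ 1 / m * (A / 2 + W i) := by
    intro i hi
    obtain ⟨y, hy, hyA⟩ := hcon i hi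
    have hint' := (intervalIntegrable_iff_integrableOn_Ioo_of_le (halt i).le).1 (hint i hi)
    rw [intervalIntegral.integral_of_le (halt i).le, integral_Ioc_eq_integral_Ioo]
    calc ∫ x in Ioo (a i) (a (i + 1)), u x ≤ ∫ x in Ioo (a i) (a (i + 1)), (A / 2 + W i) := by
          refine setIntegral_mono_on hint' (by simp) measurableSet_Ioo fun x hx => ?_
          have hd := ENNReal.toReal_mono (hWfin i hi) (eVariationOn.edist_le u hx hy)
          rw [edist_dist, ENNReal.toReal_ofReal dist_nonneg, Real.dist_eq] at hd
          have := (le_abs_self _).trans hd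
          simp only [hW]
          linarith
      _ = 1 / m * (A / 2 + W i) := by
          rw [setIntegral_const, measureReal_def, Real.volume_Ioo, ENNReal.toReal_ofReal
            (by linarith [halt i]), smul_eq_mul, hasucc i]
  have htot : ∫ x, u x ∂unitLebesgue = ∑ i ∈ Finset.range m, ∫ x in a i..a (i + 1), u x := by
    rw [intervalIntegral.sum_integral_adjacent_intervals fun i hi => hint i hi]
    have h0 : a 0 = 0 := by simp [ha]
    have h1 : a m = 1 := by simp only [ha]; field_simp
    rw [h0, h1, intervalIntegral.integral_of_le zero_le_one, integral_Icc_eq_integral_Ioc]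
  have hbound : ∫ x, u x ∂unitLebesgue ≤ A / 2 + V / m := by
    rw [htot]
    calc _ ≤ ∑ i ∈ Finset.range m, 1 / m * (A / 2 + W i) :=
          Finset.sum_le_sum fun i hi => hle i (Finset.mem_range.1 hi)
      _ = A / 2 + (∑ i ∈ Finset.range m, W i) / m := by
          rw [← Finset.mul_sum, Finset.sum_add_distrib, Finset.sum_const, Finset.card_range,
            nsmul_eq_mul]
          field_simp
      _ ≤ _ := by gcongr
  have : V / m < A / 2 := by rw [div_lt_iff₀ hm0]; linarith
  linarith

/-! ### Regularity of the invariant density -/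

/-- An integrable fixed point of all the transfer operators `T^[n]` has bounded variation. -/
theorem PiecewiseExpanding.essVar_fixedPoint_ne_top {T : ℝ → ℝ} {𝓘 : Set (Set ℝ)} {ρ C : ℝ}
    (h : PiecewiseExpanding T 𝓘 ρ C) (hρ : 1 < ρ) (hTm : Measurable T) {f : ℝ → ℝ}
    (hf : ∀ n, IsRealTransfer T^[n] f f) :
    ∃ V : ℝ, 0 ≤ V ∧ essVar unitLebesgue f (Icc 0 1) ≤ ENNReal.ofReal V := by
  obtain ⟨n, -, K, hK0, hK⟩ := h.exists_iterate_essVar_le hρ hTm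
  set s := ∫ x, |f x| ∂unitLebesgue
  have hs0 : 0 ≤ s := integral_nonneg fun _ => abs_nonneg _
  -- A function `g` of bounded variation close to `f` in L¹ is pushed forward so often that its own
  -- variation is forgotten. The result has a variation bound independent of `j`, and it is as close
  -- to `f` as `g` was, because `f` is fixed and the operators do not increase L¹-norms.
  have key : ∀ j : ℕ, ∃ k : ℝ → ℝ, Integrable k unitLebesgue ∧
      essVar unitLebesgue k (Icc 0 1) ≤ ENNReal.ofReal (1 + K * (s + 1)) ∧
      ∫ x, |f x - k x| ∂unitLebesgue ≤ 1 / ((j : ℝ) + 1) := by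
    intro j
    have hj : 0 < 1 / ((j : ℝ) + 1) := by positivity
    have hj1 : 1 / ((j : ℝ) + 1) ≤ 1 := by
      rw [div_le_one (by positivity)]; linarith [(Nat.cast_nonneg j : (0 : ℝ) ≤ j)]
    obtain ⟨g, hgi, ⟨V, hV0, hV⟩, hgf⟩ :=
      exists_essVar_ne_top_integral_sub_le (hf 0).integrable_left hj
    obtain ⟨m, hm⟩ := ((tendsto_pow_atTop_atTop_of_one_lt (by norm_num : (1 : ℝ) < 4)).eventually
      (eventually_ge_atTop V)).exists
    obtain ⟨𝓙, hJ⟩ := h.iterate hρ (n * m)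
    have hk := hJ.isRealTransfer (hTm.iterate _) hgi
    refine ⟨_, hk.integrable_right, (hK m g _ V hk hV0 hV).trans (ENNReal.ofReal_le_ofReal ?_), ?_⟩
    · have h1 : V / 4 ^ m ≤ 1 := by rw [div_le_one (by positivity)]; exact hm
      have h2 : ∫ x, |g x| ∂unitLebesgue ≤ s + 1 := by
        calc ∫ x, |g x| ∂unitLebesgue ≤ ∫ x, (|f x| + |f x - g x|) ∂unitLebesgue := by
              refine integral_mono hgi.abs ((hf 0).integrable_left.abs.add
                ((hf 0).integrable_left.sub hgi).abs) fun x => ?_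
              have := abs_sub_abs_le_abs_sub (g x) (f x)
              rw [abs_sub_comm] at this
              simp only
              linarith
          _ ≤ _ := by
              refine (integral_add (hf 0).integrable_left.abs
                ((hf 0).integrable_left.sub hgi).abs).le.trans ?_
              exact add_le_add le_rfl (hgf.trans hj1)
      gcongr
    · exact (((hf (n * m)).sub hk).integral_abs_le (hTm.iterate _)).trans hgf
  choose k hki hkV hkf using key
  have hmeas : TendstoInMeasure unitLebesgue k atTop f := by
    refine tendstoInMeasure_of_tendsto_eLpNorm one_ne_zero (fun j => (hki j).1)
      (hf 0).integrable_left.1 ?_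
    have hb : Tendsto (fun j : ℕ => ENNReal.ofReal (1 / ((j : ℝ) + 1))) atTop (𝓝 0) := by
      rw [← ENNReal.ofReal_zero]
      exact (ENNReal.continuous_ofReal.tendsto 0).comp tendsto_one_div_add_atTop_nhds_zero_nat
    refine tendsto_of_tendsto_of_tendsto_of_le_of_le tendsto_const_nhds hb (fun _ => zero_le)
      fun j => ?_
    have hi := (hki j).sub (hf 0).integrable_left
    rw [eLpNorm_one_eq_lintegral_enorm, ← ofReal_integral_norm_eq_lintegral_enorm hi]
    refine ENNReal.ofReal_le_ofReal (le_trans (le_of_eq ?_) (hkf j))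
    refine integral_congr_ae (Eventually.of_forall fun x => ?_)
    simp only [Pi.sub_apply, Real.norm_eq_abs]
    exact abs_sub_comm _ _
  obtain ⟨ns, -, hns⟩ := hmeas.exists_seq_tendsto_ae
  refine ⟨1 + K * (s + 1), by positivity, ?_⟩
  exact essVar_le_of_tendsto_ae (F := fun j => k (ns j)) (p := atTop) (ae_restrict_of_ae hns)
    measurableSet_Icc fun j => hkV _
end

noncomputable section

/-! ### Lower bound for the invariant density -/

/-- On `U` the measure `μ` dominates a positive multiple of Lebesgue measure. -/
def BoundedBelowOn (μ : Measure ℝ) (U : Set ℝ) : Prop :=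
  ∃ c : ℝ, 0 < c ∧ ∀ B ⊆ U, ENNReal.ofReal c * volume B ≤ μ B

namespace BoundedBelowOn

variable {μ : Measure ℝ} {U V : Set ℝ}

theorem mono (hV : BoundedBelowOn μ V) (hUV : U ⊆ V) : BoundedBelowOn μ U :=
  let ⟨c, hc, h⟩ := hV
  ⟨c, hc, fun B hB => h B (hB.trans hUV)⟩

/-- `B ∩ U` and `B ∩ V` may overlap, so their measures add up to at most twice `μ B`; halving the
constant avoids any measurability assumption. -/
theorem union (hU : BoundedBelowOn μ U) (hV : BoundedBelowOn μ V) : BoundedBelowOn μ (U ∪ V) := by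
  obtain ⟨c, hc, h⟩ := hU
  obtain ⟨d, hd, h'⟩ := hV
  set e := min c d with he
  have he0 : 0 < e := lt_min hc hd
  refine ⟨e / 2, half_pos he0, fun B hB => ?_⟩
  have h1 : ENNReal.ofReal e * volume B ≤ μ B + μ B := by
    calc ENNReal.ofReal e * volume B ≤ ENNReal.ofReal e * (volume (B ∩ U) + volume (B ∩ V)) := by
          gcongr
          refine (measure_mono ?_).trans (measure_union_le _ _)
          intro x hx
          exact (hB hx).imp (fun h => ⟨hx, h⟩) fun h => ⟨hx, h⟩
      _ ≤ ENNReal.ofReal c * volume (B ∩ U) + ENNReal.ofReal d * volume (B ∩ V) := by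
          rw [mul_add]
          gcongr
          · exact min_le_left _ _
          · exact min_le_right _ _
      _ ≤ μ B + μ B := add_le_add
          ((h _ inter_subset_right).trans (measure_mono inter_subset_left))
          ((h' _ inter_subset_right).trans (measure_mono inter_subset_left))
  have h2 : ENNReal.ofReal e = ENNReal.ofReal (e / 2) + ENNReal.ofReal (e / 2) := by
    rw [← ENNReal.ofReal_add (by positivity) (by positivity), add_halves]
  rw [h2, add_mul, ← two_mul, ← two_mul] at h1
  exact (ENNReal.mul_le_mul_iff_right (by norm_num) (by norm_num)).1 h1

theorem of_volume_eq_zero (hU : volume U = 0) : BoundedBelowOn μ U :=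
  ⟨1, one_pos, fun B hB => by rw [measure_mono_null hB hU, mul_zero]; exact zero_le⟩

theorem measure_pos (hU : BoundedBelowOn μ U) (h0 : volume U ≠ 0) : 0 < μ U := by
  obtain ⟨c, hc, h⟩ := hU
  refine lt_of_lt_of_le ?_ (h U Subset.rfl)
  exact ENNReal.mul_pos (by simpa using hc) h0

end BoundedBelowOn

/-- The points near which `μ` dominates a multiple of Lebesgue measure. -/
def boundedBelowPoints (μ : Measure ℝ) : Set ℝ := {x | ∃ W, IsOpen W ∧ x ∈ W ∧ BoundedBelowOn μ W}

theorem isOpen_boundedBelowPoints (μ : Measure ℝ) : IsOpen (boundedBelowPoints μ) :=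
  isOpen_iff_forall_mem_open.2 fun _ ⟨W, hW, hx, h⟩ => ⟨W, fun _ hy => ⟨W, hW, hy, h⟩, hW, hx⟩

/-- By invariance `μ (G n) = μ (T⁻¹ G n) ≤ μ (G (n+1))`: the measures cannot decrease, although the
sets decrease to a null set. This is the engine of both parts of the lower bound for the density. -/
theorem measure_eq_zero_of_shrinking {T : ℝ → ℝ} {μ : Measure ℝ} [IsFiniteMeasure μ]
    (hinv : MeasurePreserving T μ μ) {G : ℕ → Set ℝ} (hG : ∀ n, MeasurableSet (G n))
    (hanti : Antitone G) (h0 : μ (⋂ n, G n) = 0) (hstep : ∀ n, μ (T ⁻¹' G n \ G (n + 1)) = 0) :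
    μ (G 0) = 0 := by
  have hle : ∀ n, μ (G 0) ≤ μ (G n) := by
    intro n
    induction n with
    | zero => exact le_rfl
    | succ n ih =>
      refine ih.trans ?_
      rw [← hinv.measure_preimage (hG n).nullMeasurableSet]
      refine (measure_le_inter_add_sdiff μ _ (G (n + 1))).trans ?_
      rw [hstep n, add_zero]
      exact measure_mono inter_subset_right
  have hlim := tendsto_measure_iInter_atTop (μ := μ) (fun n => (hG n).nullMeasurableSet) hanti
    ⟨0, measure_ne_top _ _⟩
  rw [h0] at hlim
  exact le_antisymm (ge_of_tendsto' hlim hle) zero_le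

/-- The half-interval of length `s` issuing from `z` in the direction `σ = ±1`. -/
def halfInterval (z σ s : ℝ) : Set ℝ := {x | 0 < σ * (x - z) ∧ σ * (x - z) < s}

theorem isOpen_halfInterval (z σ s : ℝ) : IsOpen (halfInterval z σ s) :=
  have h1 : IsOpen {x : ℝ | 0 < σ * (x - z)} := isOpen_lt (by fun_prop) (by fun_prop)
  have h2 : IsOpen {x : ℝ | σ * (x - z) < s} := isOpen_lt (by fun_prop) (by fun_prop)
  h1.inter h2

theorem ordConnected_halfInterval {z σ s : ℝ} (hσ : σ = 1 ∨ σ = -1) :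
    (halfInterval z σ s).OrdConnected := by
  refine ⟨fun x hx y hy w hw => ?_⟩
  simp only [halfInterval, mem_ofPred_eq] at *
  rcases hσ with rfl | rfl <;> constructor <;> linarith [hw.1, hw.2, hx.1, hx.2, hy.1, hy.2]

theorem abs_sub_lt_of_mem_halfInterval {z σ s x : ℝ} (hσ : σ = 1 ∨ σ = -1)
    (hx : x ∈ halfInterval z σ s) : 0 < |x - z| ∧ |x - z| < s := by
  obtain ⟨h1, h2⟩ := hx
  have : |x - z| = σ * (x - z) := by
    rcases hσ with rfl | rfl
    · rw [one_mul] at *; exact abs_of_pos h1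
    · rw [abs_of_neg (by linarith)]; ring
  rw [this]; exact ⟨h1, h2⟩

theorem exists_gap {E : Set ℝ} (hE : IsClosed E) {a b x : ℝ} (ha : a ∈ E) (hb : b ∈ E)
    (hax : a < x) (hxb : x < b) (hx : x ∉ E) :
    ∃ a' ∈ E, ∃ b' ∈ E, a ≤ a' ∧ a' < x ∧ x < b' ∧ b' ≤ b ∧ Disjoint (Ioo a' b') E := by
  obtain ⟨a', ha', hmax⟩ := (isCompact_Icc.inter_left hE).exists_isGreatest
    (⟨a, ha, le_rfl, hax.le⟩ : (E ∩ Icc a x).Nonempty)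
  obtain ⟨b', hb', hmin⟩ := (isCompact_Icc.inter_left hE).exists_isLeast
    (⟨b, hb, hxb.le, le_rfl⟩ : (E ∩ Icc x b).Nonempty)
  refine ⟨a', ha'.1, b', hb'.1, ha'.2.1, lt_of_le_of_ne ha'.2.2 ?_, lt_of_le_of_ne hb'.2.1 ?_,
    hb'.2.2, ?_⟩
  · rintro rfl; exact hx ha'.1
  · rintro rfl; exact hx hb'.1
  · refine Set.disjoint_left.2 fun y hy hyE => ?_
    rcases le_total y x with hyx | hyx
    · exact absurd (hmax ⟨hyE, ha'.2.1.trans hy.1.le, hyx⟩) (not_le.2 hy.1)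
    · exact absurd (hmin ⟨hyE, hyx, hy.2.le.trans hb'.2.2⟩) (not_le.2 hy.2)

/-- Gaps of `E` that end in a given finite set have length bounded from below. -/
theorem exists_le_gap_length {E D : Set ℝ} (hD : D.Finite) :
    ∃ m : ℝ, 0 < m ∧ ∀ a ∈ E, ∀ b ∈ E, a < b → Disjoint (Ioo a b) E → a ∈ D ∨ b ∈ D →
      m ≤ b - a := by
  set P : Set (ℝ × ℝ) := {p | p.1 ∈ E ∧ p.2 ∈ E ∧ p.1 < p.2 ∧ Disjoint (Ioo p.1 p.2) E} with hP
  -- A gap is determined by either of its ends, the other one being the next point of `E`. So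
  -- finitely many gaps end in `D`.
  have hleft : {p | p ∈ P ∧ p.1 ∈ D}.Finite := by
    refine Set.Finite.of_injOn (f := Prod.fst) (t := D) (fun p hp => hp.2) ?_ hD
    rintro ⟨a, b⟩ ⟨⟨ha, hb, hab, hd⟩, -⟩ ⟨a', b'⟩ ⟨⟨ha', hb', hab', hd'⟩, -⟩ heq
    simp only at heq ha hb hab hd ha' hb' hab' hd'
    subst heq
    rcases lt_trichotomy b b' with h | rfl | h
    · exact absurd hb (Set.disjoint_left.1 hd' ⟨hab, h⟩)
    · rfl
    · exact absurd hb' (Set.disjoint_left.1 hd ⟨hab', h⟩)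
  have hright : {p | p ∈ P ∧ p.2 ∈ D}.Finite := by
    refine Set.Finite.of_injOn (f := Prod.snd) (t := D) (fun p hp => hp.2) ?_ hD
    rintro ⟨a, b⟩ ⟨⟨ha, hb, hab, hd⟩, -⟩ ⟨a', b'⟩ ⟨⟨ha', hb', hab', hd'⟩, -⟩ heq
    simp only at heq ha hb hab hd ha' hb' hab' hd'
    subst heq
    rcases lt_trichotomy a a' with h | rfl | h
    · exact absurd ha' (Set.disjoint_left.1 hd ⟨h, hab'⟩)
    · rfl
    · exact absurd ha (Set.disjoint_left.1 hd' ⟨h, hab⟩)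
  have hfin := hleft.union hright
  rcases Set.eq_empty_or_nonempty ({p | p ∈ P ∧ p.1 ∈ D} ∪ {p | p ∈ P ∧ p.2 ∈ D}) with hemp | hne
  · refine ⟨1, one_pos, fun a ha b hb hab hd hor => ?_⟩
    have : (a, b) ∈ ({p | p ∈ P ∧ p.1 ∈ D} ∪ {p | p ∈ P ∧ p.2 ∈ D}) :=
      hor.imp (fun h => ⟨⟨ha, hb, hab, hd⟩, h⟩) fun h => ⟨⟨ha, hb, hab, hd⟩, h⟩
    rw [hemp] at this
    exact this.elim
  · obtain ⟨p, hp, hmin⟩ := Set.exists_min_image _ (fun p : ℝ × ℝ => p.2 - p.1) hfin hne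
    refine ⟨p.2 - p.1, ?_, fun a ha b hb hab hd hor => ?_⟩
    · rcases hp with hp | hp <;> exact sub_pos.2 hp.1.2.2.1
    · exact hmin (a, b) (hor.imp (fun h => ⟨⟨ha, hb, hab, hd⟩, h⟩)
        fun h => ⟨⟨ha, hb, hab, hd⟩, h⟩)

namespace PiecewiseExpanding

variable {T : ℝ → ℝ} {𝓘 : Set (Set ℝ)} {ρ C : ℝ} {I : Set ℝ} {μ : Measure ℝ}

/-- `T` is Lipschitz on `I` by distortion. One-dimensional Hausdorff measure, which is Lebesgue
measure on the line, then covers arbitrary subsets, as `BoundedBelowOn` demands. -/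
theorem exists_volume_image_le (h : PiecewiseExpanding T 𝓘 ρ C) (hI : I ∈ 𝓘) :
    ∃ K : ℝ, 0 < K ∧ ∀ s ⊆ I, volume (T '' s) ≤ ENNReal.ofReal K * volume s := by
  obtain ⟨x₀, hx₀⟩ := h.nonempty hI
  have hK : 0 < Real.exp C * |deriv T x₀| := mul_pos (Real.exp_pos _) (h.deriv_pos hI hx₀)
  refine ⟨_, hK, fun s hs => ?_⟩
  have hL : LipschitzOnWith (Real.exp C * |deriv T x₀|).toNNReal T s :=
    LipschitzOnWith.of_dist_le_mul fun x hx y hy => by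
      rw [Real.dist_eq, Real.dist_eq, Real.coe_toNNReal _ hK.le]
      obtain ⟨z, hz, hz'⟩ := h.exists_slope hI (hs hx) (hs hy)
      rw [hz', abs_mul]
      gcongr
      exact h.distortion' hI hz hx₀
  have := hL.hausdorffMeasure_image_le zero_le_one
  rwa [hausdorffMeasure_real, ENNReal.rpow_one] at this

/-- By invariance `μ B` is at least the measure of the part of the preimage of `B` in `W`, where `μ`
dominates Lebesgue measure, and `T` enlarges the volume of that part by at most a factor `K`. -/
theorem boundedBelowOn_image (h : PiecewiseExpanding T 𝓘 ρ C) (hinv : MeasurePreserving T μ μ)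
    (hI : I ∈ 𝓘) {W : Set ℝ} (hW : W ⊆ I) (hb : BoundedBelowOn μ W) :
    BoundedBelowOn μ (T '' W) := by
  obtain ⟨c, hc, hcW⟩ := hb
  obtain ⟨K, hK, hKs⟩ := h.exists_volume_image_le hI
  refine ⟨c / K, div_pos hc hK, fun B hB => ?_⟩
  set B' := toMeasurable μ B with hB'
  have h1 : volume B ≤ ENNReal.ofReal K * volume (W ∩ T ⁻¹' B') := by
    refine (measure_mono ?_).trans (hKs _ (inter_subset_left.trans hW))
    intro y hy
    obtain ⟨x, hx, rfl⟩ := hB hy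
    exact ⟨x, ⟨hx, subset_toMeasurable μ B hy⟩, rfl⟩
  have h2 : ENNReal.ofReal c * volume (W ∩ T ⁻¹' B') ≤ μ B := by
    refine (hcW _ inter_subset_left).trans ((measure_mono inter_subset_right).trans ?_)
    rw [hinv.measure_preimage (measurableSet_toMeasurable μ B).nullMeasurableSet,
      measure_toMeasurable]
  calc ENNReal.ofReal (c / K) * volume B
      ≤ ENNReal.ofReal (c / K) * (ENNReal.ofReal K * volume (W ∩ T ⁻¹' B')) := by gcongr
    _ = ENNReal.ofReal c * volume (W ∩ T ⁻¹' B') := by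
        rw [← mul_assoc, ← ENNReal.ofReal_mul (by positivity), div_mul_cancel₀ _ hK.ne']
    _ ≤ μ B := h2

theorem map_mem_boundedBelowPoints (h : PiecewiseExpanding T 𝓘 ρ C)
    (hinv : MeasurePreserving T μ μ) (hI : I ∈ 𝓘) {x : ℝ} (hxI : x ∈ I)
    (hx : x ∈ boundedBelowPoints μ) : T x ∈ boundedBelowPoints μ := by
  obtain ⟨W, hW, hxW, hb⟩ := hx
  exact ⟨T '' (W ∩ I), h.isOpen_image hI (hW.inter (h.isOpen hI)) inter_subset_right,
    ⟨x, ⟨hxW, hxI⟩, rfl⟩,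
    h.boundedBelowOn_image hinv hI inter_subset_right (hb.mono inter_subset_left)⟩

/-- The density of an absolutely continuous invariant measure is a fixed point of the transfer
operators. -/
theorem isRealTransfer_density [IsProbabilityMeasure μ] (hac : μ ≪ unitLebesgue)
    (hinv : MeasurePreserving T μ μ) (n : ℕ) :
    IsRealTransfer T^[n] (fun x => (μ.rnDeriv unitLebesgue x).toReal)
      (fun x => (μ.rnDeriv unitLebesgue x).toReal) := by
  refine ⟨Measure.integrable_toReal_rnDeriv, Measure.integrable_toReal_rnDeriv, fun A hA => ?_⟩
  rw [Measure.setIntegral_toReal_rnDeriv hac, Measure.setIntegral_toReal_rnDeriv hac,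
    (hinv.iterate n).measureReal_preimage hA.nullMeasurableSet]

theorem exists_density_essVar_le (h : PiecewiseExpanding T 𝓘 ρ C) (hρ : 1 < ρ)
    [IsProbabilityMeasure μ] (hac : μ ≪ unitLebesgue) (hinv : MeasurePreserving T μ μ) :
    ∃ (g : ℝ → ℝ) (V : ℝ), 0 ≤ V ∧
      g =ᵐ[unitLebesgue] (fun x => (μ.rnDeriv unitLebesgue x).toReal) ∧
      eVariationOn g (Icc 0 1) ≤ ENNReal.ofReal V := by
  obtain ⟨V, hV0, hV⟩ := h.essVar_fixedPoint_ne_top hρ hinv.measurable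
    (isRealTransfer_density hac hinv)
  obtain ⟨g, hg, hgV⟩ := exists_ae_eq_eVariationOn_lt (hV.trans_lt
    ((ENNReal.ofReal_lt_ofReal_iff (by linarith)).2 (by linarith : V < V + 1)))
  rw [unitLebesgue_restrict_Icc] at hg
  exact ⟨g, V + 1, by linarith, hg, hgV.le⟩

/-- A density of bounded variation is differentiable almost everywhere, hence continuous there, and
it is positive at `μ`-almost every point. At a point with both properties it is bounded below in a
neighbourhood. -/
theorem measure_compl_boundedBelowPoints (h : PiecewiseExpanding T 𝓘 ρ C) (hρ : 1 < ρ)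
    [IsProbabilityMeasure μ] (hac : μ ≪ unitLebesgue) (hinv : MeasurePreserving T μ μ) :
    μ (boundedBelowPoints μ)ᶜ = 0 := by
  obtain ⟨g, V, hV0, hg, hgV⟩ := h.exists_density_essVar_le hρ hac hinv
  have hbv : BoundedVariationOn g (Icc 0 1) := ne_top_of_le_ne_top ENNReal.ofReal_ne_top hgV
  have hd : ∀ᵐ x ∂unitLebesgue, DifferentiableWithinAt ℝ g (Icc 0 1) x :=
    hbv.locallyBoundedVariationOn.ae_differentiableWithinAt measurableSet_Icc
  have hIoo : ∀ᵐ x ∂unitLebesgue, x ∈ Ioo (0 : ℝ) 1 := by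
    rw [unitLebesgue, ← restrict_Ioo_eq_restrict_Icc]
    exact ae_restrict_mem measurableSet_Ioo
  have hpos : ∀ᵐ x ∂μ, 0 < μ.rnDeriv unitLebesgue x := Measure.rnDeriv_pos hac
  have hfin : ∀ᵐ x ∂μ, μ.rnDeriv unitLebesgue x < ∞ := hac.ae_le (Measure.rnDeriv_lt_top _ _)
  rw [← mem_ae_iff]
  filter_upwards [hpos, hfin, hac.ae_le hd, hac.ae_le hIoo, hac.ae_le hg] with x hx hxf hxd hxI hxg
  have hgx : 0 < g x := by rw [hxg]; exact ENNReal.toReal_pos hx.ne' hxf.ne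
  have hcont : ContinuousAt g x :=
    (hxd.differentiableAt (Icc_mem_nhds hxI.1 hxI.2)).continuousAt
  have hev : ∀ᶠ y in 𝓝 x, g x / 2 < g y ∧ y ∈ Ioo (0 : ℝ) 1 :=
    (hcont.eventually_const_lt (half_lt_self hgx)).and (isOpen_Ioo.mem_nhds hxI)
  obtain ⟨W, hWsub, hW, hxW⟩ := eventually_nhds_iff.1 hev
  refine ⟨W, hW, hxW, g x / 2, half_pos hgx, fun B hB => ?_⟩
  set B' := toMeasurable μ B ∩ W with hB'
  have hB'm : MeasurableSet B' := (measurableSet_toMeasurable μ B).inter hW.measurableSet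
  have h1 : μ B' ≤ μ B := (measure_mono inter_subset_left).trans (measure_toMeasurable B).le
  refine le_trans ?_ h1
  have h2 : volume B ≤ volume B' := measure_mono (subset_inter (subset_toMeasurable μ B) hB)
  have h3 : unitLebesgue B' = volume B' := by
    rw [unitLebesgue, Measure.restrict_apply hB'm, inter_eq_self_of_subset_left]
    exact fun y hy => Ioo_subset_Icc_self (hWsub y hy.2).2
  rw [← Measure.setLIntegral_rnDeriv hac B']
  calc ENNReal.ofReal (g x / 2) * volume B ≤ ENNReal.ofReal (g x / 2) * unitLebesgue B' := by
        rw [h3]; gcongr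
    _ = ∫⁻ _ in B', ENNReal.ofReal (g x / 2) ∂unitLebesgue := (setLIntegral_const _ _).symm
    _ ≤ ∫⁻ y in B', μ.rnDeriv unitLebesgue y ∂unitLebesgue := by
        refine setLIntegral_mono_ae' hB'm ?_
        filter_upwards [hg] with y hy hyB
        have h4 := (hWsub y hyB.2).1
        rw [hy] at h4
        exact (ENNReal.ofReal_le_ofReal h4.le).trans ENNReal.ofReal_toReal_le

/-- The good points form an open set, nonempty because it carries `μ`, and orbits inside the
partition preserve it. Mixing sends one of them into `V`, so `μ` dominates Lebesgue measure on a
nonempty open part of `V`. -/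
theorem measure_pos_of_isTopMixing (h : PiecewiseExpanding T 𝓘 ρ C) (hρ : 1 < ρ)
    (hmix : IsTopMixing T 𝓘) [IsProbabilityMeasure μ] (hac : μ ≪ unitLebesgue)
    (hinv : MeasurePreserving T μ μ) {V : Set ℝ} (hV : IsOpen V) (hVne : (V ∩ Icc 0 1).Nonempty) :
    0 < μ V := by
  have hU0 := h.measure_compl_boundedBelowPoints hρ hac hinv
  set U := boundedBelowPoints μ with hU
  have hne : (U ∩ Icc 0 1).Nonempty := by
    by_contra hemp
    rw [not_nonempty_iff_eq_empty] at hemp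
    have h1 : ∀ᵐ x ∂μ, x ∈ Icc (0 : ℝ) 1 := hac.ae_le (ae_restrict_mem measurableSet_Icc)
    have h2 : ∀ᵐ x ∂μ, x ∈ U := hU0
    have h3 : ∀ᵐ x ∂μ, False := by
      filter_upwards [h1, h2] with x hx hx'
      have : x ∈ U ∩ Icc 0 1 := ⟨hx', hx⟩
      rw [hemp] at this
      exact this
    obtain ⟨x, hx⟩ := h3.exists
    exact hx
  obtain ⟨N, hN⟩ := hmix U V (isOpen_boundedBelowPoints μ) hV hne hVne
  obtain ⟨x, hxU, horb, hxV⟩ := hN N le_rfl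
  have hk : ∀ k ≤ N, T^[k] x ∈ U := by
    intro k
    induction k with
    | zero => exact fun _ => hxU.1
    | succ k ih =>
      intro hkN
      obtain ⟨I, hI, hxI⟩ := horb k hkN
      rw [Function.iterate_succ_apply']
      exact h.map_mem_boundedBelowPoints hinv hI hxI (ih (by omega))
  obtain ⟨W, hW, hxW, hb⟩ := hk N le_rfl
  refine lt_of_lt_of_le ((hb.mono (inter_subset_left (t := V))).measure_pos ?_)
    (measure_mono inter_subset_right)
  exact ((hW.inter hV).measure_pos volume ⟨_, hxW, hxV⟩).ne'

end PiecewiseExpanding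
end

/-! ### Excluding the points where the density could degenerate -/

noncomputable section

/-- The singular set of a measure for a piecewise expanding map: the points of `[0,1]` near which
`μ` does not dominate Lebesgue measure, and the end points of the images. -/
def singularSet (T : ℝ → ℝ) (𝓘 : Set (Set ℝ)) (μ : Measure ℝ) : Set ℝ :=
  (Icc 0 1 \ boundedBelowPoints μ) ∪ ((⋃ I ∈ 𝓘, frontier (T '' I)) ∪ {0, 1})

namespace PiecewiseExpanding

variable {T : ℝ → ℝ} {𝓘 : Set (Set ℝ)} {ρ C : ℝ} {I : Set ℝ} {μ : Measure ℝ}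

theorem finite_endpoints (h : PiecewiseExpanding T 𝓘 ρ C) :
    ((⋃ I ∈ 𝓘, frontier (T '' I)) ∪ {0, 1}).Finite := by
  refine Set.Finite.union ?_ (Set.toFinite _)
  rw [← biUnion_image (g := fun K : Set ℝ => frontier K)]
  refine h.finiteImages.biUnion ?_
  rintro _ ⟨I, hI, rfl⟩
  obtain ⟨c, d, -, hcd, -, him⟩ := h.image_eq_Ioo hI
  simp only [him, frontier_Ioo hcd]
  exact Set.toFinite _

theorem isClosed_singularSet (h : PiecewiseExpanding T 𝓘 ρ C) :
    IsClosed (singularSet T 𝓘 μ) :=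
  (isClosed_Icc.sdiff (isOpen_boundedBelowPoints μ)).union h.finite_endpoints.isClosed

theorem singularSet_subset_Icc (h : PiecewiseExpanding T 𝓘 ρ C) :
    singularSet T 𝓘 μ ⊆ Icc 0 1 := by
  rintro x (hx | hx | hx)
  · exact hx.1
  · simp only [mem_iUnion] at hx
    obtain ⟨I, hI, hx⟩ := hx
    obtain ⟨c, d, hc, hcd, hd, him⟩ := h.image_eq_Ioo hI
    rw [him, frontier_Ioo hcd] at hx
    rcases hx with rfl | rfl <;> constructor <;> linarith
  · rcases hx with rfl | rfl <;> simp

theorem subset_image_of_disjoint (h : PiecewiseExpanding T 𝓘 ρ C) (hI : I ∈ 𝓘) {S : Set ℝ}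
    (hS : S.OrdConnected) (hd : Disjoint S ((⋃ I ∈ 𝓘, frontier (T '' I)) ∪ {0, 1})) {y : ℝ}
    (hyS : y ∈ S) (hyI : y ∈ T '' I) : S ⊆ T '' I := by
  obtain ⟨c, d, hc, hcd, hd1, him⟩ := h.image_eq_Ioo hI
  have hfr : ∀ z ∈ S, z ∉ frontier (T '' I) := fun z hz hz' =>
    Set.disjoint_left.1 hd hz (Or.inl (mem_biUnion hI hz'))
  rw [him] at hyI hfr ⊢
  rw [frontier_Ioo hcd] at hfr
  intro x hx
  constructor
  · by_contra! hxc
    exact hfr c (hS.out hx hyS ⟨hxc, hyI.1.le⟩) (by simp)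
  · by_contra! hxd
    exact hfr d (hS.out hyS hx ⟨hyI.2.le, hxd⟩) (by simp)

section

variable [IsProbabilityMeasure μ] (h : PiecewiseExpanding T 𝓘 ρ C) (hρ : 1 < ρ)
  (hac : μ ≪ unitLebesgue) (hinv : MeasurePreserving T μ μ)
include h hρ hac hinv

theorem measure_singularSet : μ (singularSet T 𝓘 μ) = 0 := by
  refine measure_union_null (measure_mono_null (fun x hx => hx.2)
    (h.measure_compl_boundedBelowPoints hρ hac hinv)) (hac ?_)
  exact nonpos_iff_eq_zero.1 ((Measure.restrict_apply_le _ _).trans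
    (h.finite_endpoints.measure_zero volume).le)

omit hρ hinv [IsProbabilityMeasure μ] in
theorem measure_compl_sUnion : μ (⋃₀ 𝓘)ᶜ = 0 := by
  refine hac ?_
  have : MeasurableSet (⋃₀ 𝓘)ᶜ :=
    (MeasurableSet.sUnion h.countable fun I hI => h.measurableSet hI).compl
  rw [unitLebesgue, Measure.restrict_apply this, inter_comm]
  exact h.full

/-- Singular points are uniformly separated. Let `G s` be the set of points lying between two
singular points at distance at most `s`. A gap around `T x` shorter than every gap that ends in `D`
lies in the image of the branch through `x`, so its ends pull back to singular points at distance at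
most `s / ρ`. Hence `T⁻¹ (G s) ⊆ G (s / ρ)` up to a null set, while the intersection of the
shrinking sets lies in the null set `E`. So `G` is null for small `s`; being open, it is then empty
by mixing. -/
theorem exists_le_sub_of_mem_singularSet (hmix : IsTopMixing T 𝓘) :
    ∃ m : ℝ, 0 < m ∧ ∀ a ∈ singularSet T 𝓘 μ, ∀ b ∈ singularSet T 𝓘 μ, a < b → m < b - a := by
  set E := singularSet T 𝓘 μ with hE
  set D := (⋃ I ∈ 𝓘, frontier (T '' I)) ∪ {0, 1} with hD
  have hEcl : IsClosed E := h.isClosed_singularSet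
  have hEsub : E ⊆ Icc 0 1 := h.singularSet_subset_Icc
  have hE0 : μ E = 0 := h.measure_singularSet hρ hac hinv
  obtain ⟨m, hm, hgap⟩ := exists_le_gap_length (E := E) h.finite_endpoints
  set G : ℝ → Set ℝ := fun s => {x | ∃ a ∈ E, ∃ b ∈ E, a < x ∧ x < b ∧ b - a ≤ s} with hG
  have hGopen : ∀ s, IsOpen (G s) := fun s => by
    refine isOpen_iff_forall_mem_open.2 fun x ⟨a, ha, b, hb, hax, hxb, hs⟩ => ?_
    exact ⟨Ioo a b, fun y hy => ⟨a, ha, b, hb, hy.1, hy.2, hs⟩, isOpen_Ioo, hax, hxb⟩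
  have hρ0 : 0 < ρ := by linarith
  have hstep : ∀ s < m, μ (T ⁻¹' G s \ G (s / ρ)) = 0 := by
    intro s hs
    refine measure_mono_null (t := (⋃₀ 𝓘)ᶜ ∪ T ⁻¹' E) ?_ (measure_union_null
      (h.measure_compl_sUnion hac)
      (by rw [hinv.measure_preimage hEcl.measurableSet.nullMeasurableSet, hE0]))
    rintro x ⟨⟨a, ha, b, hb, hax, hxb, hab⟩, hx⟩
    by_contra hcon
    simp only [mem_union, mem_compl_iff, not_or, not_not, mem_preimage] at hcon
    obtain ⟨⟨I, hI, hxI⟩, hTE⟩ := hcon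
    obtain ⟨a', ha', b', hb', haa', ha'x, hxb', hb'b, hdis⟩ := exists_gap hEcl ha hb hax hxb hTE
    have hlen : b' - a' ≤ s := by linarith
    have hnD : ¬ (a' ∈ D ∨ b' ∈ D) := fun hor => by
      have := hgap a' ha' b' hb' (ha'x.trans hxb') hdis hor
      linarith
    rw [not_or] at hnD
    have hdis' : Disjoint (Icc a' b') D := by
      refine Set.disjoint_left.2 fun y hy hyD => ?_
      rcases eq_or_lt_of_le hy.1 with rfl | h1
      · exact hnD.1 hyD
      rcases eq_or_lt_of_le hy.2 with rfl | h2
      · exact hnD.2 hyD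
      exact Set.disjoint_left.1 hdis ⟨h1, h2⟩ (Or.inr hyD)
    have hsub := h.subset_image_of_disjoint hI ordConnected_Icc hdis'
      (⟨ha'x.le, hxb'.le⟩ : T x ∈ Icc a' b') (mem_image_of_mem T hxI)
    obtain ⟨u, hu, hua⟩ := hsub (left_mem_Icc.2 (ha'x.trans hxb').le)
    obtain ⟨w, hw, hwb⟩ := hsub (right_mem_Icc.2 (ha'x.trans hxb').le)
    -- A good point has a good image. So if `T y` is singular for a reason other than being an end
    -- point in `D`, then `y` is singular.
    have hmemE : ∀ y ∈ I, T y ∈ E → T y ∉ D → y ∈ E := by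
      intro y hy hTy hTyD
      refine Or.inl ⟨h.subset_Icc hI hy, fun hyU => ?_⟩
      rcases hTy with hTy | hTy
      · exact hTy.2 (h.map_mem_boundedBelowPoints hinv hI hy hyU)
      · exact hTyD hTy
    have huE : u ∈ E := hmemE u hu (hua ▸ ha') (hua ▸ hnD.1)
    have hwE : w ∈ E := hmemE w hw (hwb ▸ hb') (hwb ▸ hnD.2)
    have hdist : |w - u| ≤ s / ρ := by
      rw [le_div_iff₀ hρ0, mul_comm]
      refine (h.mul_abs_sub_le hI hw hu).trans ?_
      rw [hua, hwb, abs_of_pos (by linarith)]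
      exact hlen
    have hdist' := abs_le.1 hdist
    rw [← hua] at ha'x
    rw [← hwb] at hxb'
    apply hx
    rcases h.strictMonoOrAnti I hI with hmo | hmo
    · exact ⟨u, huE, w, hwE, (hmo.lt_iff_lt hu hxI).1 ha'x, (hmo.lt_iff_lt hxI hw).1 hxb', hdist'.2⟩
    · exact ⟨w, hwE, u, huE, (hmo.lt_iff_gt hxI hw).1 hxb', (hmo.lt_iff_gt hu hxI).1 ha'x,
        by linarith [hdist'.1]⟩
  have hzero : μ (G (m / 2)) = 0 := by
    have hpow : ∀ n : ℕ, m / 2 / ρ ^ n ≤ m / 2 := fun n =>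
      div_le_self (by positivity) (one_le_pow₀ hρ.le)
    have := measure_eq_zero_of_shrinking hinv (G := fun n => G (m / 2 / ρ ^ n))
      (fun n => (hGopen _).measurableSet) ?_ ?_ ?_
    · simpa using this
    · intro i j hij x ⟨a, ha, b, hb, hax, hxb, hs⟩
      refine ⟨a, ha, b, hb, hax, hxb, hs.trans ?_⟩
      gcongr
      exact hρ.le
    · refine measure_mono_null (fun x hx => ?_) hE0
      by_contra hxE
      obtain ⟨ε, hε, hball⟩ := Metric.isOpen_iff.1 hEcl.isOpen_compl x hxE
      obtain ⟨n, hn⟩ := ((tendsto_pow_atTop_atTop_of_one_lt hρ).eventually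
        (eventually_gt_atTop (m / 2 / ε))).exists
      obtain ⟨a, ha, b, hb, hax, hxb, hs⟩ := mem_iInter.1 hx n
      refine hball (?_ : a ∈ Metric.ball x ε) ha
      rw [Metric.mem_ball, Real.dist_eq, abs_lt]
      have : m / 2 / ρ ^ n < ε := by
        rw [div_lt_iff₀ (by positivity)] at hn ⊢
        linarith
      constructor <;> linarith
    · intro n
      have := hstep (m / 2 / ρ ^ n) (by linarith [hpow n])
      have he : m / 2 / ρ ^ n / ρ = m / 2 / ρ ^ (n + 1) := by rw [pow_succ]; field_simp
      rwa [he] at this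
  refine ⟨m / 2, half_pos hm, fun a ha b hb hab => ?_⟩
  by_contra! hle
  have hmem : (a + b) / 2 ∈ G (m / 2) := ⟨a, ha, b, hb, by linarith, by linarith, hle⟩
  have h1 := hEsub ha
  have h2 := hEsub hb
  refine (h.measure_pos_of_isTopMixing hρ hmix hac hinv (hGopen (m / 2))
    ⟨(a + b) / 2, hmem, ?_⟩).ne' hzero
  constructor <;> linarith [h1.1, h1.2, h2.1, h2.2]

omit hρ hac [IsProbabilityMeasure μ] in
/-- One-sided neighbourhoods on which `μ` does not dominate Lebesgue measure pull back to such
neighbourhoods. -/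
theorem exists_halfInterval_of_map_mem (hI : I ∈ 𝓘) {x z σ s : ℝ} (hxI : x ∈ I)
    (hσ : σ = 1 ∨ σ = -1) (hx : T x ∈ halfInterval z σ s) (hS : halfInterval z σ s ⊆ T '' I)
    (hb : ∀ δ > 0, ¬ BoundedBelowOn μ (halfInterval z σ δ)) :
    ∃ w σ' : ℝ, w ∈ Icc (0 : ℝ) 1 ∧ (σ' = 1 ∨ σ' = -1) ∧ x ∈ halfInterval w σ' (s / ρ) ∧
      (∃ η > 0, halfInterval w σ' η ⊆ Icc 0 1) ∧
      ∀ δ > 0, ¬ BoundedBelowOn μ (halfInterval w σ' δ) := by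
  have hρ0 := h.rho_pos
  set y := Function.invFunOn T I with hy
  have hyI : ∀ t ∈ T '' I, y t ∈ I := fun t ht => Function.invFunOn_mem ht
  have hTy : ∀ t ∈ T '' I, T (y t) = t := fun t ht => Function.invFunOn_eq ht
  have hyT : ∀ u ∈ I, y (T u) = u := fun u hu => (h.injOn hI).leftInvOn_invFunOn hu
  have hLip : LipschitzOnWith (ρ⁻¹).toNNReal y (T '' I) :=
    LipschitzOnWith.of_dist_le_mul fun t ht t' ht' => by
      rw [Real.dist_eq, Real.dist_eq, Real.coe_toNNReal _ (inv_nonneg.2 hρ0.le), inv_mul_eq_div,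
        le_div_iff₀ hρ0, mul_comm]
      have := h.mul_abs_sub_le hI (hyI t ht) (hyI t' ht')
      rwa [hTy t ht, hTy t' ht'] at this
  -- The point `z` may be an end of the image, where the inverse branch is not defined. Its
  -- Lipschitz extension supplies the limit `w` of the branch at `z`, and `w` remains in `[0,1]`.
  obtain ⟨Y, hYL, hYy⟩ := hLip.extend_real
  set w := Y z with hw
  have hYdist : ∀ t ∈ halfInterval z σ s, |y t - w| ≤ |t - z| / ρ := by
    intro t ht
    have h1 := hYL.dist_le_mul t z
    rw [Real.dist_eq, Real.dist_eq, Real.coe_toNNReal _ (inv_nonneg.2 hρ0.le), inv_mul_eq_div,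
      ← hYy (hS ht)] at h1
    exact h1
  obtain ⟨σ', hσ', hmono⟩ : ∃ σ' : ℝ, (σ' = 1 ∨ σ' = -1) ∧ ∀ t ∈ T '' I, ∀ t' ∈ T '' I,
      0 < σ * (t - t') → 0 < σ' * (y t - y t') := by
    rcases h.strictMonoOrAnti I hI with hm | hm
    · refine ⟨σ, hσ, fun t ht t' ht' htt => ?_⟩
      have h1 := hm.lt_iff_lt (hyI t ht) (hyI t' ht')
      have h2 := hm.lt_iff_lt (hyI t' ht') (hyI t ht)
      rw [hTy t ht, hTy t' ht'] at h1 h2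
      rcases hσ with rfl | rfl
      · linarith [h2.1 (by linarith)]
      · linarith [h1.1 (by linarith)]
    · refine ⟨-σ, by rcases hσ with rfl | rfl <;> simp, fun t ht t' ht' htt => ?_⟩
      have h1 := hm.lt_iff_gt (hyI t ht) (hyI t' ht')
      have h2 := hm.lt_iff_gt (hyI t' ht') (hyI t ht)
      rw [hTy t ht, hTy t' ht'] at h1 h2
      rcases hσ with rfl | rfl
      · linarith [h2.1 (by linarith)]
      · linarith [h1.1 (by linarith)]
  have hscale : ∀ t ∈ halfInterval z σ s, ∀ r ∈ Ioc (0 : ℝ) 1,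
      z + (t - z) * r ∈ halfInterval z σ s := by
    intro t ht r hr
    have he : σ * (z + (t - z) * r - z) = σ * (t - z) * r := by ring
    refine ⟨?_, ?_⟩
    · rw [he]; exact mul_pos ht.1 hr.1
    · rw [he]; nlinarith [ht.1, ht.2, hr.1, hr.2]
  have hlim : ∀ t : ℝ, Tendsto (fun r : ℝ => Y (z + (t - z) * r)) (𝓝[>] 0) (𝓝 w) := by
    intro t
    have hc : Continuous fun r : ℝ => Y (z + (t - z) * r) := by
      have := hYL.continuous
      fun_prop
    simpa using (hc.tendsto 0).mono_left nhdsWithin_le_nhds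
  have hr : ∀ᶠ r : ℝ in 𝓝[>] 0, r ∈ Ioc (0 : ℝ) (1 / 4) := Ioc_mem_nhdsGT (by norm_num)
  -- Passing to the limit along points sliding towards `z` gives only a weak inequality; the
  -- intermediate point `t'` makes it strict.
  have hpos : ∀ t ∈ halfInterval z σ s, 0 < σ' * (y t - w) := by
    intro t ht
    set t' := z + (t - z) * (1 / 2) with ht'
    have ht'S : t' ∈ halfInterval z σ s := hscale t ht _ (by norm_num)
    have h1 : 0 < σ' * (y t - y t') := hmono t (hS ht) t' (hS ht'S) (by
      have : σ * (t - t') = σ * (t - z) * (1 / 2) := by rw [ht']; ring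
      rw [this]; linarith [ht.1])
    have h2 : 0 ≤ σ' * (y t' - w) := by
      refine ge_of_tendsto (((hlim t).const_sub (y t')).const_mul σ') ?_
      filter_upwards [hr] with r hr
      have hrS := hscale t ht r ⟨hr.1, by linarith [hr.2]⟩
      rw [← hYy (hS hrS)]
      refine (hmono t' (hS ht'S) _ (hS hrS) ?_).le
      have : σ * (t' - (z + (t - z) * r)) = σ * (t - z) * (1 / 2 - r) := by rw [ht']; ring
      rw [this]
      exact mul_pos ht.1 (by linarith [hr.2])
    linarith
  have hxy : y (T x) = x := hyT x hxI
  have hwIcc : w ∈ Icc (0 : ℝ) 1 := by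
    refine isClosed_Icc.mem_of_tendsto (hlim (T x)) ?_
    filter_upwards [hr] with r hr
    have hrS := hscale _ hx r ⟨hr.1, by linarith [hr.2]⟩
    rw [← hYy (hS hrS)]
    exact h.subset_Icc hI (hyI _ (hS hrS))
  have hmem : ∀ t ∈ halfInterval z σ s, ∀ δ, |t - z| < δ → y t ∈ halfInterval w σ' (δ / ρ) := by
    intro t ht δ hδ
    refine ⟨hpos t ht, ?_⟩
    have h1 := hYdist t ht
    have h2 : σ' * (y t - w) ≤ |y t - w| := by
      rcases hσ' with rfl | rfl
      · rw [one_mul]; exact le_abs_self _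
      · rw [neg_one_mul]; exact neg_le_abs _
    exact h2.trans_lt (h1.trans_lt (by gcongr))
  have hxH : x ∈ halfInterval w σ' (s / ρ) := by
    have := hmem _ hx s (abs_sub_lt_of_mem_halfInterval hσ hx).2
    rwa [hxy] at this
  refine ⟨w, σ', hwIcc, hσ', hxH, ⟨σ' * (x - w), hxH.1, fun u hu => ?_⟩, fun δ hδ hbb => ?_⟩
  · have hxc := h.subset_Icc hI hxI
    obtain ⟨h1, h2⟩ := hu
    rcases hσ' with rfl | rfl <;> constructor <;> linarith [hxc.1, hxc.2, hwIcc.1, hwIcc.2]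
  -- A lower bound on a half-interval of length `δ` at `w` would be pushed forward by `T` to one at
  -- `z`, of length `min s (δ * ρ)` since the inverse branch contracts by `ρ`.
  · have hs0 : 0 < s := hx.1.trans hx.2
    refine hb (min s (δ * ρ)) (lt_min hs0 (by positivity)) ?_
    refine (h.boundedBelowOn_image hinv hI (inter_subset_left (t := halfInterval w σ' δ))
      (hbb.mono inter_subset_right)).mono fun t ht => ?_
    have htS : t ∈ halfInterval z σ s := ⟨ht.1, ht.2.trans_le (min_le_left _ _)⟩
    refine ⟨y t, ⟨hyI t (hS htS), ?_⟩, hTy t (hS htS)⟩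
    have := hmem t htS (δ * ρ)
      ((abs_sub_lt_of_mem_halfInterval hσ ht).2.trans_le (min_le_right _ _))
    rwa [mul_div_cancel_right₀ _ hρ0.ne'] at this

/-- The shrinking argument again, now for half-intervals of length `s` at the pairs `(z, σ)`
violating the claim. Such a `z` is singular, so for `s ≤ m` its half-interval contains no other
singular point, in particular no end of an image. It therefore lies in every image it meets and
pulls back to a half-interval of length `s / ρ` at another bad pair. The union of these
half-intervals is open and must be null, so no bad pair exists. -/
theorem exists_boundedBelowOn_halfInterval (hmix : IsTopMixing T 𝓘) {z σ : ℝ}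
    (hz : z ∈ Icc (0 : ℝ) 1) (hσ : σ = 1 ∨ σ = -1) (hin : ∃ η > 0, halfInterval z σ η ⊆ Icc 0 1) :
    ∃ δ > 0, BoundedBelowOn μ (halfInterval z σ δ) := by
  obtain ⟨m, hm, hsep⟩ := h.exists_le_sub_of_mem_singularSet hρ hac hinv hmix
  set E := singularSet T 𝓘 μ with hE
  have hEcl : IsClosed E := h.isClosed_singularSet
  have hE0 : μ E = 0 := h.measure_singularSet hρ hac hinv
  have hρ0 : 0 < ρ := by linarith
  set Z : ℝ → ℝ → Prop := fun z σ => z ∈ Icc (0 : ℝ) 1 ∧ (σ = 1 ∨ σ = -1) ∧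
    (∃ η > 0, halfInterval z σ η ⊆ Icc 0 1) ∧ ∀ δ > 0, ¬ BoundedBelowOn μ (halfInterval z σ δ)
    with hZ
  set A : ℝ → Set ℝ := fun s => {x | ∃ z σ, Z z σ ∧ x ∈ halfInterval z σ s} with hA
  have hAopen : ∀ s, IsOpen (A s) := fun s => by
    refine isOpen_iff_forall_mem_open.2 fun x ⟨z, σ, hzσ, hx⟩ => ?_
    exact ⟨halfInterval z σ s, fun y hy => ⟨z, σ, hzσ, hy⟩, isOpen_halfInterval _ _ _, hx⟩
  have hZE : ∀ z σ, Z z σ → z ∈ E := by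
    rintro z σ ⟨hz, hσ, -, hb⟩
    refine Or.inl ⟨hz, ?_⟩
    rintro ⟨W, hW, hzW, hWb⟩
    obtain ⟨ε, hε, hball⟩ := Metric.isOpen_iff.1 hW z hzW
    refine hb ε hε (hWb.mono fun y hy => hball ?_)
    rw [Metric.mem_ball, Real.dist_eq]
    exact (abs_sub_lt_of_mem_halfInterval hσ hy).2
  have hsep' : ∀ a ∈ E, ∀ b ∈ E, a ≠ b → m < |a - b| := by
    intro a ha b hb hab
    rcases lt_or_gt_of_ne hab with hlt | hlt
    · rw [abs_sub_comm, abs_of_pos (by linarith)]; exact hsep a ha b hb hlt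
    · rw [abs_of_pos (by linarith)]; exact hsep b hb a ha hlt
  have hstep : ∀ s ≤ m, μ (T ⁻¹' A s \ A (s / ρ)) = 0 := by
    intro s hs
    refine measure_mono_null ?_ (h.measure_compl_sUnion hac)
    rintro x ⟨⟨z, σ, hzσ, hx⟩, hxA⟩ ⟨I, hI, hxI⟩
    have hzE := hZE z σ hzσ
    obtain ⟨hz, hσ, hη, hb⟩ := hzσ
    have hdis : Disjoint (halfInterval z σ s) E := by
      refine Set.disjoint_left.2 fun e he heE => ?_
      have h1 := abs_sub_lt_of_mem_halfInterval hσ he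
      have h2 := hsep' e heE z hzE (fun hez => by rw [hez] at h1; simp at h1)
      linarith
    have hsub := h.subset_image_of_disjoint hI (ordConnected_halfInterval hσ)
      (hdis.mono_right fun y hy => Or.inr hy) hx (mem_image_of_mem T hxI)
    obtain ⟨w, σ', hw, hσ', hxw, hη', hb'⟩ :=
      h.exists_halfInterval_of_map_mem hinv hI hxI hσ hx hsub hb
    exact hxA ⟨w, σ', ⟨hw, hσ', hη', hb'⟩, hxw⟩
  have hzero : μ (A m) = 0 := by
    have hpow : ∀ n : ℕ, m / ρ ^ n ≤ m := fun n => div_le_self hm.le (one_le_pow₀ hρ.le)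
    have := measure_eq_zero_of_shrinking hinv (G := fun n => A (m / ρ ^ n))
      (fun n => (hAopen _).measurableSet) ?_ ?_ ?_
    · simpa using this
    · intro i j hij x ⟨z, σ, hzσ, hx⟩
      refine ⟨z, σ, hzσ, hx.1, hx.2.trans_le ?_⟩
      gcongr
      exact hρ.le
    · refine measure_mono_null (fun x hx => ?_) hE0
      by_contra hxE
      obtain ⟨ε, hε, hball⟩ := Metric.isOpen_iff.1 hEcl.isOpen_compl x hxE
      obtain ⟨n, hn⟩ := ((tendsto_pow_atTop_atTop_of_one_lt hρ).eventually
        (eventually_gt_atTop (m / ε))).exists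
      obtain ⟨z, σ, hzσ, hx⟩ := mem_iInter.1 hx n
      refine hball (?_ : z ∈ Metric.ball x ε) (hZE z σ hzσ)
      rw [Metric.mem_ball, Real.dist_eq, abs_sub_comm]
      refine (abs_sub_lt_of_mem_halfInterval hzσ.2.1 hx).2.trans ?_
      rw [div_lt_iff₀ hε] at hn
      rw [div_lt_iff₀ (by positivity)]
      linarith
    · intro n
      have := hstep (m / ρ ^ n) (hpow n)
      rwa [div_div, ← pow_succ] at this
  by_contra! hcon
  obtain ⟨η, hη, hηsub⟩ := hin
  have hmin : 0 < min η m := lt_min hη hm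
  have hmem : z + σ * (min η m / 2) ∈ halfInterval z σ (min η m) := by
    have : σ * σ = 1 := by rcases hσ with rfl | rfl <;> norm_num
    have h1 : σ * (z + σ * (min η m / 2) - z) = min η m / 2 := by
      rw [add_sub_cancel_left, ← mul_assoc, this, one_mul]
    constructor <;> rw [h1] <;> linarith
  refine (h.measure_pos_of_isTopMixing hρ hmix hac hinv (hAopen m)
    ⟨_, ⟨z, σ, ⟨hz, hσ, ⟨η, hη, hηsub⟩, hcon⟩, hmem.1, hmem.2.trans_le (min_le_right _ _)⟩,
      hηsub ⟨hmem.1, hmem.2.trans_le (min_le_left _ _)⟩⟩).ne' hzero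

/-- Each point of `[0,1]` has a lower bound on either side, where the side may leave `[0,1]` at
once, and the point itself is null; compactness leaves finitely many neighbourhoods. -/
theorem boundedBelowOn_Icc (hmix : IsTopMixing T 𝓘) : BoundedBelowOn μ (Icc 0 1) := by
  have key : BoundedBelowOn μ (Icc 0 1 ∩ Icc 0 1) := by
    refine isCompact_Icc.induction_on (p := fun S => BoundedBelowOn μ (S ∩ Icc 0 1)) ?_ ?_ ?_ ?_
    · exact BoundedBelowOn.of_volume_eq_zero (by simp)
    · exact fun s t hst ht => ht.mono (inter_subset_inter_left _ hst)
    · intro s t hs ht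
      rw [union_inter_distrib_right]
      exact hs.union ht
    · intro x hx
      have side : ∀ σ : ℝ, (σ = 1 ∨ σ = -1) →
          ∃ δ > 0, BoundedBelowOn μ (halfInterval x σ δ ∩ Icc 0 1) := by
        intro σ hσ
        by_cases hin : ∃ η > 0, halfInterval x σ η ⊆ Icc 0 1
        · obtain ⟨δ, hδ, hb⟩ := h.exists_boundedBelowOn_halfInterval hρ hac hinv hmix hx hσ hin
          exact ⟨δ, hδ, hb.mono inter_subset_left⟩
        · refine ⟨1, one_pos, BoundedBelowOn.of_volume_eq_zero ?_⟩
          have : halfInterval x σ 1 ∩ Icc 0 1 = ∅ := by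
            rw [← not_nonempty_iff_eq_empty]
            rintro ⟨y, hy, hyI⟩
            refine hin ⟨σ * (y - x), hy.1, fun u hu => ?_⟩
            obtain ⟨h1, h2⟩ := hu
            rcases hσ with rfl | rfl <;> constructor <;> linarith [hyI.1, hyI.2, hx.1, hx.2]
          rw [this, measure_empty]
      obtain ⟨δ₁, hδ₁, hb₁⟩ := side 1 (Or.inl rfl)
      obtain ⟨δ₂, hδ₂, hb₂⟩ := side (-1) (Or.inr rfl)
      refine ⟨Ioo (x - δ₂) (x + δ₁), mem_nhdsWithin_of_mem_nhds
        (Ioo_mem_nhds (by linarith) (by linarith)), ?_⟩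
      refine ((hb₁.union hb₂).union (BoundedBelowOn.of_volume_eq_zero
        (measure_singleton x))).mono ?_
      rintro y ⟨hy, hyI⟩
      rcases lt_trichotomy y x with hlt | rfl | hlt
      · exact Or.inl (Or.inr ⟨⟨by linarith, by linarith [hy.1]⟩, hyI⟩)
      · exact Or.inr rfl
      · exact Or.inl (Or.inl ⟨⟨by linarith, by linarith [hy.2]⟩, hyI⟩)
  rwa [inter_self] at key

/-- The invariant density has a version that is of bounded variation and bounded away from zero. -/
theorem exists_density (hmix : IsTopMixing T 𝓘) :
    ∃ (g : ℝ → ℝ) (c M V : ℝ), 0 < c ∧ 0 ≤ V ∧ Measurable g ∧ (∀ x, c ≤ g x) ∧ (∀ x, g x ≤ M) ∧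
      (∃ g' : ℝ → ℝ, g' =ᵐ[unitLebesgue] g ∧ (∀ x, c ≤ g' x) ∧ (∀ x, g' x ≤ M) ∧
        eVariationOn g' (Icc 0 1) ≤ ENNReal.ofReal V) ∧
      μ = unitLebesgue.withDensity fun x => ENNReal.ofReal (g x) := by
  obtain ⟨c, hc, hb⟩ := h.boundedBelowOn_Icc hρ hac hinv hmix
  obtain ⟨g, V, hV0, hg, hgV⟩ := h.exists_density_essVar_le hρ hac hinv
  set r := fun x => (μ.rnDeriv unitLebesgue x).toReal with hr
  have hrm : Measurable r := (Measure.measurable_rnDeriv _ _).ennreal_toReal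
  have hfin := Measure.rnDeriv_lt_top μ unitLebesgue
  have hlow : ∀ᵐ x ∂unitLebesgue, c ≤ r x := by
    have h1 : (fun _ => ENNReal.ofReal c) ≤ᵐ[unitLebesgue] μ.rnDeriv unitLebesgue := by
      refine ae_le_of_forall_setLIntegral_le_of_sigmaFinite measurable_const fun s hs _ => ?_
      rw [setLIntegral_const, Measure.setLIntegral_rnDeriv hac, unitLebesgue,
        Measure.restrict_apply hs]
      exact (hb _ inter_subset_right).trans (measure_mono inter_subset_left)
    filter_upwards [h1, hfin] with x hx hx'
    exact (ENNReal.ofReal_le_iff_le_toReal hx'.ne).1 hx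
  set M := max c (g 0 + V) with hM
  have h0 : (0 : ℝ) ∈ Icc (0 : ℝ) 1 := by simp
  have hup : ∀ x ∈ Icc (0 : ℝ) 1, g x ≤ g 0 + V := by
    intro x hx
    have h1 := (eVariationOn.edist_le g hx h0).trans hgV
    rw [edist_dist, ENNReal.ofReal_le_ofReal_iff hV0, Real.dist_eq] at h1
    linarith [le_abs_self (g x - g 0)]
  -- Almost everywhere the density already lies in `[c, M]`. Clipping enforces the bounds at every
  -- point without increasing the variation, since it is 1-Lipschitz.
  set clip : ℝ → ℝ := fun y => max c (min M y) with hclip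
  have hclip1 : ∀ y, c ≤ clip y := fun y => le_max_left _ _
  have hclip2 : ∀ y, clip y ≤ M := fun y => max_le (le_max_left _ _) (min_le_left _ _)
  have hclipL : LipschitzWith 1 clip := (LipschitzWith.id.const_min M).const_max c
  have hclipr : ∀ᵐ x ∂unitLebesgue, clip (r x) = r x := by
    filter_upwards [hlow, hg, ae_restrict_mem measurableSet_Icc] with x hx hxg hxI
    have h2 : r x ≤ M := by rw [← hxg]; exact (hup x hxI).trans (le_max_right _ _)
    simp only [hclip, min_eq_right h2, max_eq_right hx]
  refine ⟨fun x => clip (r x), c, M, V, hc, hV0, hclipL.continuous.measurable.comp hrm,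
    fun x => hclip1 _, fun x => hclip2 _, ⟨fun x => clip (g x), ?_, fun x => hclip1 _,
    fun x => hclip2 _, ?_⟩, ?_⟩
  · filter_upwards [hg] with x hx
    rw [hx]
  · have := (hclipL.lipschitzOnWith (s := univ)).comp_eVariationOn_le (g := g) (s := Icc 0 1)
      (mapsTo_univ _ _)
    refine this.trans ?_
    simpa using hgV
  · conv_lhs => rw [← Measure.withDensity_rnDeriv_eq _ _ hac]
    refine withDensity_congr_ae ?_
    filter_upwards [hclipr, hfin] with x hx hx'
    rw [hx, ENNReal.ofReal_toReal hx'.ne]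

end

end PiecewiseExpanding
end

noncomputable section

/-! ### Contraction on functions of mean zero -/

instance : IsProbabilityMeasure unitLebesgue := ⟨by simp⟩

theorem norm_le_add_integral_norm {E : Type*} [NormedAddCommGroup E] {f : ℝ → E} {V : ℝ}
    (hV0 : 0 ≤ V) (hV : eVariationOn f (Icc 0 1) ≤ ENNReal.ofReal V)
    (hf : Integrable f unitLebesgue) {x : ℝ} (hx : x ∈ Icc (0 : ℝ) 1) :
    ‖f x‖ ≤ V + ∫ y, ‖f y‖ ∂unitLebesgue := by
  have h1 : ∫ y in Icc (0 : ℝ) 1, (‖f x‖ - V) ≤ ∫ y in Icc (0 : ℝ) 1, ‖f y‖ := by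
    refine setIntegral_mono_on (by simp) hf.norm measurableSet_Icc fun y hy => ?_
    linarith [norm_le_add_of_eVariationOn_le hV0 hV hx hy]
  rw [setIntegral_const, measureReal_def, Real.volume_Icc] at h1
  simp only [sub_zero, ENNReal.ofReal_one, ENNReal.toReal_one, one_smul] at h1
  linarith

theorem exists_ae_eq_eVariationOn_le {E : Type*} [NormedAddCommGroup E] {f : ℝ → E} {V W : ℝ}
    (hV : essVar unitLebesgue f (Icc 0 1) ≤ ENNReal.ofReal V) (hW : 0 < W) (hVW : V < W) :
    ∃ g : ℝ → E, g =ᵐ[unitLebesgue] f ∧ eVariationOn g (Icc 0 1) ≤ ENNReal.ofReal W := by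
  obtain ⟨g, hg, hgV⟩ := exists_ae_eq_eVariationOn_lt (hV.trans_lt
    ((ENNReal.ofReal_lt_ofReal_iff hW).2 hVW))
  rw [unitLebesgue_restrict_Icc] at hg
  exact ⟨g, hg, hgV.le⟩

theorem integral_max_zero_add_integral_max_neg_zero {X : Type*} [MeasurableSpace X] {μ : Measure X}
    {f : X → ℝ} (hf : Integrable f μ) (h0 : ∫ x, f x ∂μ = 0) :
    ∫ x, max (f x) 0 ∂μ = (∫ x, |f x| ∂μ) / 2 ∧ ∫ x, max (-f x) 0 ∂μ = (∫ x, |f x| ∂μ) / 2 := by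
  have h1 : ∫ x, max (f x) 0 ∂μ - ∫ x, max (-f x) 0 ∂μ = 0 := by
    rw [← integral_sub hf.pos_part hf.neg_part]
    refine Eq.trans ?_ h0
    exact integral_congr_ae (Eventually.of_forall fun x => max_zero_sub_max_neg_zero_eq_self (f x))
  have h2 : ∫ x, max (f x) 0 ∂μ + ∫ x, max (-f x) 0 ∂μ = ∫ x, |f x| ∂μ := by
    rw [← integral_add hf.pos_part hf.neg_part]
    exact integral_congr_ae (Eventually.of_forall fun x =>
      max_zero_add_max_neg_zero_eq_abs_self (f x))
  constructor <;> linarith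

namespace PiecewiseExpanding

variable {T : ℝ → ℝ} {𝓘 : Set (Set ℝ)} {ρ C : ℝ}

theorem continuousAt_iterate (h : PiecewiseExpanding T 𝓘 ρ C) {x : ℝ} (n : ℕ)
    (hx : ∀ k < n, T^[k] x ∈ ⋃₀ 𝓘) : ContinuousAt T^[n] x := by
  induction n with
  | zero => exact continuousAt_id
  | succ n ih =>
    rw [Function.iterate_succ']
    obtain ⟨I, hI, hxI⟩ := hx n (Nat.lt_succ_self n)
    exact ContinuousAt.comp (h.differentiableAt I hI _ hxI).continuousAt
      (ih fun k hk => hx k (hk.trans (Nat.lt_succ_self n)))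

/-- Mixing provides a point whose orbit stays in the open partition intervals, where the iterate is
continuous; a whole neighbourhood therefore follows it. The point may be `0` or `1`, hence the
passage to the open interval. -/
theorem eventually_measure_inter_preimage_pos (h : PiecewiseExpanding T 𝓘 ρ C)
    (hmix : IsTopMixing T 𝓘) {U V : Set ℝ} (hU : IsOpen U) (hV : IsOpen V)
    (hUne : (U ∩ Icc 0 1).Nonempty) (hVne : (V ∩ Icc 0 1).Nonempty) :
    ∀ᶠ n in atTop, 0 < unitLebesgue.real (U ∩ T^[n] ⁻¹' V) := by
  obtain ⟨N, hN⟩ := hmix U V hU hV hUne hVne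
  filter_upwards [eventually_ge_atTop N] with n hn
  obtain ⟨x, ⟨hxU, hxI⟩, horb, hxV⟩ := hN n hn
  have hnhds : U ∩ T^[n] ⁻¹' V ∈ 𝓝 x :=
    inter_mem (hU.mem_nhds hxU) ((h.continuousAt_iterate n horb).preimage_mem_nhds
      (hV.mem_nhds hxV))
  obtain ⟨W, hWs, hWo, hxW⟩ := mem_nhds_iff.1 hnhds
  have hcl : x ∈ closure (Ioo (0 : ℝ) 1) := by rwa [closure_Ioo zero_ne_one]
  obtain ⟨y, hyW, hyI⟩ := mem_closure_iff.1 hcl W hWo hxW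
  refine ENNReal.toReal_pos (ne_of_gt ?_) (measure_ne_top _ _)
  refine lt_of_lt_of_le ((hWo.inter isOpen_Ioo).measure_pos volume ⟨y, hyW, hyI⟩) ?_
  rw [Measure.restrict_apply' measurableSet_Icc]
  exact measure_mono fun z hz => ⟨hWs hz.1, Ioo_subset_Icc_self hz.2⟩

theorem eventually_forall_grid (h : PiecewiseExpanding T 𝓘 ρ C) (hmix : IsTopMixing T 𝓘) (m : ℕ) :
    ∀ᶠ n in atTop, ∀ i < m, ∀ j < m, 0 < unitLebesgue.real
      (Ioo ((i : ℝ) / m) ((i + 1 : ℕ) / m) ∩ T^[n] ⁻¹' Ioo ((j : ℝ) / m) ((j + 1 : ℕ) / m)) := by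
  have hne : ∀ i < m, (Ioo ((i : ℝ) / m) ((i + 1 : ℕ) / m) ∩ Icc 0 1).Nonempty := by
    intro i hi
    have hm : (0 : ℝ) < m := by exact_mod_cast Nat.zero_lt_of_lt hi
    have hi' : (i : ℝ) + 1 ≤ m := by exact_mod_cast hi
    have hi0 : (0 : ℝ) ≤ i := Nat.cast_nonneg i
    refine ⟨((i : ℝ) + 1 / 2) / m, ⟨?_, ?_⟩, by positivity, ?_⟩
    · gcongr; linarith
    · gcongr; push_cast; linarith
    · rw [div_le_one hm]; linarith
  have h1 : ∀ i ∈ Finset.range m, ∀ᶠ n in atTop, ∀ j ∈ Finset.range m, 0 < unitLebesgue.real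
      (Ioo ((i : ℝ) / m) ((i + 1 : ℕ) / m) ∩ T^[n] ⁻¹' Ioo ((j : ℝ) / m) ((j + 1 : ℕ) / m)) := by
    intro i hi
    rw [Filter.eventually_all_finset]
    intro j hj
    exact h.eventually_measure_inter_preimage_pos hmix isOpen_Ioo isOpen_Ioo
      (hne i (Finset.mem_range.1 hi)) (hne j (Finset.mem_range.1 hj))
  filter_upwards [(Filter.eventually_all_finset _).2 h1] with n hn i hi j hj
  exact hn i (Finset.mem_range.2 hi) j (Finset.mem_range.2 hj)

/-- Functions of mean zero whose variation is dominated by their `L¹`-norm are contracted in `L¹`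
by a large iterate. -/
theorem exists_integral_abs_le (h : PiecewiseExpanding T 𝓘 ρ C) (hρ : 1 < ρ) (hTm : Measurable T)
    (hmix : IsTopMixing T 𝓘) {n₀ : ℕ} (hn₀ : 0 < n₀) {K : ℝ} (hK0 : 0 ≤ K)
    (hK : ∀ (m : ℕ) (f k : ℝ → ℝ) (V : ℝ), IsRealTransfer T^[n₀ * m] f k → 0 ≤ V →
      essVar unitLebesgue f (Icc 0 1) ≤ ENNReal.ofReal V →
      essVar unitLebesgue k (Icc 0 1) ≤ ENNReal.ofReal (V / 4 ^ m + K * ∫ x, |f x| ∂unitLebesgue))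
    {a : ℝ} (ha : 0 ≤ a) :
    ∃ m : ℕ, ∃ γ : ℝ, 0 < γ ∧ γ ≤ 1 ∧ ∀ u u' : ℝ → ℝ, IsRealTransfer T^[n₀ * m] u u' →
      ∫ x, u x ∂unitLebesgue = 0 →
      essVar unitLebesgue u (Icc 0 1) ≤ ENNReal.ofReal (a * ∫ x, |u x| ∂unitLebesgue) →
      ∫ x, |u' x| ∂unitLebesgue ≤ (1 - γ) * ∫ x, |u x| ∂unitLebesgue := by
  -- With `s` the L¹-norm of `u`, `W * s` bounds the variation of the parts of `u` before and after
  -- transfer. Each part has integral `s / 2`, so finding an interval where it is at least `s / 4`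
  -- takes a grid with `M > 4W`.
  set W := a + K + 3 with hW
  obtain ⟨M, hM⟩ := exists_nat_gt (4 * W)
  have hM0 : 0 < M := by
    have : (0 : ℝ) < M := by linarith
    exact_mod_cast this
  obtain ⟨n₁, hn₁⟩ := eventually_atTop.1 (h.eventually_forall_grid hmix M)
  have hmix' := hn₁ (n₀ * n₁) (Nat.le_mul_of_pos_left _ hn₀)
  set J : ℕ → Set ℝ := fun i => Ioo ((i : ℝ) / M) ((i + 1 : ℕ) / M) with hJ
  set N := n₀ * n₁ with hN
  have hTN : Measurable T^[N] := hTm.iterate N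
  obtain ⟨β, hβ0, hβ⟩ : ∃ β : ℝ, 0 < β ∧ ∀ i < M, ∀ j < M,
      β ≤ unitLebesgue.real (J i ∩ T^[N] ⁻¹' J j) := by
    have hne : (Finset.range M ×ˢ Finset.range M).Nonempty :=
      ⟨(0, 0), by simp [hM0]⟩
    obtain ⟨z, hz, hzmin⟩ := Finset.exists_min_image (Finset.range M ×ˢ Finset.range M)
      (fun z : ℕ × ℕ => unitLebesgue.real (J z.1 ∩ T^[N] ⁻¹' J z.2)) hne
    rw [Finset.mem_product, Finset.mem_range, Finset.mem_range] at hz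
    refine ⟨_, hmix' z.1 hz.1 z.2 hz.2, fun i hi j hj => hzmin (i, j) ?_⟩
    simp [hi, hj]
  obtain ⟨𝓙, hJN⟩ := h.iterate hρ N
  have hD : 0 < W + 1 := by linarith
  refine ⟨n₁, min 1 (β / (8 * (W + 1))), lt_min one_pos (by positivity), min_le_left _ _,
    fun u u' huu' hu0 hV => ?_⟩
  set s := ∫ x, |u x| ∂unitLebesgue with hs
  have hs0 : 0 ≤ s := integral_nonneg fun _ => abs_nonneg _
  rcases hs0.eq_or_lt with hs0' | hspos
  · rw [← hs0', mul_zero]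
    exact (huu'.integral_abs_le hTN).trans hs0'.ge
  obtain ⟨g, hgu, hgV⟩ := exists_ae_eq_eVariationOn_le (W := (a + 1) * s) hV (by positivity)
    (by linarith)
  have hg : Integrable g unitLebesgue := huu'.integrable_left.congr hgu.symm
  have hgs : ∫ x, |g x| ∂unitLebesgue = s :=
    integral_congr_ae (hgu.mono fun x hx => by simp only [hx])
  have hg0 : ∫ x, g x ∂unitLebesgue = 0 := (integral_congr_ae hgu).trans hu0
  obtain ⟨hp, hn⟩ := integral_max_zero_add_integral_max_neg_zero hg hg0
  rw [hgs] at hp hn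
  have hVp := (eVariationOn_max_zero_le g (Icc 0 1)).trans hgV
  have hVn := (eVariationOn_max_zero_le (fun x => -g x) (Icc 0 1)).trans
    ((eVariationOn_neg g _).le.trans hgV)
  have aux : ∀ f : ℝ → ℝ, Integrable f unitLebesgue → (∀ x, 0 ≤ f x) →
      ∫ x, f x ∂unitLebesgue = s / 2 → eVariationOn f (Icc 0 1) ≤ ENNReal.ofReal ((a + 1) * s) →
      ∃ k : ℝ → ℝ, IsRealTransfer T^[N] f k ∧ 0 ≤ᵐ[unitLebesgue] k ∧
        ∫ x, k x ∂unitLebesgue = s / 2 ∧ eVariationOn k (Icc 0 1) ≤ ENNReal.ofReal (W * s) := by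
    intro f hf hf0 hfi hfV
    have hk := hJN.isRealTransfer hTN hf
    have habs : ∫ x, |f x| ∂unitLebesgue = s / 2 := by
      rw [← hfi]; exact integral_congr_ae (Eventually.of_forall fun x => abs_of_nonneg (hf0 x))
    have h1 := hK n₁ f _ _ hk (by positivity : 0 ≤ (a + 1) * s)
      ((essVar_le (EventuallyEq.refl _ _)).trans hfV)
    rw [habs] at h1
    have h4 : (a + 1) * s / 4 ^ n₁ ≤ (a + 1) * s :=
      div_le_self (by positivity) (one_le_pow₀ (by norm_num))
    obtain ⟨k, hkk, hkV⟩ := exists_ae_eq_eVariationOn_le (W := W * s) h1 (by positivity)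
      (by rw [hW]; nlinarith [mul_nonneg hK0 hs0])
    have hk' : IsRealTransfer T^[N] f k :=
      ⟨hk.integrable_left, hk.integrable_right.congr hkk.symm, fun A hA => by
        rw [← hk.setIntegral_eq A hA]; exact integral_congr_ae (ae_restrict_of_ae hkk)⟩
    exact ⟨k, hk', hk'.nonneg hf0, hk'.integral_eq.trans hfi, hkV⟩
  obtain ⟨kp, hkp, hkp0, hkpi, hkpV⟩ := aux _ hg.pos_part (fun x => le_max_right _ _) hp hVp
  obtain ⟨kn, hkn, hkn0, hkni, hknV⟩ := aux _ hg.neg_part (fun x => le_max_right _ _) hn hVn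
  have hWs : W * s < M * (s / 2 / 2) := by nlinarith
  -- The transferred positive part is at least `s / 4` on `J l`, and the negative part before
  -- transfer is at least `s / 4` on `J j`. Mixing moves a share at least `β` of `J j` into `J l`,
  -- so the transferred negative part has mass at least `sβ/4` there.
  obtain ⟨l, hl, hlk⟩ := exists_interval_half_le hkp.integrable_right (by positivity) hkpV hkpi.ge
    hM0 hWs
  obtain ⟨j, hj, hjg⟩ := exists_interval_half_le hg.neg_part (by positivity)
    (hVn.trans (ENNReal.ofReal_le_ofReal (by rw [hW]; nlinarith [mul_nonneg hK0 hs0]))) hn.ge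
    hM0 hWs
  have hlow : s / 4 * β ≤ ∫ x in J l, kn x ∂unitLebesgue := by
    have hJm : MeasurableSet (J j ∩ T^[N] ⁻¹' J l) := measurableSet_Ioo.inter (hTN measurableSet_Ioo)
    rw [hkn.setIntegral_eq _ measurableSet_Ioo]
    calc s / 4 * β ≤ s / 4 * unitLebesgue.real (J j ∩ T^[N] ⁻¹' J l) := by
          gcongr; exact hβ j hj l hl
      _ = ∫ x in J j ∩ T^[N] ⁻¹' J l, s / 4 ∂unitLebesgue := by
          rw [setIntegral_const, smul_eq_mul, mul_comm]
      _ ≤ ∫ x in J j ∩ T^[N] ⁻¹' J l, max (-g x) 0 ∂unitLebesgue := by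
          refine setIntegral_mono_on (integrable_const _).integrableOn hg.neg_part.integrableOn hJm fun x hx => ?_
          have := hjg x hx.1
          linarith
      _ ≤ _ := setIntegral_mono_set hg.neg_part.integrableOn
          (Eventually.of_forall fun x => le_max_right _ _)
          (LE.le.eventuallyLE inter_subset_right)
  have hu' : u' =ᵐ[unitLebesgue] fun x => kp x - kn x := by
    refine huu'.unique ((hkp.sub hkn).congr_left ?_)
    filter_upwards [hgu] with x hx
    rw [max_zero_sub_max_neg_zero_eq_self, hx]
  have hint : Integrable ((J l).indicator fun x => kn x / (2 * (W + 1))) unitLebesgue :=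
    (hkn.integrable_right.div_const _).indicator measurableSet_Ioo
  -- On `J l` the difference loses twice the smaller part. Since `kn ≤ (W + 1) s` and `kp ≥ s / 4`,
  -- both parts are at least `kn / (4 (W + 1))`, and twice this is the subtracted term.
  have hpt : ∀ᵐ x ∂unitLebesgue, |u' x| ≤
      kp x + kn x - (J l).indicator (fun x => kn x / (2 * (W + 1))) x := by
    filter_upwards [hu', hkp0, hkn0, ae_restrict_mem measurableSet_Icc] with x hx hp0 hn0 hxI
    simp only [Pi.zero_apply] at hp0 hn0
    rw [hx]
    by_cases hxl : x ∈ J l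
    · rw [indicator_of_mem hxl]
      have h1 : s / 4 ≤ kp x := by have := hlk x hxl; linarith
      have h2 : kn x ≤ (W + 1) * s := by
        have h3 := norm_le_add_integral_norm (by positivity) hknV hkn.integrable_right hxI
        have h4 : ∫ y, ‖kn y‖ ∂unitLebesgue = s / 2 := by
          rw [← hkni]
          exact integral_congr_ae (hkn0.mono fun y hy => by
            exact abs_of_nonneg (a := kn y) hy)
        rw [h4] at h3
        linarith [le_abs_self (kn x), Real.norm_eq_abs (kn x)]
      have h5 : kn x / (2 * (W + 1)) = 2 * (kn x / (4 * (W + 1))) := by field_simp; ring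
      have h6 : kn x / (4 * (W + 1)) ≤ s / 4 := by
        rw [div_le_iff₀ (by positivity)]; linarith
      have h7 : kn x / (4 * (W + 1)) ≤ kn x := div_le_self hn0 (by linarith)
      rw [h5, abs_le]
      constructor <;> linarith
    · rw [indicator_of_notMem hxl, abs_le]
      constructor <;> linarith
  have hγ : min 1 (β / (8 * (W + 1))) * s ≤ s / 4 * β / (2 * (W + 1)) :=
    (mul_le_mul_of_nonneg_right (min_le_right _ _) hs0).trans (le_of_eq (by field_simp; ring))
  calc ∫ x, |u' x| ∂unitLebesgue
      ≤ ∫ x, (kp x + kn x - (J l).indicator (fun x => kn x / (2 * (W + 1))) x) ∂unitLebesgue :=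
        integral_mono_ae huu'.integrable_right.abs
          ((hkp.integrable_right.add hkn.integrable_right).sub hint) hpt
    _ = s / 2 + s / 2 - (∫ x in J l, kn x ∂unitLebesgue) / (2 * (W + 1)) := by
        have e1 : ∫ x, (kp x + kn x) ∂unitLebesgue = s / 2 + s / 2 := by
          rw [integral_add hkp.integrable_right hkn.integrable_right, hkpi, hkni]
        rw [integral_sub (f := fun x => kp x + kn x)
          (hkp.integrable_right.add hkn.integrable_right) hint, e1,
          integral_indicator measurableSet_Ioo, integral_div]
    _ ≤ s / 2 + s / 2 - s / 4 * β / (2 * (W + 1)) := by gcongr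
    _ ≤ _ := by linarith

/-- A large iterate of the transfer operator contracts the functions of mean zero for a norm
equivalent to the one of bounded variation. -/
theorem exists_contraction (h : PiecewiseExpanding T 𝓘 ρ C) (hρ : 1 < ρ) (hTm : Measurable T)
    (hmix : IsTopMixing T 𝓘) :
    ∃ n : ℕ, 0 < n ∧ ∃ B θ : ℝ, 0 < B ∧ 0 < θ ∧ θ < 1 ∧ ∀ (u u' : ℝ → ℝ) (V : ℝ),
      IsRealTransfer T^[n] u u' → ∫ x, u x ∂unitLebesgue = 0 → 0 ≤ V →
      essVar unitLebesgue u (Icc 0 1) ≤ ENNReal.ofReal V →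
      ∃ V' : ℝ, 0 ≤ V' ∧ essVar unitLebesgue u' (Icc 0 1) ≤ ENNReal.ofReal V' ∧
        V' + B * ∫ x, |u' x| ∂unitLebesgue ≤ θ * (V + B * ∫ x, |u x| ∂unitLebesgue) := by
  obtain ⟨n₀, hn₀, K', hK'0, hK'⟩ := h.exists_iterate_essVar_le hρ hTm
  set K := K' + 1 with hKdef
  have hK0 : 0 < K := by linarith
  have hK : ∀ (m : ℕ) (f k : ℝ → ℝ) (V : ℝ), IsRealTransfer T^[n₀ * m] f k → 0 ≤ V →
      essVar unitLebesgue f (Icc 0 1) ≤ ENNReal.ofReal V →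
      essVar unitLebesgue k (Icc 0 1) ≤
        ENNReal.ofReal (V / 4 ^ m + K * ∫ x, |f x| ∂unitLebesgue) :=
    fun m f k V h1 h2 h3 => (hK' m f k V h1 h2 h3).trans (ENNReal.ofReal_le_ofReal (by
      have : 0 ≤ ∫ x, |f x| ∂unitLebesgue := integral_nonneg fun _ => abs_nonneg _
      gcongr; linarith))
  obtain ⟨m₁, γ', hγ'0, hγ'1, hγ'⟩ := h.exists_integral_abs_le hρ hTm hmix hn₀ hK0.le hK
    (a := 4 * K) (by positivity)
  set γ := min γ' (1 / 2) with hγdef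
  have hγ0 : 0 < γ := lt_min hγ'0 (by norm_num)
  have hγ2 : γ ≤ 1 / 2 := min_le_right _ _
  -- With this `B` an L¹-gain of `γ s` is worth `B γ s = 2 K s` in the combined norm, twice the term
  -- `K s` that Lasota–Yorke adds to the variation.
  set B := 2 * K / γ with hB
  have hB0 : 0 < B := by positivity
  have hBγ : K = B * γ / 2 := by rw [hB]; field_simp
  have hBK : K ≤ B := by nlinarith
  obtain ⟨m₂, hm₂⟩ := ((tendsto_pow_atTop_atTop_of_one_lt (by norm_num : (1 : ℝ) < 4)).eventually
    (eventually_ge_atTop (4 * B / K))).and (eventually_ge_atTop 1) |>.exists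
  have hm₂' : 4 * B / 4 ^ m₂ ≤ K := by
    have := hm₂.1
    rw [div_le_iff₀ hK0] at this
    rw [div_le_iff₀ (by positivity)]; linarith
  obtain ⟨𝓙, hJ⟩ := h.iterate hρ (n₀ * m₂)
  obtain ⟨𝓙', hJ'⟩ := h.iterate hρ (n₀ * m₁)
  have hcast : n₀ * m₁ + n₀ * m₂ = n₀ * (m₁ + m₂) := by ring
  refine ⟨n₀ * (m₁ + m₂), Nat.mul_pos hn₀ (by omega), B, 1 - γ / 2, hB0, by linarith, by linarith,
    fun u u' V huu' hu0 hV0 hV => ?_⟩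
  have hu₁ := hJ.isRealTransfer (hTm.iterate _) huu'.integrable_left
  set u₁ := transfer T^[n₀ * m₂] 𝓙 u
  have hu₂ := hJ'.isRealTransfer (hTm.iterate _) hu₁.integrable_right
  set u₂ := transfer T^[n₀ * m₁] 𝓙' u₁
  have hcomp := hu₁.comp (hTm.iterate _) hu₂
  rw [← Function.iterate_add, hcast] at hcomp
  have hae := huu'.unique hcomp
  have hs' : ∫ x, |u' x| ∂unitLebesgue = ∫ x, |u₂ x| ∂unitLebesgue :=
    integral_congr_ae (hae.mono fun x hx => by simp only [hx])
  set s := ∫ x, |u x| ∂unitLebesgue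
  have hs0 : 0 ≤ s := integral_nonneg fun _ => abs_nonneg _
  have hs₁ : ∫ x, |u₁ x| ∂unitLebesgue ≤ s := hu₁.integral_abs_le (hTm.iterate _)
  have hs₂ : ∫ x, |u₂ x| ∂unitLebesgue ≤ ∫ x, |u₁ x| ∂unitLebesgue :=
    hu₂.integral_abs_le (hTm.iterate _)
  have hVu' := hK _ u u' V huu' hV0 hV
  have h4 : V / 4 ^ (m₁ + m₂) ≤ V / 4 := by
    gcongr
    calc (4 : ℝ) = 4 ^ 1 := by norm_num
      _ ≤ 4 ^ (m₁ + m₂) := pow_le_pow_right₀ (by norm_num) (by omega)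
  refine ⟨V / 4 ^ (m₁ + m₂) + K * s, by positivity, hVu', ?_⟩
  rw [hs']
  -- If `V > 4 B s`, the variation dominates the norm and its division by 4 suffices. Otherwise `n₀
  -- * m₂` steps bring the variation down to `2 K s`. Then either the L¹-norm has already halved, or
  -- the variation is at most `4 K` times the new L¹-norm and mixing contracts the latter.
  rcases le_or_gt V (4 * B * s) with hle | hgt
  · have hL1 : ∫ x, |u₂ x| ∂unitLebesgue ≤ (1 - γ) * s := by
      rcases le_or_gt (∫ x, |u₁ x| ∂unitLebesgue) (s / 2) with hle' | hgt'
      · nlinarith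
      · have hV₁ := hK m₂ u u₁ V hu₁ hV0 hV
        have h5 : V / 4 ^ m₂ ≤ K * s := by
          calc V / 4 ^ m₂ ≤ 4 * B * s / 4 ^ m₂ := by gcongr
            _ = 4 * B / 4 ^ m₂ * s := by ring
            _ ≤ K * s := by gcongr
        have h6 := hγ' u₁ u₂ hu₂ (hu₁.integral_eq.trans hu0)
          (hV₁.trans (ENNReal.ofReal_le_ofReal (by nlinarith)))
        have h7 : γ ≤ γ' := min_le_left _ _
        calc _ ≤ _ := h6
          _ ≤ (1 - γ') * s := mul_le_mul_of_nonneg_left hs₁ (by linarith)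
          _ ≤ _ := by nlinarith
    calc V / 4 ^ (m₁ + m₂) + K * s + B * ∫ x, |u₂ x| ∂unitLebesgue
        ≤ V / 4 + K * s + B * ((1 - γ) * s) := by gcongr
      _ ≤ _ := by rw [hBγ]; nlinarith [mul_nonneg hB0.le hs0]
  · have h8 : ∫ x, |u₂ x| ∂unitLebesgue ≤ s := hs₂.trans hs₁
    have h9 : K * s ≤ B * s := by gcongr
    have h10 : B * s < V / 4 := by linarith
    calc V / 4 ^ (m₁ + m₂) + K * s + B * ∫ x, |u₂ x| ∂unitLebesgue
        ≤ V / 4 + K * s + B * s := by gcongr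
      _ ≤ _ := by nlinarith [mul_nonneg hB0.le hs0]

theorem exists_iterate_contraction (h : PiecewiseExpanding T 𝓘 ρ C) (hρ : 1 < ρ)
    (hTm : Measurable T) (hmix : IsTopMixing T 𝓘) :
    ∃ n : ℕ, 0 < n ∧ ∃ B θ : ℝ, 0 < B ∧ 0 < θ ∧ θ < 1 ∧ ∀ (j : ℕ) (u u' : ℝ → ℝ) (V : ℝ),
      IsRealTransfer T^[n * j] u u' → ∫ x, u x ∂unitLebesgue = 0 → 0 ≤ V →
      essVar unitLebesgue u (Icc 0 1) ≤ ENNReal.ofReal V →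
      ∃ V' : ℝ, 0 ≤ V' ∧ essVar unitLebesgue u' (Icc 0 1) ≤ ENNReal.ofReal V' ∧
        V' + B * ∫ x, |u' x| ∂unitLebesgue ≤ θ ^ j * (V + B * ∫ x, |u x| ∂unitLebesgue) := by
  obtain ⟨n, hn, B, θ, hB, hθ0, hθ1, hc⟩ := h.exists_contraction hρ hTm hmix
  refine ⟨n, hn, B, θ, hB, hθ0, hθ1, fun j => ?_⟩
  induction j with
  | zero =>
    intro u u' V huu' hu0 hV0 hV
    have hid : IsRealTransfer T^[n * 0] u u := ⟨huu'.integrable_left, huu'.integrable_left, by simp⟩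
    have hae := huu'.unique hid
    refine ⟨V, hV0, (essVar_congr hae).trans_le hV, ?_⟩
    rw [integral_congr_ae (hae.mono fun x hx => congrArg abs hx), pow_zero, one_mul]
  | succ j ih =>
    intro u u' V huu' hu0 hV0 hV
    obtain ⟨𝓙, hJ⟩ := h.iterate hρ (n * j)
    obtain ⟨𝓙', hJ'⟩ := h.iterate hρ n
    have hu₁ := hJ.isRealTransfer (hTm.iterate _) huu'.integrable_left
    set u₁ := transfer T^[n * j] 𝓙 u
    have hu₂ := hJ'.isRealTransfer (hTm.iterate _) hu₁.integrable_right
    set u₂ := transfer T^[n] 𝓙' u₁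
    have hcomp := hu₁.comp (hTm.iterate _) hu₂
    rw [← Function.iterate_add, show n + n * j = n * (j + 1) by ring] at hcomp
    have hae := huu'.unique hcomp
    obtain ⟨V₁, hV₁0, hV₁, hle₁⟩ := ih u u₁ V hu₁ hu0 hV0 hV
    obtain ⟨V₂, hV₂0, hV₂, hle₂⟩ := hc u₁ u₂ V₁ hu₂ (hu₁.integral_eq.trans hu0) hV₁0 hV₁
    refine ⟨V₂, hV₂0, (essVar_congr hae).trans_le hV₂, ?_⟩
    rw [integral_congr_ae (hae.mono fun x hx => congrArg abs hx)]
    calc _ ≤ _ := hle₂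
      _ ≤ θ * (θ ^ j * (V + B * ∫ x, |u x| ∂unitLebesgue)) := by gcongr
      _ = _ := by ring

end PiecewiseExpanding
end

noncomputable section

/-! ### The Banach space `BV` -/

namespace BV

variable {μ : Measure ℝ}

theorem essVar_eq (φ : BV μ) : essVar μ (incl μ φ : ℝ → ℂ) (Icc 0 1) = ENNReal.ofReal (var φ) :=
  (ENNReal.ofReal_toReal (essVar_ne_top φ)).symm

theorem norm_incl_le (φ : BV μ) : ‖incl μ φ‖ ≤ ‖φ‖ := by
  rw [norm_def]; linarith [var_nonneg φ]

theorem var_le (φ : BV μ) : var φ ≤ ‖φ‖ := by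
  rw [norm_def]; linarith [norm_nonneg (incl μ φ)]

theorem var_le_of_essVar_le {φ : BV μ} {V : ℝ} (hV0 : 0 ≤ V)
    (hV : essVar μ (incl μ φ : ℝ → ℂ) (Icc 0 1) ≤ ENNReal.ofReal V) : var φ ≤ V :=
  ENNReal.toReal_le_of_le_ofReal hV0 hV

theorem ae_norm_le (φ : BV μ) : ∀ᵐ x ∂μ, ‖(incl μ φ : ℝ → ℂ) x‖ ≤ ‖incl μ φ‖ := by
  have h := ae_le_eLpNormEssSup (μ := μ) (f := (incl μ φ : ℝ → ℂ))
  filter_upwards [h] with x hx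
  have hfin : eLpNorm (incl μ φ : ℝ → ℂ) ∞ μ ≠ ∞ := Lp.eLpNorm_ne_top _
  rw [← eLpNorm_exponent_top] at hx
  have := ENNReal.toReal_mono hfin hx
  rwa [toReal_enorm] at this

theorem aestronglyMeasurable (φ : BV μ) : AEStronglyMeasurable (incl μ φ : ℝ → ℂ) μ :=
  Lp.aestronglyMeasurable _

theorem ext_ae {φ ψ : BV μ} (h : (incl μ φ : ℝ → ℂ) =ᵐ[μ] incl μ ψ) : φ = ψ :=
  incl_injective (Lp.ext h)

/-- Bounded functions of bounded variation define elements of `BV`. -/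
theorem exists_of_essVar_le {f : ℝ → ℂ} (hf : AEStronglyMeasurable f μ) {A V : ℝ} (hA0 : 0 ≤ A)
    (hA : ∀ᵐ x ∂μ, ‖f x‖ ≤ A) (hV0 : 0 ≤ V)
    (hV : essVar μ f (Icc 0 1) ≤ ENNReal.ofReal V) :
    ∃ φ : BV μ, (incl μ φ : ℝ → ℂ) =ᵐ[μ] f ∧ ‖φ‖ ≤ A + V := by
  have hmem : MemLp f ∞ μ := memLp_top_of_bound hf A hA
  have hco := hmem.coeFn_toLp
  have hV' : essVar μ (hmem.toLp f : ℝ → ℂ) (Icc 0 1) ≤ ENNReal.ofReal V := by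
    rwa [essVar_congr hco]
  let φ : BV μ := (⟨hmem.toLp f, ne_top_of_le_ne_top ENNReal.ofReal_ne_top hV'⟩ : bvSubmodule μ)
  refine ⟨φ, hco, ?_⟩
  rw [norm_def]
  refine add_le_add ?_ (var_le_of_essVar_le hV0 hV')
  change ‖hmem.toLp f‖ ≤ A
  rw [Lp.norm_toLp]
  refine ENNReal.toReal_le_of_le_ofReal hA0 ?_
  rw [eLpNorm_exponent_top]
  refine eLpNormEssSup_le_of_ae_enorm_bound (hA.mono fun x hx => ?_)
  rw [← ofReal_norm]
  exact ENNReal.ofReal_le_ofReal hx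

theorem norm_le_of_ae_eq {φ : BV μ} {f : ℝ → ℂ} (hφ : (incl μ φ : ℝ → ℂ) =ᵐ[μ] f) {A V : ℝ}
    (hA0 : 0 ≤ A) (hA : ∀ᵐ x ∂μ, ‖f x‖ ≤ A) (hV0 : 0 ≤ V)
    (hV : essVar μ f (Icc 0 1) ≤ ENNReal.ofReal V) : ‖φ‖ ≤ A + V := by
  obtain ⟨ψ, hψ, hle⟩ := exists_of_essVar_le ((aestronglyMeasurable φ).congr hφ) hA0 hA hV0 hV
  rwa [ext_ae (hφ.trans hψ.symm)]

/-- Every `φ ∈ BV` has a version whose variation and supremum are controlled by `‖φ‖`. -/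
theorem exists_version [IsProbabilityMeasure μ] (hμ : μ ≪ unitLebesgue) (φ : BV μ) :
    ∃ f : ℝ → ℂ, f =ᵐ[μ] incl μ φ ∧ eVariationOn f (Icc 0 1) ≤ ENNReal.ofReal (2 * ‖φ‖) ∧
      ∀ x ∈ Icc (0 : ℝ) 1, ‖f x‖ ≤ 3 * ‖φ‖ := by
  rcases (norm_nonneg φ).eq_or_lt with h0 | hpos
  · have hφ : φ = 0 := norm_eq_zero.1 h0.symm
    refine ⟨fun _ => 0, ?_, ?_, ?_⟩
    · rw [hφ, map_zero]; exact (Lp.coeFn_zero ℂ ∞ μ).symm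
    · rw [eVariationOn.constant_on (by rintro _ ⟨_, _, rfl⟩ _ ⟨_, _, rfl⟩; rfl)]; exact zero_le
    · intro x _; simp
  have hI : ∀ᵐ x ∂μ, x ∈ Icc (0 : ℝ) 1 := hμ.ae_le (ae_restrict_mem measurableSet_Icc)
  have hμI : μ.restrict (Icc 0 1) = μ := Measure.restrict_eq_self_of_ae_mem hI
  -- For `φ ≠ 0` the bound `2 ‖φ‖` strictly exceeds the variation, so some version satisfies it.
  obtain ⟨f, hf, hfV⟩ := exists_ae_eq_eVariationOn_lt ((essVar_eq φ).trans_lt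
    ((ENNReal.ofReal_lt_ofReal_iff (by linarith : 0 < 2 * ‖φ‖)).2 (by linarith [var_le φ])))
  rw [hμI] at hf
  obtain ⟨y, hyI, hy, hyn⟩ := (hI.and (hf.and (ae_norm_le φ))).exists
  refine ⟨f, hf, hfV.le, fun x hx => ?_⟩
  have h1 := norm_le_add_of_eVariationOn_le (by positivity) hfV.le hx hyI
  rw [hy] at h1
  linarith [norm_incl_le φ]

/-- Limits exist in `L^∞`. Along a subsequence converging almost everywhere the essential variation
is lower semicontinuous; applied to the differences `φ n - φ m`, this shows at once that the limit
lies in `BV` and that the convergence holds there. -/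
theorem completeSpace : CompleteSpace (BV μ) := by
  refine Metric.complete_of_cauchySeq_tendsto fun φ hφ => ?_
  have hLip : LipschitzWith 1 (incl μ) := by
    refine LipschitzWith.of_dist_le_mul fun x y => ?_
    rw [dist_eq_norm, dist_eq_norm, ← map_sub, NNReal.coe_one, one_mul]
    exact norm_incl_le _
  have hc : CauchySeq fun n => incl μ (φ n) := hLip.uniformContinuous.comp_cauchySeq hφ
  obtain ⟨F, hF⟩ := cauchySeq_tendsto_of_complete hc
  have hmeas : TendstoInMeasure μ (fun n => (incl μ (φ n) : ℝ → ℂ)) atTop F :=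
    tendstoInMeasure_of_tendsto_eLpNorm (p := ∞) (by simp) (fun n => aestronglyMeasurable _)
      (Lp.aestronglyMeasurable F) ((Lp.tendsto_Lp_iff_tendsto_eLpNorm' _ F).1 hF)
  obtain ⟨ns, hns, hlim⟩ := hmeas.exists_seq_tendsto_ae
  have key : ∀ ε : ℝ, ∀ n : ℕ, (∀ m ≥ n, ‖φ n - φ m‖ ≤ ε) →
      essVar μ ((incl μ (φ n) - F : Lp ℂ ∞ μ) : ℝ → ℂ) (Icc 0 1) ≤ ENNReal.ofReal ε := by
    intro ε n hn
    have hlim' : ∀ᵐ x ∂μ, Tendsto (fun j => (incl μ (φ n - φ (ns (j + n))) : ℝ → ℂ) x) atTop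
        (𝓝 (((incl μ (φ n) - F : Lp ℂ ∞ μ) : ℝ → ℂ) x)) := by
      have h1 : ∀ᵐ x ∂μ, ∀ j, (incl μ (φ n - φ (ns (j + n))) : ℝ → ℂ) x =
          (incl μ (φ n) : ℝ → ℂ) x - (incl μ (φ (ns (j + n))) : ℝ → ℂ) x := by
        rw [ae_all_iff]
        intro j
        rw [map_sub]
        exact Lp.coeFn_sub _ _
      filter_upwards [hlim, h1, Lp.coeFn_sub (incl μ (φ n)) F] with x hx hx1 hx2
      simp only [hx1, hx2, Pi.sub_apply]
      exact tendsto_const_nhds.sub (hx.comp (tendsto_add_atTop_nat n))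
    refine essVar_le_of_tendsto_ae (ae_restrict_of_ae hlim') measurableSet_Icc fun j => ?_
    rw [essVar_eq]
    refine ENNReal.ofReal_le_ofReal ((var_le _).trans (hn _ ?_))
    exact (Nat.le_add_left n j).trans (hns.id_le _)
  rw [Metric.cauchySeq_iff'] at hφ
  have hcau : ∀ ε > 0, ∃ N, ∀ n ≥ N, ∀ m ≥ n, ‖φ n - φ m‖ ≤ ε := by
    intro ε hε
    obtain ⟨N, hN⟩ := hφ (ε / 2) (half_pos hε)
    refine ⟨N, fun n hn m hm => ?_⟩
    rw [← dist_eq_norm]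
    linarith [dist_triangle_right (φ n) (φ m) (φ N), hN n hn, hN m (hn.trans hm)]
  obtain ⟨N₀, hN₀⟩ := hcau 1 one_pos
  have hsub : incl μ (φ N₀) - F ∈ bvSubmodule μ :=
    ne_top_of_le_ne_top ENNReal.ofReal_ne_top (key 1 N₀ (hN₀ N₀ le_rfl))
  have hFmem : F ∈ bvSubmodule μ := by
    have := (bvSubmodule μ).sub_mem (show incl μ (φ N₀) ∈ bvSubmodule μ from (φ N₀).2) hsub
    rwa [sub_sub_cancel] at this
  let ψ : BV μ := (⟨F, hFmem⟩ : bvSubmodule μ)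
  have hψ : incl μ ψ = F := rfl
  refine ⟨ψ, ?_⟩
  rw [Metric.tendsto_atTop]
  intro ε hε
  obtain ⟨N, hN⟩ := hcau (ε / 4) (by linarith)
  obtain ⟨N', hN'⟩ := Metric.tendsto_atTop.1 hF (ε / 4) (by linarith)
  refine ⟨max N N', fun n hn => ?_⟩
  rw [dist_eq_norm, norm_def, map_sub, hψ, ← dist_eq_norm]
  have h1 := hN' n ((le_max_right _ _).trans hn)
  have h2 : var (φ n - ψ) ≤ ε / 4 := by
    refine var_le_of_essVar_le (by linarith) ?_
    rw [map_sub, hψ]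
    exact key _ n (hN n ((le_max_left _ _).trans hn))
  linarith

theorem isBanachInLinfty : IsBanachInLinfty μ (incl μ) := by
  refine ⟨completeSpace, incl_injective, fun c => ?_, norm_incl_le⟩
  obtain ⟨φ, hφ, -⟩ := exists_of_essVar_le (μ := μ) (f := fun _ => c) aestronglyMeasurable_const
    (norm_nonneg c) (Eventually.of_forall fun _ => le_rfl) le_rfl
    ((essVar_le (EventuallyEq.refl _ _)).trans (eVariationOn.constant_on (by
      rintro _ ⟨_, _, rfl⟩ _ ⟨_, _, rfl⟩; rfl)).le |>.trans zero_le)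
  exact ⟨φ, hφ⟩

end BV

/-! ### Transfer operators on `BV` -/

namespace IsTransferOf

variable {Ω : Type*} [MeasurableSpace Ω] {μ : Measure Ω} {T S : Ω → Ω} {f f' k k' l : Ω → ℂ}

theorem integrable_mul_comp (hT : Measurable T) (hf : Integrable f μ) {g : Ω → ℂ}
    (hg : Measurable g) {C : ℝ} (hC : ∀ x, ‖g x‖ ≤ C) : Integrable (fun x => f x * g (T x)) μ :=
  hf.mul_bdd (c := C) (hg.comp hT).aestronglyMeasurable (Eventually.of_forall fun _ => hC _)

theorem congr (h : IsTransferOf μ T f k) (hf : f =ᵐ[μ] f') (hk : k =ᵐ[μ] k') :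
    IsTransferOf μ T f' k' := by
  refine ⟨h.1.congr hk, fun g hg hb => ?_⟩
  rw [← integral_congr_ae (hk.mono fun x hx => congrArg (· * g x) hx), h.2 g hg hb]
  exact integral_congr_ae (hf.mono fun x hx => congrArg (· * g (T x)) hx)

theorem add (hT : Measurable T) (hf : Integrable f μ) (hf' : Integrable f' μ)
    (h : IsTransferOf μ T f k) (h' : IsTransferOf μ T f' k') :
    IsTransferOf μ T (fun x => f x + f' x) (fun x => k x + k' x) := by
  refine ⟨h.1.add h'.1, fun g hg ⟨C, hC⟩ => ?_⟩
  simp only [add_mul]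
  rw [integral_add (h.1.mul_bdd hg.aestronglyMeasurable (Eventually.of_forall hC))
    (h'.1.mul_bdd hg.aestronglyMeasurable (Eventually.of_forall hC)),
    integral_add (integrable_mul_comp hT hf hg hC) (integrable_mul_comp hT hf' hg hC),
    h.2 g hg ⟨C, hC⟩, h'.2 g hg ⟨C, hC⟩]

theorem const_mul (c : ℂ) (h : IsTransferOf μ T f k) :
    IsTransferOf μ T (fun x => c * f x) (fun x => c * k x) := by
  refine ⟨h.1.const_mul c, fun g hg hb => ?_⟩
  simp only [mul_assoc]
  rw [integral_const_mul, integral_const_mul, h.2 g hg hb]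

theorem comp (hS : Measurable S) (h : IsTransferOf μ T f k) (h' : IsTransferOf μ S k l) :
    IsTransferOf μ (S ∘ T) f l :=
  ⟨h'.1, fun g hg ⟨C, hC⟩ => by
    rw [h'.2 g hg ⟨C, hC⟩, h.2 (fun x => g (S x)) (hg.comp hS) ⟨C, fun x => hC _⟩]; rfl⟩

theorem integral_eq (h : IsTransferOf μ T f k) : ∫ x, k x ∂μ = ∫ x, f x ∂μ := by
  simpa using h.2 (fun _ => 1) measurable_const ⟨1, by simp⟩

end IsTransferOf

namespace BV

variable {μ : Measure ℝ} {T : ℝ → ℝ}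

theorem integrable_mul {ψ : ℝ → ℂ} (hψ : Integrable ψ μ) (φ : BV μ) :
    Integrable (fun x => ψ x * (incl μ φ : ℝ → ℂ) x) μ :=
  hψ.mul_bdd (c := ‖incl μ φ‖) (aestronglyMeasurable φ) (ae_norm_le φ)

/-- The transfer relation determines its second member almost everywhere, so images chosen
separately for each `φ` depend linearly on it. -/
theorem exists_continuousLinearMap (hT : Measurable T) {ψ : ℝ → ℂ} (hψ : Integrable ψ μ) {C : ℝ}
    (hC : 0 ≤ C) (h : ∀ φ : BV μ, ∃ k : BV μ,
      IsTransferOf μ T (fun x => ψ x * (incl μ φ : ℝ → ℂ) x) (incl μ k) ∧ ‖k‖ ≤ C * ‖φ‖) :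
    ∃ A : BV μ →L[ℂ] BV μ, (∀ φ, IsTransferOf μ T (fun x => ψ x * (incl μ φ : ℝ → ℂ) x)
      (incl μ (A φ))) ∧ ‖A‖ ≤ C := by
  choose k hk hkC using h
  let A : BV μ →ₗ[ℂ] BV μ :=
    { toFun := k
      map_add' := fun φ φ' => by
        refine ext_ae (((hk (φ + φ')).unique ?_).trans (EventuallyEq.refl _ _))
        refine ((hk φ).add hT (integrable_mul hψ φ) (integrable_mul hψ φ') (hk φ')).congr ?_ ?_
        · rw [map_add]
          filter_upwards [Lp.coeFn_add (incl μ φ) (incl μ φ')] with x hx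
          rw [hx, Pi.add_apply, mul_add]
        · rw [map_add]
          exact (Lp.coeFn_add _ _).symm
      map_smul' := fun c φ => by
        refine ext_ae (((hk (c • φ)).unique ?_).trans (EventuallyEq.refl _ _))
        refine ((hk φ).const_mul c).congr ?_ ?_
        · rw [map_smul]
          filter_upwards [Lp.coeFn_smul c (incl μ φ)] with x hx
          rw [hx, Pi.smul_apply, smul_eq_mul]; ring
        · rw [RingHom.id_apply, map_smul]
          exact (Lp.coeFn_smul c (incl μ (k φ))).symm }
  exact ⟨A.mkContinuous C hkC, hk, A.mkContinuous_norm_le hC hkC⟩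

end BV
end

noncomputable section

/-! ### Multipliers composed with the transfer operator -/

/-- `μ` has the density `g` with respect to Lebesgue measure on `[0,1]`, where `c ≤ g ≤ M` and the
variation of `g` is at most `V`. -/
structure HasBVDensity (μ : Measure ℝ) (g : ℝ → ℝ) (c M V : ℝ) : Prop where
  pos : 0 < c
  nonneg : 0 ≤ V
  aemeasurable : AEMeasurable g unitLebesgue
  le : ∀ x, c ≤ g x
  ge : ∀ x, g x ≤ M
  eVariationOn_le : eVariationOn g (Icc 0 1) ≤ ENNReal.ofReal V
  eq_withDensity : μ = unitLebesgue.withDensity fun x => ENNReal.ofReal (g x)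

namespace HasBVDensity

variable {μ : Measure ℝ} {g : ℝ → ℝ} {c M V : ℝ}

theorem absolutelyContinuous (hd : HasBVDensity μ g c M V) : μ ≪ unitLebesgue := by
  rw [hd.eq_withDensity]; exact withDensity_absolutelyContinuous _ _

theorem absolutelyContinuous' (hd : HasBVDensity μ g c M V) : unitLebesgue ≪ μ := by
  rw [hd.eq_withDensity]
  exact withDensity_absolutelyContinuous' hd.aemeasurable.ennreal_ofReal
    (Eventually.of_forall fun x => by simpa using hd.pos.trans_le (hd.le x))

variable {E : Type*} [NormedAddCommGroup E] [NormedSpace ℝ E] {f : ℝ → E}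

theorem integral_eq (hd : HasBVDensity μ g c M V) (f : ℝ → E) :
    ∫ x, f x ∂μ = ∫ x, g x • f x ∂unitLebesgue := by
  rw [hd.eq_withDensity, integral_withDensity_eq_integral_toReal_smul₀
    hd.aemeasurable.ennreal_ofReal (Eventually.of_forall fun _ => ENNReal.ofReal_lt_top)]
  simp only [ENNReal.toReal_ofReal (hd.pos.le.trans (hd.le _))]

theorem integrable_iff_smul (hd : HasBVDensity μ g c M V) :
    Integrable f μ ↔ Integrable (fun x => g x • f x) unitLebesgue := by
  rw [hd.eq_withDensity, integrable_withDensity_iff_integrable_smul₀'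
    hd.aemeasurable.ennreal_ofReal (Eventually.of_forall fun _ => ENNReal.ofReal_lt_top)]
  simp only [ENNReal.toReal_ofReal (hd.pos.le.trans (hd.le _))]

theorem abs_le (hd : HasBVDensity μ g c M V) (x : ℝ) : |g x| ≤ M :=
  (abs_of_nonneg (hd.pos.le.trans (hd.le x))).trans_le (hd.ge x)

theorem abs_inv_le (hd : HasBVDensity μ g c M V) (x : ℝ) : |(g x)⁻¹| ≤ c⁻¹ := by
  rw [abs_inv, abs_of_nonneg (hd.pos.le.trans (hd.le x))]
  exact inv_anti₀ hd.pos (hd.le x)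

theorem bound_nonneg (hd : HasBVDensity μ g c M V) : 0 ≤ M :=
  hd.pos.le.trans ((hd.le 0).trans (hd.ge 0))

theorem inv_smul_smul (hd : HasBVDensity μ g c M V) (x : ℝ) (e : E) : (g x)⁻¹ • g x • e = e :=
  inv_smul_smul₀ (hd.pos.trans_le (hd.le x)).ne' e

theorem smul_inv_smul (hd : HasBVDensity μ g c M V) (x : ℝ) (e : E) : g x • (g x)⁻¹ • e = e :=
  smul_inv_smul₀ (hd.pos.trans_le (hd.le x)).ne' e

theorem integrable_iff (hd : HasBVDensity μ g c M V) :
    Integrable f μ ↔ Integrable f unitLebesgue := by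
  rw [hd.integrable_iff_smul]
  constructor <;> intro h
  · have := h.bdd_smul (𝕜 := ℝ) (C := c⁻¹) hd.aemeasurable.inv.aestronglyMeasurable
      (Eventually.of_forall fun x => hd.abs_inv_le x)
    refine this.congr (Eventually.of_forall fun x => ?_)
    exact hd.inv_smul_smul x _
  · exact h.bdd_smul (𝕜 := ℝ) (C := M) hd.aemeasurable.aestronglyMeasurable
      (Eventually.of_forall fun x => hd.abs_le x)

theorem integral_le (hd : HasBVDensity μ g c M V) {b : ℝ → ℝ} (hb : Integrable b μ)
    (hb0 : ∀ x, 0 ≤ b x) : ∫ x, b x ∂unitLebesgue ≤ c⁻¹ * ∫ x, b x ∂μ := by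
  rw [hd.integral_eq, ← integral_const_mul]
  refine integral_mono (hd.integrable_iff.1 hb) ((hd.integrable_iff_smul.1 hb).const_mul _)
    fun x => ?_
  have h1 : 1 ≤ c⁻¹ * g x := by
    rw [inv_mul_eq_div, one_le_div hd.pos]; exact hd.le x
  calc b x ≤ (c⁻¹ * g x) * b x := le_mul_of_one_le_left (hb0 x) h1
    _ = _ := by rw [smul_eq_mul, mul_assoc]

theorem eVariationOn_inv_le (hd : HasBVDensity μ g c M V) :
    eVariationOn (fun x => (g x)⁻¹) (Icc 0 1) ≤ ENNReal.ofReal (V / c ^ 2) := by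
  have hc := hd.pos
  have hL : LipschitzOnWith (Real.toNNReal (1 / c ^ 2)) (fun y : ℝ => y⁻¹) (Ici c) := by
    refine LipschitzOnWith.of_dist_le_mul fun x hx y hy => ?_
    have hx' : 0 < x := hc.trans_le hx
    have hy' : 0 < y := hc.trans_le hy
    rw [Real.dist_eq, Real.dist_eq, Real.coe_toNNReal _ (by positivity),
      inv_sub_inv hx'.ne' hy'.ne', abs_div, abs_of_pos (mul_pos hx' hy'), abs_sub_comm y x,
      div_le_iff₀ (mul_pos hx' hy'), one_div]
    have h1 : c ^ 2 ≤ x * y := by rw [sq]; exact mul_le_mul hx hy hc.le hx'.le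
    calc |x - y| = (c ^ 2)⁻¹ * |x - y| * c ^ 2 := by field_simp
      _ ≤ _ := by gcongr
  refine (hL.comp_eVariationOn_le (g := g) (s := Icc 0 1) fun x _ => hd.le x).trans ?_
  refine (mul_le_mul_right hd.eVariationOn_le _).trans ?_
  change ENNReal.ofReal _ * _ ≤ _
  rw [← ENNReal.ofReal_mul (by positivity)]
  exact ENNReal.ofReal_le_ofReal (le_of_eq (by ring))

variable {T : ℝ → ℝ} {𝓘 : Set (Set ℝ)} {ρ C : ℝ}

theorem isTransferOf (hd : HasBVDensity μ g c M V) (h : PiecewiseExpanding T 𝓘 ρ C)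
    (hTm : Measurable T) {F : ℝ → ℂ} (hF : Integrable F μ) :
    IsTransferOf μ T F fun x => (g x)⁻¹ • transfer T 𝓘 (fun y => g y • F y) x := by
  have h1 := h.isTransferOf_transfer hTm (hd.integrable_iff_smul.1 hF)
  refine ⟨?_, fun w hw hb => ?_⟩
  · rw [hd.integrable_iff_smul]
    simpa only [hd.smul_inv_smul] using h1.1
  · rw [hd.integral_eq, hd.integral_eq]
    simp only [← smul_mul_assoc, hd.smul_inv_smul]
    exact h1.2 w hw hb

end HasBVDensity

namespace PiecewiseExpanding

variable {T : ℝ → ℝ} {𝓘 : Set (Set ℝ)} {ρ C : ℝ} {μ : Measure ℝ}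

/-- The supremum bounds the variation of a separate version on each interval. The intervals are
disjoint and countably many, so these versions glue to a single function equal to `v` almost
everywhere. -/
theorem exists_ae_eq_eVariationOn_le (h : PiecewiseExpanding T 𝓘 ρ C) (hμ : μ ≪ unitLebesgue)
    {v : ℝ → ℝ} (hvar : (⨆ I ∈ 𝓘, essVar μ v I) < ∞) :
    ∃ v₀ : ℝ → ℝ, ∃ V : ℝ, 0 ≤ V ∧ v₀ =ᵐ[μ] v ∧
      ∀ I ∈ 𝓘, eVariationOn v₀ I ≤ ENNReal.ofReal V := by
  obtain ⟨V, hV⟩ := ENNReal.lt_iff_exists_coe.1 hvar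
  have key : ∀ I : 𝓘, ∃ w : ℝ → ℝ, w =ᵐ[μ.restrict I] v ∧
      eVariationOn w I < ENNReal.ofReal (V + 1) := by
    intro I
    refine exists_ae_eq_eVariationOn_lt ?_
    refine (le_iSup₂ (f := fun I (_ : I ∈ 𝓘) => essVar μ v I) I.1 I.2).trans_lt ?_
    rw [hV.1]
    refine (ENNReal.coe_lt_coe.2 (lt_add_one V)).trans_le (le_of_eq ?_)
    exact (ENNReal.ofReal_coe_nnreal (p := V + 1)).symm
  choose w hw hwV using key
  classical
  set v₀ : ℝ → ℝ := fun x => if hx : ∃ I : 𝓘, x ∈ (I : Set ℝ) then w hx.choose x else 0 with hv₀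
  have heq : ∀ (I : 𝓘) (x : ℝ), x ∈ (I : Set ℝ) → v₀ x = w I x := by
    intro I x hx
    have hex : ∃ I : 𝓘, x ∈ (I : Set ℝ) := ⟨I, hx⟩
    simp only [hv₀, dif_pos hex]
    congr 1
    refine Subtype.ext (h.pairwiseDisjoint.elim hex.choose.2 I.2 ?_)
    exact Set.not_disjoint_iff.2 ⟨x, hex.choose_spec, hx⟩
  refine ⟨v₀, V + 1, by positivity, ?_, fun I hI => ?_⟩
  · have := h.countable.to_subtype
    have h1 : ∀ᵐ x ∂μ, ∀ I : 𝓘, x ∈ (I : Set ℝ) → w I x = v x :=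
      ae_all_iff.2 fun I => (ae_restrict_iff' (h.measurableSet I.2)).1 (hw I)
    have h2 : ∀ᵐ x ∂unitLebesgue, x ∈ ⋃₀ 𝓘 := by
      rw [ae_restrict_iff' measurableSet_Icc, ae_iff]
      refine measure_mono_null (fun x hx => ?_) h.full
      simp only [mem_ofPred_eq, Classical.not_imp] at hx
      exact hx
    filter_upwards [h1, hμ.ae_le h2] with x hx1 ⟨I, hI, hxI⟩
    rw [heq ⟨I, hI⟩ x hxI, hx1 ⟨I, hI⟩ hxI]
  · rw [eVariationOn.congr fun x hx => heq ⟨I, hI⟩ x hx]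
    exact (hwV ⟨I, hI⟩).le

theorem le_average (h : PiecewiseExpanding T 𝓘 ρ C) {I : Set ℝ} (hI : I ∈ 𝓘) {b : ℝ → ℝ}
    (hb : Integrable b unitLebesgue) {t : ℝ} (ht : ∀ y ∈ I, t ≤ b y) :
    t ≤ (volume.real I)⁻¹ * ∫ x in I, b x := by
  obtain ⟨p, q, -, hpq, -, rfl⟩ := h.isInterval I hI
  have hvol : 0 < volume.real (Ioo p q) := by
    rw [measureReal_def, Real.volume_Ioo, ENNReal.toReal_ofReal (by linarith)]; linarith
  have h1 : ∫ x in Ioo p q, t ≤ ∫ x in Ioo p q, b x :=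
    setIntegral_mono_on (integrableOn_const (by simp)) (h.integrableOn hb hI) measurableSet_Ioo ht
  rw [setIntegral_const, smul_eq_mul] at h1
  rw [inv_mul_eq_div, le_div_iff₀ hvol]
  linarith

/-- Composition of the transfer operator with multiplication by `F ∘ v`, where the growth of `F` and
`F'` is controlled by a monotone function `a`. -/
theorem exists_multiplier_operator (h : PiecewiseExpanding T 𝓘 ρ C) (hTm : Measurable T)
    [IsProbabilityMeasure μ] {g : ℝ → ℝ} {c M V : ℝ} (hd : HasBVDensity μ g c M V) {v : ℝ → ℝ}
    (hv : Measurable v) (hvar : (⨆ I ∈ 𝓘, essVar μ v I) < ∞) :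
    ∃ V₁ C₀ : ℝ, 0 ≤ V₁ ∧ 0 ≤ C₀ ∧ ∀ (F F' : ℝ → ℂ) (a : ℝ → ℝ),
      (∀ x, HasDerivAt F (F' x) x) → (∀ x, ‖F x‖ ≤ a |x|) → (∀ x, ‖F' x‖ ≤ a |x|) →
      (∀ x y, 0 ≤ x → x ≤ y → a x ≤ a y) → Integrable (fun x => a (|v x| + V₁)) μ →
      ∃ A : BV μ →L[ℂ] BV μ,
        (∀ φ, IsTransferOf μ T (fun x => F (v x) * (BV.incl μ φ : ℝ → ℂ) x) (BV.incl μ (A φ))) ∧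
        ‖A‖ ≤ C₀ * ∫ x, a (|v x| + V₁) ∂μ := by
  obtain ⟨v₀, V₁, hV₁, hv₀, hv₀V⟩ := h.exists_ae_eq_eVariationOn_le hd.absolutelyContinuous hvar
  obtain ⟨D, hD0, hD⟩ := h.exists_inv_deriv_le
  have hc := hd.pos
  have hM0 := hd.bound_nonneg
  have hV0 := hd.nonneg
  have hC0 := h.const_nonneg
  set Q := C * Real.exp C + 2 with hQ
  have hQ0 : 0 ≤ Q := by positivity
  set Z := M * 2 + 3 * V + 3 * M * V₁ + Q * (3 * M) with hZ
  have hZ0 : 0 ≤ Z := by positivity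
  set K := D * (c⁻¹ * (3 * M) + (c⁻¹ * Z + 3 * M * (V / c ^ 2))) with hK
  have hK0 : 0 ≤ K := by positivity
  refine ⟨V₁, K * c⁻¹, hV₁, by positivity, fun F F' a hF hFa hF'a hamono hint => ?_⟩
  set b := fun x => a (|v₀ x| + V₁) with hb
  have hbv : b =ᵐ[μ] fun x => a (|v x| + V₁) := hv₀.mono fun x hx => by simp only [hb, hx]
  have hbint : Integrable b μ := hint.congr hbv.symm
  have ha0 : ∀ x, 0 ≤ x → 0 ≤ a x := fun x hx => by
    have := (norm_nonneg _).trans (hFa x); rwa [abs_of_nonneg hx] at this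
  have hb0 : ∀ x, 0 ≤ b x := fun x => ha0 _ (by positivity)
  have hbl := hd.integrable_iff.1 hbint
  set J := ∫ x, b x ∂unitLebesgue with hJ
  have hJ0 : 0 ≤ J := integral_nonneg hb0
  have hJle : J ≤ c⁻¹ * ∫ x, a (|v x| + V₁) ∂μ := by
    rw [← integral_congr_ae hbv]; exact hd.integral_le hbint hb0
  have hFc : Continuous F := continuous_iff_continuousAt.2 fun x => (hF x).continuousAt
  have hFv : Integrable (fun x => F (v x)) μ :=
    hint.mono' (hFc.measurable.comp hv).aestronglyMeasurable (Eventually.of_forall fun x =>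
      (hFa _).trans (hamono _ _ (abs_nonneg _) (by linarith)))
  -- On `I` the values of `|v₀|` differ by at most `V₁`, so `a(|v₀ x|) ≤ a(|v₀ y| + V₁) = b y` for
  -- all `x`, `y` in `I`. Averaging over `y` replaces the supremum on `I` by the mean `m I`.
  set m : Set ℝ → ℝ := fun I => (volume.real I)⁻¹ * ∫ x in I, b x with hm
  have hm0 : ∀ I ∈ 𝓘, 0 ≤ m I := fun I hI => h.le_average hI hbl fun y _ => hb0 y
  have hv₀le : ∀ I ∈ 𝓘, ∀ x ∈ I, ∀ y ∈ I, |v₀ x| ≤ |v₀ y| + V₁ := fun I hI x hx y hy =>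
    norm_le_add_of_eVariationOn_le hV₁ (hv₀V I hI) hx hy
  have hFm : ∀ I ∈ 𝓘, ∀ x ∈ I, ‖F (v₀ x)‖ ≤ m I := fun I hI x hx =>
    h.le_average hI hbl fun y hy =>
      (hFa _).trans (hamono _ _ (abs_nonneg _) (hv₀le I hI x hx y hy))
  -- The segment between two values of `v₀` on `I` obeys the same bound as its ends, so `F'` is at
  -- most `b y` on it for every `y` in `I`, hence at most `m I`.
  have hFLip : ∀ I ∈ 𝓘, ∀ x ∈ I, ∀ z ∈ I, ‖F (v₀ x) - F (v₀ z)‖ ≤ m I * |v₀ x - v₀ z| := by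
    intro I hI x hx z hz
    rcases eq_or_ne (v₀ x) (v₀ z) with heq | hne
    · simp [heq]
    have hpos : 0 < |v₀ x - v₀ z| := abs_pos.2 (sub_ne_zero.2 hne)
    rw [← div_le_iff₀ hpos]
    refine h.le_average hI hbl fun y hy => ?_
    rw [div_le_iff₀ hpos]
    refine (convex_uIcc (v₀ z) (v₀ x)).norm_image_sub_le_of_norm_hasDerivWithin_le
      (fun w _ => (hF w).hasDerivWithinAt) (fun w hw => (hF'a w).trans ?_) left_mem_uIcc
      right_mem_uIcc
    refine hamono _ _ (abs_nonneg _) ?_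
    exact (abs_le_max_abs_abs hw.1 hw.2).trans (max_le
      (by rcases min_choice (v₀ z) (v₀ x) with h' | h' <;> rw [h'] <;>
            [exact hv₀le I hI z hz y hy; exact hv₀le I hI x hx y hy])
      (by rcases max_choice (v₀ z) (v₀ x) with h' | h' <;> rw [h'] <;>
            [exact hv₀le I hI z hz y hy; exact hv₀le I hI x hx y hy]))
  have hFV : ∀ I ∈ 𝓘, eVariationOn (fun x => F (v₀ x)) I ≤ ENNReal.ofReal (m I * V₁) := by
    intro I hI
    have hL : LipschitzOnWith (m I).toNNReal F (v₀ '' I) := by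
      refine LipschitzOnWith.of_dist_le_mul ?_
      rintro _ ⟨x, hx, rfl⟩ _ ⟨z, hz, rfl⟩
      rw [dist_eq_norm, Real.dist_eq, Real.coe_toNNReal _ (hm0 I hI)]
      exact hFLip I hI x hx z hz
    refine (hL.comp_eVariationOn_le (mapsTo_image v₀ I)).trans ?_
    rw [ENNReal.ofReal_mul (hm0 I hI)]
    exact mul_le_mul_right (hv₀V I hI) _
  -- The branch weight `D|I|` cancels the normalisation of the mean: `s I * m I` is `D` times the
  -- integral of `b` over `I`, and the sum over the infinitely many branches is `D * J`.
  set s : Set ℝ → ℝ := fun I => D * volume.real I with hs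
  have hsm : ∀ I : 𝓘, s I * m I = D * ∫ x in I, b x := by
    intro I
    obtain ⟨p, q, -, hpq, -, hIpq⟩ := h.isInterval I I.2
    have hvol : volume.real (I : Set ℝ) ≠ 0 := by
      rw [hIpq, measureReal_def, Real.volume_Ioo, ENNReal.toReal_ofReal (by linarith)]
      linarith
    simp only [hs, hm]
    field_simp
  have hsum : HasSum (fun I : 𝓘 => s I * m I) (D * J) := by
    simp only [hsm]; exact (h.hasSum_integral hbl).mul_left D
  have hsm0 : ∀ I : 𝓘, 0 ≤ s I * m I := fun I =>
    mul_nonneg (mul_nonneg hD0 measureReal_nonneg) (hm0 I I.2)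
  obtain ⟨A, hA, hAle⟩ := BV.exists_continuousLinearMap (C := K * J) hTm hFv (by positivity)
    (fun φ => by
      obtain ⟨f, hfφ, hfV, hf3⟩ := BV.exists_version hd.absolutelyContinuous φ
      set n := ‖φ‖
      have hn0 : 0 ≤ n := norm_nonneg φ
      have hgfV := eVariationOn_smul_le_ofReal (𝕜 := ℝ) hM0 (by positivity)
        (fun x (_ : x ∈ Icc (0 : ℝ) 1) => hd.abs_le x) hf3 hV0 (by positivity)
        hd.eVariationOn_le hfV
      have hgf : ∀ x ∈ Icc (0 : ℝ) 1, ‖g x • f x‖ ≤ M * (3 * n) := fun x hx => by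
        rw [norm_smul]
        exact mul_le_mul (hd.abs_le x) (hf3 x hx) (norm_nonneg _) hM0
      set H : ℝ → ℂ := fun x => F (v₀ x) • (g x • f x) with hH
      have hHM : ∀ I ∈ 𝓘, ∀ x ∈ I, ‖H x‖ ≤ m I * (M * (3 * n)) := fun I hI x hx => by
        rw [hH, norm_smul]
        exact mul_le_mul (hFm I hI x hx) (hgf x (h.subset_Icc hI hx)) (norm_nonneg _) (hm0 I hI)
      have hHV : ∀ I ∈ 𝓘, eVariationOn H I ≤ ENNReal.ofReal
          (m I * (M * (2 * n) + 3 * n * V) + M * (3 * n) * (m I * V₁)) := fun I hI =>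
        eVariationOn_smul_le_ofReal (hm0 I hI) (by positivity) (hFm I hI)
          (fun x hx => hgf x (h.subset_Icc hI hx)) (mul_nonneg (hm0 I hI) hV₁) (by positivity)
          (hFV I hI) ((eVariationOn.mono _ (h.subset_Icc hI)).trans hgfV)
      have hsumM : HasSum (fun I : 𝓘 => s I * (m I * (M * (3 * n)))) (D * J * (M * (3 * n))) := by
        simpa only [mul_assoc] using hsum.mul_right (M * (3 * n))
      set w := transfer T 𝓘 H with hw
      have hwM : ∀ x, ‖w x‖ ≤ D * J * (M * (3 * n)) := fun x =>
        (h.norm_transfer_le hD hHM hsumM.summable x).trans_eq hsumM.tsum_eq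
      have hwV : eVariationOn w univ ≤ ENNReal.ofReal (D * J * (Z * n)) := by
        refine (h.eVariationOn_transfer_le hD hHM (fun I hI => ?_) hHV hsumM.summable).trans ?_
        · have := hm0 I hI; positivity
        · have e : ∀ I : 𝓘, D * volume.real (I : Set ℝ) *
              (m I * (M * (2 * n) + 3 * n * V) + M * (3 * n) * (m I * V₁)) +
              (C * Real.exp C + 2) * (D * volume.real (I : Set ℝ) * (m I * (M * (3 * n)))) =
              s I * m I * (Z * n) := fun I => by
            simp only [hs, hZ, hQ]; ring
          simp only [e]
          rw [← ENNReal.ofReal_tsum_of_nonneg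
            (fun I => mul_nonneg (hsm0 I) (by positivity)) (hsum.mul_right _).summable,
            (hsum.mul_right _).tsum_eq]
      have hkM : ∀ x, ‖(g x)⁻¹ • w x‖ ≤ c⁻¹ * (D * J * (M * (3 * n))) := fun x => by
        rw [norm_smul]
        exact mul_le_mul (hd.abs_inv_le x) (hwM x) (norm_nonneg _) (by positivity)
      have hkV := eVariationOn_smul_le_ofReal (𝕜 := ℝ) (inv_nonneg.2 hc.le) (by positivity)
        (fun x (_ : x ∈ Icc (0 : ℝ) 1) => hd.abs_inv_le x) (fun x _ => hwM x) (by positivity)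
        (by positivity) hd.eVariationOn_inv_le ((eVariationOn.mono _ (subset_univ _)).trans hwV)
      have hae : (fun x => F (v₀ x) * f x) =ᵐ[μ] fun x => F (v x) * (BV.incl μ φ : ℝ → ℂ) x := by
        filter_upwards [hv₀, hfφ] with x hx hx'
        rw [hx, hx']
      have htr := hd.isTransferOf h hTm ((BV.integrable_mul hFv φ).congr hae.symm)
      have hHeq : (fun y => g y • (F (v₀ y) * f y)) = H := by
        funext y
        simp only [hH, smul_eq_mul, Complex.real_smul]; ring
      rw [hHeq] at htr
      obtain ⟨k, hk, hkn⟩ := BV.exists_of_essVar_le htr.1.1 (by positivity)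
        (Eventually.of_forall hkM) (by positivity)
        ((essVar_le (EventuallyEq.refl _ _)).trans hkV)
      refine ⟨k, htr.congr hae hk.symm, hkn.trans (le_of_eq ?_)⟩
      simp only [hK]; ring)
  refine ⟨A, hA, hAle.trans ?_⟩
  exact (mul_le_mul_of_nonneg_left hJle hK0).trans_eq (mul_assoc _ _ _).symm

end PiecewiseExpanding
end

noncomputable section

/-! ### The spectral gap -/

section SpectralGap

variable {B : Type*} [NormedAddCommGroup B] [NormedSpace ℂ B]

theorem isUnit_smul_iff_of_ne_zero {A : Type*} [Ring A] [Algebra ℂ A] {z : ℂ} (hz : z ≠ 0) {a : A} :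
    IsUnit (z • a) ↔ IsUnit a := by
  have := isUnit_smul_iff (Units.mk0 z hz) a
  rwa [Units.smul_def, Units.val_mk0] at this

/-- A spectral gap follows from a contraction on the kernel of an invariant functional. -/
theorem hypH3_of_contraction [CompleteSpace B] (R : B →L[ℂ] B) (ℓ : B →L[ℂ] ℂ) (e : B)
    (he : ℓ e = 1) (hRe : R e = e) (hℓR : ∀ φ, ℓ (R φ) = ℓ φ)
    (hc : ∀ κ > 0, ∃ n, 0 < n ∧ ∀ φ, ℓ φ = 0 → ‖(R ^ n) φ‖ ≤ κ * ‖φ‖) : HypH3 R := by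
  have he0 : e ≠ 0 := fun h => by simp [h] at he
  have : Nontrivial B := ⟨⟨e, 0, he0⟩⟩
  -- `P` projects onto `e` along the kernel of `ℓ`, and `N = R - P` vanishes at `e` and agrees with
  -- `R` on that kernel. So some power of `N` has norm at most 1/2, which confines its spectrum.
  set P : B →L[ℂ] B := ℓ.smulRight e with hP
  have hPa : ∀ φ, P φ = ℓ φ • e := fun φ => rfl
  set N : B →L[ℂ] B := R - P with hN
  have hNa : ∀ φ, N φ = R φ - ℓ φ • e := fun φ => rfl
  have hPP : P * P = P := by
    ext φ; simp [hPa, he]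
  have hNP : N * P = 0 := by
    ext φ; simp [hNa, hPa, he, hRe]
  have hℓN : ∀ φ, ℓ (N φ) = 0 := fun φ => by simp [hNa, hℓR, he]
  have hNpow : ∀ n, 0 < n → ∀ φ, (N ^ n) φ = (R ^ n) (φ - ℓ φ • e) := by
    intro n hn
    induction n, hn using Nat.le_induction with
    | base => intro φ; simp [hNa, hRe]
    | succ n hn ih =>
      intro φ
      rw [pow_succ, mul_apply_eq_comp, ih, hℓN, zero_smul, sub_zero, hNa, pow_succ,
        mul_apply_eq_comp, map_sub R, map_smul, hRe]
  set κ := (2 * (1 + ‖P‖))⁻¹ with hκ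
  have hκ0 : 0 < κ := by positivity
  obtain ⟨n, hn, hcn⟩ := hc κ hκ0
  have hNn : ‖N ^ n‖ ≤ 1 / 2 := by
    refine ContinuousLinearMap.opNorm_le_bound _ (by norm_num) fun φ => ?_
    rw [hNpow n hn]
    have h1 : ℓ (φ - ℓ φ • e) = 0 := by simp [he]
    have h2 : ‖φ - ℓ φ • e‖ ≤ (1 + ‖P‖) * ‖φ‖ := by
      calc ‖φ - P φ‖ ≤ ‖φ‖ + ‖P φ‖ := norm_sub_le _ _
        _ ≤ ‖φ‖ + ‖P‖ * ‖φ‖ := by gcongr; exact P.le_opNorm φ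
        _ = _ := by ring
    calc _ ≤ κ * ‖φ - ℓ φ • e‖ := hcn _ h1
      _ ≤ κ * ((1 + ‖P‖) * ‖φ‖) := by gcongr
      _ = 1 / 2 * ‖φ‖ := by rw [hκ]; field_simp
  have hspecN : ∀ z ∈ spectrum ℂ N, ‖z‖ ^ n ≤ 1 / 2 := by
    intro z hz
    have h1 := spectrum.norm_le_norm_of_mem (spectrum.pow_mem_pow N n hz)
    rw [norm_pow] at h1
    exact h1.trans hNn
  have hunitP : ∀ z : ℂ, z ≠ 0 → z ≠ 1 → IsUnit (algebraMap ℂ (B →L[ℂ] B) z - P) := by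
    intro z hz hz1
    have h1 : (algebraMap ℂ (B →L[ℂ] B) z - P) * (algebraMap ℂ (B →L[ℂ] B) (z - 1) + P) =
        algebraMap ℂ (B →L[ℂ] B) (z * (z - 1)) := by
      rw [sub_mul, mul_add, mul_add, hPP, ← map_mul]
      simp only [Algebra.algebraMap_eq_smul_one, smul_mul_assoc, one_mul, mul_smul_comm, mul_one]
      module
    have h2 : (algebraMap ℂ (B →L[ℂ] B) (z - 1) + P) * (algebraMap ℂ (B →L[ℂ] B) z - P) =
        algebraMap ℂ (B →L[ℂ] B) (z * (z - 1)) := by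
      rw [add_mul, mul_sub, mul_sub, hPP, ← map_mul]
      simp only [Algebra.algebraMap_eq_smul_one, smul_mul_assoc, one_mul, mul_smul_comm, mul_one]
      module
    have h3 : IsUnit (algebraMap ℂ (B →L[ℂ] B) (z * (z - 1))) :=
      (IsUnit.mk0 _ (mul_ne_zero hz (sub_ne_zero.2 hz1))).map _
    have hcomm : Commute (algebraMap ℂ (B →L[ℂ] B) z - P)
      (algebraMap ℂ (B →L[ℂ] B) (z - 1) + P) := h1.trans h2.symm
    rw [← h1] at h3
    exact (hcomm.isUnit_mul_iff.1 h3).1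
  have hspecR : ∀ z ∈ spectrum ℂ R, z ≠ 0 → z ≠ 1 → z ∈ spectrum ℂ N := by
    intro z hz hz0 hz1
    by_contra hzN
    refine hz ?_
    rw [spectrum.notMem_iff] at hzN
    -- Since `N P = 0`, the product `(z - N)(z - P)` equals `z (z - R)`. Away from `0` and `1`,
    -- where `z - P` is invertible, the spectrum of `R` is thus contained in that of `N`.
    have h1 : (algebraMap ℂ (B →L[ℂ] B) z - N) * (algebraMap ℂ (B →L[ℂ] B) z - P) =
        z • (algebraMap ℂ (B →L[ℂ] B) z - R) := by
      rw [sub_mul, mul_sub, mul_sub, hNP, Algebra.algebraMap_eq_smul_one, hN]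
      simp only [smul_mul_assoc, one_mul, mul_smul_comm, mul_one]
      module
    have h2 := hzN.mul (hunitP z hz0 hz1)
    rw [h1, isUnit_smul_iff_of_ne_zero hz0] at h2
    exact h2
  have hker : ∀ φ, R φ = φ → φ = ℓ φ • e := by
    intro φ hφ
    have h1 : ∀ m : ℕ, (R ^ m) (φ - ℓ φ • e) = φ - ℓ φ • e := by
      intro m
      induction m with
      | zero => simp
      | succ m ih =>
        rw [pow_succ, mul_apply_eq_comp, map_sub R, map_smul, hRe, hφ, ih]
    obtain ⟨m, hm, hcm⟩ := hc (1 / 2) (by norm_num)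
    have h2 := hcm (φ - ℓ φ • e) (by simp [he])
    rw [h1] at h2
    have h3 : ‖φ - ℓ φ • e‖ = 0 := by linarith [norm_nonneg (φ - ℓ φ • e)]
    exact sub_eq_zero.1 (norm_eq_zero.1 h3)
  have hmemker : ∀ φ, φ ∈ LinearMap.ker ((R - 1 : B →L[ℂ] B) : B →ₗ[ℂ] B) ↔ R φ = φ := by
    intro φ
    rw [LinearMap.mem_ker]
    change R φ - φ = 0 ↔ _
    exact sub_eq_zero
  have hkerspan : LinearMap.ker ((R - 1 : B →L[ℂ] B) : B →ₗ[ℂ] B) = ℂ ∙ e := by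
    ext φ
    rw [hmemker, Submodule.mem_span_singleton]
    constructor
    · intro h; exact ⟨ℓ φ, (hker φ h).symm⟩
    · rintro ⟨t, rfl⟩; rw [map_smul, hRe]
  have hrange : ∀ φ, φ ∈ LinearMap.range ((R - 1 : B →L[ℂ] B) : B →ₗ[ℂ] B) ↔ ℓ φ = 0 := by
    intro φ
    constructor
    · rintro ⟨ψ, rfl⟩
      change ℓ (R ψ - ψ) = 0
      rw [map_sub, hℓR, sub_self]
    · intro hφ
      have h1 : (1 : ℂ) ∉ spectrum ℂ N := fun h => by
        have := hspecN 1 h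
        norm_num at this
      rw [spectrum.notMem_iff, map_one] at h1
      obtain ⟨U, hU⟩ := h1
      -- The solution of `(1 - N) ψ = φ` satisfies `ℓ ψ = 0`, because `ℓ N = 0` and `ℓ φ = 0`. Hence
      -- `N ψ = R ψ`, and `φ` is the image of `-ψ` under `R - 1`.
      set ψ := (↑U⁻¹ : B →L[ℂ] B) φ with hψ
      have h2 : ψ - N ψ = φ := by
        have h3 : ((1 : B →L[ℂ] B) - N) ψ = φ := by
          rw [← hU, hψ, ← mul_apply_eq_comp, Units.mul_inv]; rfl
        exact h3
      have h4 : ℓ ψ = 0 := by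
        have := congrArg ℓ h2
        rwa [map_sub, hℓN, sub_zero, hφ] at this
      refine ⟨-ψ, ?_⟩
      change R (-ψ) - -ψ = φ
      rw [hNa, h4, zero_smul, sub_zero] at h2
      rw [map_neg, ← h2]; abel
  refine ⟨⟨?_, ?_⟩, ((1 : ℝ) / 2) ^ ((1 : ℝ) / n), ?_, fun z hz hz1 => ?_⟩
  · rw [hkerspan]; exact finrank_span_singleton he0
  · refine IsCompl.of_eq ?_ ?_
    · rw [eq_bot_iff]
      rintro φ ⟨h1, h2⟩
      have h3 := hker φ ((hmemker φ).1 h1)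
      rw [(hrange φ).1 h2, zero_smul] at h3
      exact h3
    · rw [eq_top_iff]
      intro φ _
      refine Submodule.mem_sup.2 ⟨ℓ φ • e, (hmemker _).2 (by rw [map_smul, hRe]), φ - ℓ φ • e,
        (hrange _).2 (by simp [he]), by abel⟩
  · exact Real.rpow_lt_one (by norm_num) (by norm_num) (by positivity)
  · rcases eq_or_ne z 0 with rfl | hz0
    · rw [norm_zero]; positivity
    · have h1 := hspecN z (hspecR z hz hz0 hz1)
      rw [one_div (n : ℝ)]
      refine (Real.le_rpow_inv_iff_of_pos (norm_nonneg _) (by norm_num) (by exact_mod_cast hn)).2 ?_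
      rwa [Real.rpow_natCast]

end SpectralGap

/-- Multiplication by the density conjugates the transfer operator for `μ` to the one for Lebesgue
measure; `L` extracts a real or imaginary part, as the contraction argument splits functions by
sign. -/
theorem IsTransferOf.isRealTransfer {μ : Measure ℝ} {g : ℝ → ℝ} {c M V : ℝ} {S : ℝ → ℝ}
    {f k : ℝ → ℂ} (hd : HasBVDensity μ g c M V) (hS : Measurable S) (hf : Integrable f μ)
    (h : IsTransferOf μ S f k) (L : ℂ →L[ℝ] ℝ) :
    IsRealTransfer S (fun x => L (g x • f x)) (fun x => L (g x • k x)) := by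
  have hfi := hd.integrable_iff_smul.1 hf
  have hki := hd.integrable_iff_smul.1 h.1
  refine ⟨L.integrable_comp hfi, L.integrable_comp hki, fun A hA => ?_⟩
  rw [L.integral_comp_comm hki.restrict, L.integral_comp_comm hfi.restrict]
  congr 1
  rw [← integral_indicator hA, ← integral_indicator (hS hA)]
  have h1 := h.2 (A.indicator fun _ => (1 : ℂ)) (measurable_const.indicator hA)
    ⟨1, fun x => by by_cases hx : x ∈ A <;> simp [hx]⟩
  rw [hd.integral_eq, hd.integral_eq] at h1
  convert h1 using 2
  · ext x; by_cases hx : x ∈ A <;> simp [hx]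
  · ext x; by_cases hx : S x ∈ A <;> simp [hx]

theorem eVariationOn_comp_le_of_norm_le {E F : Type*} [NormedAddCommGroup E] [NormedSpace ℝ E]
    [NormedAddCommGroup F] [NormedSpace ℝ F] (L : E →L[ℝ] F) (hL : ‖L‖ ≤ 1) (f : ℝ → E)
    (s : Set ℝ) : eVariationOn (fun x => L (f x)) s ≤ eVariationOn f s := by
  have h1 : LipschitzOnWith 1 L univ := (L.lipschitz.weaken hL).lipschitzOnWith
  have h2 := h1.comp_eVariationOn_le (g := f) (s := s) (mapsTo_univ _ _)
  rwa [ENNReal.coe_one, one_mul] at h2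

namespace PiecewiseExpanding

variable {T : ℝ → ℝ} {𝓘 : Set (Set ℝ)} {ρ C : ℝ} {μ : Measure ℝ} {g : ℝ → ℝ} {c M V : ℝ}

/-- Exponential decay in `BV` of the iterates of the transfer operator on functions of mean
zero. -/
theorem exists_norm_le_pow (h : PiecewiseExpanding T 𝓘 ρ C) (hρ : 1 < ρ) (hTm : Measurable T)
    (hmix : IsTopMixing T 𝓘) [IsProbabilityMeasure μ] (hd : HasBVDensity μ g c M V) :
    ∃ n : ℕ, 0 < n ∧ ∃ Q θ : ℝ, 0 ≤ θ ∧ θ < 1 ∧ ∀ (j : ℕ) (φ k : BV μ),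
      ∫ x, (BV.incl μ φ : ℝ → ℂ) x ∂μ = 0 →
      IsTransferOf μ T^[n * j] (BV.incl μ φ) (BV.incl μ k) → ‖k‖ ≤ Q * θ ^ j * ‖φ‖ := by
  obtain ⟨n, hn, B, θ, hB, hθ0, hθ1, hcon⟩ := h.exists_iterate_contraction hρ hTm hmix
  have hc := hd.pos
  have hM0 := hd.bound_nonneg
  have hV0 := hd.nonneg
  set q := M * 2 + 3 * V + B * (M * 3) with hq
  have hq0 : 0 ≤ q := by positivity
  set W := q + 1 with hW
  have hW0 : 0 < W := by linarith
  -- The contracted norm is `Var + B |·|₁`, so it controls the L¹-norm only after division by `B`;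
  -- the supremum is at most variation plus L¹-norm.
  set S := W + q / B with hS
  have hS0 : 0 ≤ S := by positivity
  refine ⟨n, hn, c⁻¹ * (2 * S) + (c⁻¹ * (2 * W) + 2 * S * (V / c ^ 2)), θ, hθ0.le, hθ1,
    fun j φ k hφ0 htr => ?_⟩
  rcases (norm_nonneg φ).eq_or_lt with hn0 | hpos
  · have hφ : φ = 0 := norm_eq_zero.1 hn0.symm
    have h0 : (BV.incl μ φ : ℝ → ℂ) =ᵐ[μ] fun _ => 0 := by
      rw [hφ, map_zero]; exact Lp.coeFn_zero ℂ ∞ μ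
    have h1 : IsTransferOf μ T^[n * j] (fun _ => (0 : ℂ)) fun _ => 0 :=
      ⟨integrable_zero _ _ _, by simp⟩
    have h2 := (htr.congr h0 (EventuallyEq.refl _ _)).unique h1
    have h3 : k = 0 := BV.ext_ae (h2.trans (by rw [map_zero]; exact (Lp.coeFn_zero ℂ ∞ μ).symm))
    rw [h3, hφ]; simp
  set N := ‖φ‖ with hN
  have hφi : Integrable (BV.incl μ φ : ℝ → ℂ) μ :=
    (Lp.memLp (BV.incl μ φ)).integrable (by simp)
  obtain ⟨f, hfφ, hfV, hf3⟩ := BV.exists_version hd.absolutelyContinuous φ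
  have hfφl : f =ᵐ[unitLebesgue] BV.incl μ φ := hd.absolutelyContinuous'.ae_le hfφ
  have hgfV := eVariationOn_smul_le_ofReal (𝕜 := ℝ) hM0 (by positivity)
    (fun x (_ : x ∈ Icc (0 : ℝ) 1) => hd.abs_le x) hf3 hV0 (by positivity)
    hd.eVariationOn_le hfV
  have key : ∀ L : ℂ →L[ℝ] ℝ, ‖L‖ ≤ 1 → ∃ w : ℝ → ℝ,
      w =ᵐ[μ] (fun x => L (g x • (BV.incl μ k : ℝ → ℂ) x)) ∧
      eVariationOn w (Icc 0 1) ≤ ENNReal.ofReal (W * θ ^ j * N) ∧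
      ∀ x ∈ Icc (0 : ℝ) 1, ‖w x‖ ≤ S * θ ^ j * N := by
    intro L hL
    have hrt := htr.isRealTransfer hd (hTm.iterate _) hφi L
    have hint0 : ∫ x, L (g x • (BV.incl μ φ : ℝ → ℂ) x) ∂unitLebesgue = 0 := by
      rw [L.integral_comp_comm (hd.integrable_iff_smul.1 hφi), ← hd.integral_eq, hφ0, map_zero]
    have hae : (fun x => L (g x • f x)) =ᵐ[unitLebesgue]
        fun x => L (g x • (BV.incl μ φ : ℝ → ℂ) x) := hfφl.mono fun x hx => by simp only [hx]
    have hvar : essVar unitLebesgue (fun x => L (g x • (BV.incl μ φ : ℝ → ℂ) x)) (Icc 0 1) ≤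
        ENNReal.ofReal (M * (2 * N) + 3 * N * V) := by
      rw [← essVar_congr hae]
      exact (essVar_le (EventuallyEq.refl _ _)).trans
        ((eVariationOn_comp_le_of_norm_le L hL _ _).trans hgfV)
    have habs : ∫ x, |L (g x • (BV.incl μ φ : ℝ → ℂ) x)| ∂unitLebesgue ≤ M * (3 * N) := by
      rw [← integral_congr_ae (hae.mono fun x hx => congrArg abs hx)]
      have h1 : ∀ᵐ x ∂unitLebesgue, ‖|L (g x • f x)|‖ ≤ M * (3 * N) := by
        filter_upwards [ae_restrict_mem measurableSet_Icc] with x hx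
        rw [Real.norm_eq_abs, abs_abs]
        calc |L (g x • f x)| ≤ ‖L‖ * ‖g x • f x‖ := L.le_opNorm _
          _ ≤ 1 * (M * (3 * N)) := by
            rw [norm_smul]
            exact mul_le_mul hL (mul_le_mul (hd.abs_le x) (hf3 x hx) (norm_nonneg _) hM0)
              (by positivity) zero_le_one
          _ = _ := one_mul _
      have h2 := norm_integral_le_of_norm_le_const h1
      rw [probReal_univ, mul_one] at h2
      exact (le_abs_self _).trans h2
    obtain ⟨V', hV'0, hV', hle⟩ := hcon j _ _ _ hrt hint0 (by positivity) hvar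
    set I := ∫ x, |L (g x • (BV.incl μ k : ℝ → ℂ) x)| ∂unitLebesgue
    have hI0 : 0 ≤ I := integral_nonneg fun _ => abs_nonneg _
    have hle' : V' + B * I ≤ q * θ ^ j * N := by
      refine hle.trans ?_
      calc _ ≤ θ ^ j * (M * (2 * N) + 3 * N * V + B * (M * (3 * N))) := by gcongr
        _ = _ := by rw [hq]; ring
    have hθN : 0 < θ ^ j * N := by positivity
    obtain ⟨w, hw, hwV⟩ := _root_.exists_ae_eq_eVariationOn_le (W := W * θ ^ j * N) hV'
      (by positivity) (by
        have : 0 ≤ B * I := by positivity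
        rw [hW]; linarith)
    refine ⟨w, hd.absolutelyContinuous.ae_le hw, hwV, fun x hx => ?_⟩
    have h1 := norm_le_add_integral_norm (by positivity) hwV
      (hrt.integrable_right.congr hw.symm) hx
    have h2 : ∫ y, ‖w y‖ ∂unitLebesgue = I :=
      integral_congr_ae (hw.mono fun y hy => congrArg abs hy)
    have h3 : I ≤ q / B * θ ^ j * N := by
      have h4 : I ≤ q * θ ^ j * N / B := by
        rw [le_div_iff₀ hB]; linarith
      exact h4.trans (le_of_eq (by ring))
    rw [h2] at h1
    rw [hS]; linarith
  obtain ⟨w₁, hw₁, hw₁V, hw₁S⟩ := key Complex.reCLM Complex.reCLM_norm.le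
  obtain ⟨w₂, hw₂, hw₂V, hw₂S⟩ := key Complex.imCLM Complex.imCLM_norm.le
  set w : ℝ → ℂ := fun x => (w₁ x : ℂ) + (w₂ x : ℂ) * Complex.I with hw
  have hkw : (BV.incl μ k : ℝ → ℂ) =ᵐ[μ] fun x => (g x)⁻¹ • w x := by
    filter_upwards [hw₁, hw₂] with x hx1 hx2
    rw [hw]
    simp only [hx1, hx2, Complex.reCLM_apply, Complex.imCLM_apply, Complex.re_add_im]
    exact (hd.inv_smul_smul x _).symm
  have hwS : ∀ x ∈ Icc (0 : ℝ) 1, ‖w x‖ ≤ 2 * (S * θ ^ j * N) := by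
    intro x hx
    refine (norm_add_le _ _).trans ?_
    rw [norm_mul, Complex.norm_I, mul_one, Complex.norm_real, Complex.norm_real]
    linarith [hw₁S x hx, hw₂S x hx]
  have hwV : eVariationOn w (Icc 0 1) ≤ ENNReal.ofReal (2 * (W * θ ^ j * N)) := by
    refine (eVariationOn_add_le' _ _ _).trans ?_
    rw [two_mul, ENNReal.ofReal_add (by positivity) (by positivity)]
    refine add_le_add ?_ ?_
    · exact (eVariationOn_comp_le_of_norm_le Complex.ofRealCLM Complex.ofRealCLM_norm.le w₁ _).trans
        hw₁V
    · have hL : LipschitzOnWith 1 (fun y : ℝ => (y : ℂ) * Complex.I) univ :=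
        LipschitzOnWith.of_dist_le_mul fun x _ y _ => by
          rw [dist_eq_norm, ← sub_mul, norm_mul, Complex.norm_I, mul_one, ← Complex.ofReal_sub,
            Complex.norm_real, NNReal.coe_one, one_mul, dist_eq_norm]
      have h2 := hL.comp_eVariationOn_le (g := w₂) (s := Icc 0 1) (mapsTo_univ _ _)
      rw [ENNReal.coe_one, one_mul] at h2
      exact h2.trans hw₂V
  have hkV := eVariationOn_smul_le_ofReal (𝕜 := ℝ) (inv_nonneg.2 hc.le) (by positivity)
    (fun x (_ : x ∈ Icc (0 : ℝ) 1) => hd.abs_inv_le x) hwS (by positivity)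
    (by positivity) hd.eVariationOn_inv_le hwV
  have hkM : ∀ᵐ x ∂μ, ‖(g x)⁻¹ • w x‖ ≤ c⁻¹ * (2 * (S * θ ^ j * N)) := by
    filter_upwards [hd.absolutelyContinuous.ae_le (ae_restrict_mem measurableSet_Icc)] with x hx
    rw [norm_smul]
    exact mul_le_mul (hd.abs_inv_le x) (hwS x hx) (norm_nonneg _) (by positivity)
  refine (BV.norm_le_of_ae_eq hkw (by positivity) hkM (by positivity)
    ((essVar_le (EventuallyEq.refl _ _)).trans hkV)).trans (le_of_eq ?_)
  ring

theorem hypH3 (h : PiecewiseExpanding T 𝓘 ρ C) (hρ : 1 < ρ)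
    (hmix : IsTopMixing T 𝓘) [IsProbabilityMeasure μ] (hd : HasBVDensity μ g c M V)
    (hinv : MeasurePreserving T μ μ) (R : BV μ →L[ℂ] BV μ)
    (hR : ∀ φ, IsTransferOf μ T (BV.incl μ φ) (BV.incl μ (R φ))) : HypH3 R := by
  have hTm := hinv.measurable
  obtain ⟨n, hn, Q, θ, hθ0, hθ1, hpow⟩ := h.exists_norm_le_pow hρ hTm hmix hd
  have := BV.completeSpace (μ := μ)
  have hint : ∀ φ : BV μ, Integrable (BV.incl μ φ : ℝ → ℂ) μ := fun φ =>
    (Lp.memLp (BV.incl μ φ)).integrable (by simp)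
  let ℓ : BV μ →L[ℂ] ℂ := LinearMap.mkContinuous
    { toFun := fun φ => ∫ x, (BV.incl μ φ : ℝ → ℂ) x ∂μ
      map_add' := fun φ ψ => by
        rw [map_add, ← integral_add (hint φ) (hint ψ)]
        exact integral_congr_ae (Lp.coeFn_add _ _)
      map_smul' := fun t φ => by
        rw [map_smul, RingHom.id_apply, ← integral_smul]
        exact integral_congr_ae (Lp.coeFn_smul t (BV.incl μ φ)) } 1 fun φ => by
      rw [one_mul]
      refine (norm_integral_le_of_norm_le_const (BV.ae_norm_le φ)).trans ?_
      rw [probReal_univ, mul_one]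
      exact BV.norm_incl_le φ
  have hℓ : ∀ φ, ℓ φ = ∫ x, (BV.incl μ φ : ℝ → ℂ) x ∂μ := fun φ => rfl
  obtain ⟨e, he⟩ := (BV.isBanachInLinfty (μ := μ)).2.2.1 1
  have hRpow : ∀ (m : ℕ) (φ : BV μ),
      IsTransferOf μ T^[m] (BV.incl μ φ) (BV.incl μ ((R ^ m) φ)) := by
    intro m
    induction m with
    | zero => intro φ; exact ⟨hint _, fun g _ _ => by simp⟩
    | succ m ih =>
      intro φ
      rw [pow_succ, mul_apply_eq_comp, Function.iterate_succ]
      exact (hR φ).comp (hTm.iterate m) (ih (R φ))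
  refine hypH3_of_contraction R ℓ e ?_ ?_ (fun φ => (hR φ).integral_eq) fun κ hκ => ?_
  · rw [hℓ, integral_congr_ae he]; simp
  -- Invariance of `μ` says exactly that the constant function `1` is its own image.
  · refine BV.ext_ae ((hR e).unique ?_)
    refine ⟨hint e, fun w hw hb => ?_⟩
    rw [integral_congr_ae (he.mono fun x hx => congrArg (· * w x) hx),
      integral_congr_ae (he.mono fun x hx => congrArg (· * w (T x)) hx)]
    simp only [one_mul]
    conv_lhs => rw [← hinv.map_eq]
    exact integral_map hTm.aemeasurable hw.aestronglyMeasurable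
  · have hlim : Tendsto (fun j : ℕ => Q * θ ^ j) atTop (𝓝 0) := by
      simpa using (tendsto_pow_atTop_nhds_zero_of_lt_one hθ0 hθ1).const_mul Q
    obtain ⟨j, hj, hj1⟩ := ((hlim.eventually (gt_mem_nhds hκ)).and (eventually_ge_atTop 1)).exists
    refine ⟨n * j, Nat.mul_pos hn hj1, fun φ hφ => ?_⟩
    exact (hpow j φ _ hφ (hRpow _ φ)).trans (by gcongr)

end PiecewiseExpanding
end

noncomputable section

/-! ### Regularly varying tails and truncated moments -/

section Tails

/-- The asymptotics of moments are obtained by doubling from one dyadic block, so regular variation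
enters only through the limit `2^{-α}` of the ratio of the tails at `2x` and `x`. -/
theorem dyadic_induction {P : ℝ → Prop} {x₀ : ℝ} (hx₀ : 0 < x₀)
    (base : ∀ x, x₀ ≤ x → x < 2 * x₀ → P x) (step : ∀ x, x₀ ≤ x → P x → P (2 * x)) :
    ∀ x, x₀ ≤ x → P x := by
  have key : ∀ n : ℕ, ∀ x, x₀ ≤ x → x < 2 ^ (n + 1) * x₀ → P x := by
    intro n
    induction n with
    | zero => intro x h1 h2; exact base x h1 (by simpa using h2)
    | succ n ih =>
      intro x h1 h2
      rcases lt_or_ge x (2 * x₀) with hlt | hge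
      · exact base x h1 hlt
      · have := step (x / 2) (by linarith) (ih (x / 2) (by linarith) (by
          rw [pow_succ] at h2; linarith))
        rwa [mul_div_cancel₀ x (two_ne_zero)] at this
  intro x hx
  obtain ⟨n, hn⟩ := ((tendsto_pow_atTop_atTop_of_one_lt (one_lt_two : (1 : ℝ) < 2)).eventually
    (eventually_gt_atTop (x / x₀))).exists
  refine key n x hx ?_
  rw [div_lt_iff₀ hx₀] at hn
  rw [pow_succ]
  nlinarith [pow_pos (two_pos : (0 : ℝ) < 2) n]

variable {Ω : Type*} [MeasurableSpace Ω] {μ : Measure Ω} {v : Ω → ℝ} {α p q : ℝ} {ℓ : ℝ → ℝ}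

/-- The two-sided tail of `v`. -/
def tailSum (μ : Measure Ω) (v : Ω → ℝ) (x : ℝ) : ℝ :=
  μ.real {y | x < v y} + μ.real {y | v y ≤ -x}

theorem tailSum_nonneg (x : ℝ) : 0 ≤ tailSum μ v x :=
  add_nonneg measureReal_nonneg measureReal_nonneg

variable [IsProbabilityMeasure μ]

theorem tailSum_anti {x y : ℝ} (h : x ≤ y) : tailSum μ v y ≤ tailSum μ v x :=
  add_le_add (measureReal_mono fun z hz => lt_of_le_of_lt h hz)
    (measureReal_mono fun z (hz : v z ≤ -y) => hz.trans (neg_le_neg h))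

theorem measureReal_lt_abs_le_tailSum (x : ℝ) : μ.real {y | x < |v y|} ≤ tailSum μ v x := by
  refine (measureReal_mono fun y hy => ?_).trans (measureReal_union_le _ _)
  rcases lt_abs.1 (show x < |v y| from hy) with h | h
  · exact Or.inl h
  · exact Or.inr (show v y ≤ -x by linarith)

namespace HypH1

omit [IsProbabilityMeasure μ] in
theorem tendsto_tailSum (h : HypH1 μ v α p q ℓ) :
    Tendsto (fun x => tailSum μ v x / (ℓ x * x ^ (-α))) atTop (𝓝 1) := by
  obtain ⟨-, -, -, hpq, hp, hq⟩ := h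
  rw [← hpq]
  refine (hp.add hq).congr fun x => ?_
  rw [tailSum, add_div]

omit [IsProbabilityMeasure μ] in
theorem eventually_bounds (h : HypH1 μ v α p q ℓ) : ∀ᶠ x in atTop, 0 < ℓ x ∧
    ℓ x * x ^ (-α) / 2 ≤ tailSum μ v x ∧ tailSum μ v x ≤ 2 * (ℓ x * x ^ (-α)) := by
  filter_upwards [h.1.2.1, eventually_gt_atTop 0,
    h.tendsto_tailSum.eventually (lt_mem_nhds (by norm_num : (1 / 2 : ℝ) < 1)),
    h.tendsto_tailSum.eventually (gt_mem_nhds (by norm_num : (1 : ℝ) < 2))] with x hℓ hx h1 h2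
  have hpos : 0 < ℓ x * x ^ (-α) := mul_pos hℓ (Real.rpow_pos_of_pos hx _)
  rw [lt_div_iff₀ hpos] at h1
  rw [div_lt_iff₀ hpos] at h2
  exact ⟨hℓ, by linarith, h2.le⟩

omit [IsProbabilityMeasure μ] in
theorem eventually_pos (h : HypH1 μ v α p q ℓ) : ∀ᶠ x in atTop, 0 < tailSum μ v x := by
  filter_upwards [h.eventually_bounds, eventually_gt_atTop 0] with x hx hx0
  have := mul_pos hx.1 (Real.rpow_pos_of_pos hx0 (-α))
  linarith [hx.2.1]

omit [IsProbabilityMeasure μ] in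
theorem tendsto_ratio (h : HypH1 μ v α p q ℓ) :
    Tendsto (fun x => tailSum μ v (2 * x) / tailSum μ v x) atTop (𝓝 (2 ^ (-α))) := by
  have h2x : Tendsto (fun x : ℝ => 2 * x) atTop atTop := tendsto_id.const_mul_atTop two_pos
  have h1 := ((h.tendsto_tailSum.comp h2x).mul (h.1.2.2 2 two_pos)).mul
    ((h.tendsto_tailSum.inv₀ one_ne_zero).mul_const ((2 : ℝ) ^ (-α)))
  rw [inv_one, one_mul, one_mul, one_mul] at h1
  refine h1.congr' ?_
  filter_upwards [h.1.2.1, h2x.eventually h.1.2.1, eventually_gt_atTop 0, h.eventually_pos]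
    with x hℓ hℓ2 hx hG
  have hx' : 0 < x ^ (-α) := Real.rpow_pos_of_pos hx _
  have h2' : (0 : ℝ) < 2 ^ (-α) := Real.rpow_pos_of_pos two_pos _
  simp only [Function.comp_apply, Real.mul_rpow two_pos.le hx.le]
  field_simp

omit [IsProbabilityMeasure μ] in
theorem eventually_le_two_rpow_mul (h : HypH1 μ v α p q ℓ) {β : ℝ} (hβ : α < β) :
    ∀ᶠ x in atTop, tailSum μ v x ≤ 2 ^ β * tailSum μ v (2 * x) := by
  have h1 : (2 : ℝ) ^ (-β) < 2 ^ (-α) := Real.rpow_lt_rpow_of_exponent_lt one_lt_two (by linarith)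
  filter_upwards [h.tendsto_ratio.eventually (lt_mem_nhds h1), h.eventually_pos] with x hx hG
  rw [lt_div_iff₀ hG, Real.rpow_neg two_pos.le, inv_mul_lt_iff₀ (by positivity)] at hx
  exact hx.le

omit [IsProbabilityMeasure μ] in
theorem eventually_tailSum_two_mul_le (h : HypH1 μ v α p q ℓ) {β : ℝ} (hβ : β < α) :
    ∀ᶠ x in atTop, tailSum μ v (2 * x) ≤ 2 ^ (-β) * tailSum μ v x := by
  have h1 : (2 : ℝ) ^ (-α) < 2 ^ (-β) := Real.rpow_lt_rpow_of_exponent_lt one_lt_two (by linarith)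
  filter_upwards [h.tendsto_ratio.eventually (gt_mem_nhds h1), h.eventually_pos] with x hx hG
  rw [div_lt_iff₀ hG] at hx
  exact hx.le

end HypH1

theorem integrable_min_pow (hv : Measurable v) (n : ℕ) {X : ℝ} (hX : 0 ≤ X) :
    Integrable (fun y => min |v y| X ^ n) μ :=
  Integrable.of_bound ((hv.abs.min measurable_const).pow_const n).aestronglyMeasurable (X ^ n)
    (Eventually.of_forall fun y => by
      rw [norm_pow, Real.norm_of_nonneg (le_min (abs_nonneg _) hX)]
      exact pow_le_pow_left₀ (le_min (abs_nonneg _) hX) (min_le_right _ _) n)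

theorem integral_min_pow_le (n : ℕ) {X : ℝ} (hX : 0 ≤ X) :
    ∫ y, min |v y| X ^ n ∂μ ≤ X ^ n := by
  have h1 : ∀ᵐ y ∂μ, ‖min |v y| X ^ n‖ ≤ X ^ n := Eventually.of_forall fun y => by
    rw [norm_pow, Real.norm_of_nonneg (le_min (abs_nonneg _) hX)]
    exact pow_le_pow_left₀ (le_min (abs_nonneg _) hX) (min_le_right _ _) n
  have h2 := norm_integral_le_of_norm_le_const h1
  rw [probReal_univ, mul_one] at h2
  exact (le_abs_self _).trans h2

theorem integral_min_two_mul_pow_le (hv : Measurable v) (n : ℕ) {X : ℝ} (hX : 0 ≤ X) :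
    ∫ y, min |v y| (2 * X) ^ n ∂μ ≤ ∫ y, min |v y| X ^ n ∂μ + (2 * X) ^ n * tailSum μ v X := by
  have hm : MeasurableSet {y | X < |v y|} := measurableSet_lt measurable_const hv.abs
  have hi : Integrable ({y | X < |v y|}.indicator fun _ => (2 * X) ^ n) μ :=
    (integrable_const _).indicator hm
  calc ∫ y, min |v y| (2 * X) ^ n ∂μ
      ≤ ∫ y, (min |v y| X ^ n + {y | X < |v y|}.indicator (fun _ => (2 * X) ^ n) y) ∂μ := by
        refine integral_mono (integrable_min_pow hv n (by positivity))
          ((integrable_min_pow hv n hX).add hi) fun y => ?_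
        by_cases hy : X < |v y|
        · simp only [indicator_of_mem (show y ∈ {y | X < |v y|} from hy)]
          have h1 : min |v y| (2 * X) ^ n ≤ (2 * X) ^ n :=
            pow_le_pow_left₀ (le_min (abs_nonneg _) (by positivity)) (min_le_right _ _) n
          have h2 : 0 ≤ min |v y| X ^ n := pow_nonneg (le_min (abs_nonneg _) hX) n
          linarith
        · simp only [indicator_of_notMem (show y ∉ {y | X < |v y|} from hy), add_zero]
          rw [not_lt] at hy
          rw [min_eq_left hy, min_eq_left (by linarith)]
    _ = ∫ y, min |v y| X ^ n ∂μ + (2 * X) ^ n * μ.real {y | X < |v y|} := by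
        rw [integral_add (integrable_min_pow hv n hX) hi, integral_indicator hm,
          setIntegral_const, smul_eq_mul, mul_comm (μ.real _)]
    _ ≤ _ := by
        gcongr
        exact measureReal_lt_abs_le_tailSum X

namespace HypH1

/-- Truncated moments of order larger than the index. -/
theorem exists_integral_min_pow_le (h : HypH1 μ v α p q ℓ) (hv : Measurable v) {n : ℕ}
    (hn : α < n) : ∃ x₀ K : ℝ, 0 < x₀ ∧ 0 < K ∧ ∀ X, x₀ ≤ X →
      1 + ∫ y, min |v y| X ^ n ∂μ ≤ K * (X ^ n * tailSum μ v X) := by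
  obtain ⟨β, hαβ, hβn⟩ := exists_between hn
  obtain ⟨x₁, hx₁⟩ := eventually_atTop.1 ((h.eventually_le_two_rpow_mul hαβ).and h.eventually_pos)
  set x₀ := max x₁ 1 with hx₀
  have hx₀0 : 0 < x₀ := lt_max_of_lt_right one_pos
  have hx₀1 : ∀ x, x₀ ≤ x → x₁ ≤ x := fun x hx => (le_max_left _ _).trans hx
  set G := tailSum μ v
  have hG0 : 0 < G (2 * x₀) := (hx₁ _ (hx₀1 _ (by linarith))).2
  -- At each doubling `Xⁿ G(X)` grows at least by the factor `r = 2^{n-β} > 1`, while the truncated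
  -- moment gains at most `2ⁿ Xⁿ G(X)`. The recursion closes when `K + 2ⁿ ≤ K r`.
  set r : ℝ := 2 ^ (n : ℕ) / 2 ^ β with hr
  have hr1 : 1 < r := by
    rw [hr, one_lt_div (by positivity), ← Real.rpow_natCast]
    exact Real.rpow_lt_rpow_of_exponent_lt one_lt_two hβn
  set K := max ((1 + (2 * x₀) ^ n) / (x₀ ^ n * G (2 * x₀))) (2 ^ n / (r - 1)) with hK
  have hK0 : 0 < K := lt_max_of_lt_right (div_pos (by positivity) (by linarith))
  refine ⟨x₀, K, hx₀0, hK0, dyadic_induction hx₀0 (fun x h1 h2 => ?_) fun x h1 ih => ?_⟩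
  · have h3 : ∫ y, min |v y| x ^ n ∂μ ≤ (2 * x₀) ^ n :=
      (integral_min_pow_le n (hx₀0.le.trans h1)).trans
        (pow_le_pow_left₀ (hx₀0.le.trans h1) h2.le n)
    have h4 : x₀ ^ n * G (2 * x₀) ≤ x ^ n * G x :=
      mul_le_mul (pow_le_pow_left₀ hx₀0.le h1 n) (tailSum_anti h2.le) hG0.le
        (pow_nonneg (hx₀0.le.trans h1) n)
    have h5 : (1 + (2 * x₀) ^ n) ≤ K * (x₀ ^ n * G (2 * x₀)) := by
      rw [← div_le_iff₀ (by positivity)]; exact le_max_left _ _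
    calc _ ≤ 1 + (2 * x₀) ^ n := by linarith
      _ ≤ _ := h5
      _ ≤ _ := by gcongr
  · have hx0 : 0 ≤ x := hx₀0.le.trans h1
    have h3 := integral_min_two_mul_pow_le (μ := μ) hv n hx0
    have h4 : G x ≤ 2 ^ β * G (2 * x) := (hx₁ x (hx₀1 x h1)).1
    have h5 : K + 2 ^ n ≤ K * r := by
      have : 2 ^ n / (r - 1) ≤ K := le_max_right _ _
      rw [div_le_iff₀ (by linarith)] at this
      linarith
    have h6 : r * 2 ^ β = 2 ^ n := by rw [hr]; field_simp
    calc _ ≤ 1 + (∫ y, min |v y| x ^ n ∂μ + (2 * x) ^ n * G x) := by gcongr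
      _ ≤ K * (x ^ n * G x) + (2 * x) ^ n * G x := by linarith
      _ = (K + 2 ^ n) * (x ^ n * G x) := by rw [mul_pow]; ring
      _ ≤ K * r * (x ^ n * (2 ^ β * G (2 * x))) := by
          have := tailSum_nonneg (μ := μ) (v := v) x
          gcongr
      _ = K * ((2 * x) ^ n * G (2 * x)) := by rw [mul_pow, ← h6]; ring

/-- Tail moments of order smaller than the index. -/
theorem exists_lintegral_rpow_le (h : HypH1 μ v α p q ℓ) (hv : Measurable v) {γ : ℝ} (hγ0 : 0 < γ)
    (hγ : γ < α) : ∃ x₀ K : ℝ, 0 < x₀ ∧ 0 < K ∧ ∀ X, x₀ ≤ X →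
      ∫⁻ y in {y | X < |v y|}, ENNReal.ofReal (|v y| ^ γ) ∂μ ≤
        ENNReal.ofReal (K * (X ^ γ * tailSum μ v X)) := by
  obtain ⟨β, hγβ, hβα⟩ := exists_between hγ
  obtain ⟨x₁, hx₁⟩ := eventually_atTop.1 (h.eventually_tailSum_two_mul_le hβα)
  set x₀ := max x₁ 1 with hx₀
  have hx₀0 : 0 < x₀ := lt_max_of_lt_right one_pos
  set G := tailSum μ v
  set r : ℝ := 2 ^ (γ - β) with hr
  have hr0 : 0 < r := by positivity
  have hr1 : r < 1 := Real.rpow_lt_one_of_one_lt_of_neg one_lt_two (by linarith)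
  refine ⟨x₀, 2 ^ γ * (1 - r)⁻¹, hx₀0, mul_pos (by positivity) (inv_pos.2 (by linarith)),
    fun X hX => ?_⟩
  have hX0 : 0 < X := hx₀0.trans_le hX
  have hG : ∀ n : ℕ, G (2 ^ n * X) ≤ (2 ^ (-β)) ^ n * G X := by
    intro n
    induction n with
    | zero => simp
    | succ n ih =>
      have h1 : x₁ ≤ 2 ^ n * X := by
        have : 1 * X ≤ 2 ^ n * X := by gcongr; exact one_le_pow₀ one_le_two
        linarith [le_max_left x₁ 1]
      have h2 := hx₁ _ h1
      rw [show 2 * (2 ^ n * X) = 2 ^ (n + 1) * X by ring] at h2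
      calc _ ≤ _ := h2
        _ ≤ 2 ^ (-β) * ((2 ^ (-β)) ^ n * G X) := by gcongr
        _ = _ := by ring
  -- If `2^k X < |v y| ≤ 2^{k+1} X`, the `k`-th term alone dominates. In the integrated series the
  -- tails decay like `2^{-βn}` against the growth `2^{γn}`, which leaves a geometric series of
  -- ratio `r = 2^{γ-β} < 1`.
  have hpt : ∀ y, X < |v y| → ENNReal.ofReal (|v y| ^ γ) ≤
      ∑' n : ℕ, {y | 2 ^ n * X < |v y|}.indicator
        (fun _ => ENNReal.ofReal ((2 ^ (n + 1) * X) ^ γ)) y := by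
    intro y hy
    obtain ⟨m, hm⟩ := ((tendsto_pow_atTop_atTop_of_one_lt (one_lt_two : (1 : ℝ) < 2)).eventually
      (eventually_ge_atTop (|v y| / X))).exists
    rw [div_le_iff₀ hX0] at hm
    have hex : ∃ m : ℕ, |v y| ≤ 2 ^ m * X := ⟨m, hm⟩
    classical
    have hspec := Nat.find_spec hex
    have hne : Nat.find hex ≠ 0 := fun h0 => by
      rw [h0] at hspec; simp at hspec; linarith
    obtain ⟨k, hk⟩ := Nat.exists_eq_succ_of_ne_zero hne
    have hkl : 2 ^ k * X < |v y| := not_le.1 (Nat.find_min hex (by omega))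
    rw [hk] at hspec
    refine le_trans ?_ (ENNReal.le_tsum k)
    rw [indicator_of_mem (show y ∈ {y | 2 ^ k * X < |v y|} from hkl)]
    exact ENNReal.ofReal_le_ofReal (Real.rpow_le_rpow (abs_nonneg _) hspec hγ0.le)
  have hms : ∀ x, MeasurableSet {y | x < |v y|} := fun x =>
    measurableSet_lt measurable_const hv.abs
  have hterm : ∀ n : ℕ, ∫⁻ y, {y | 2 ^ n * X < |v y|}.indicator
      (fun _ => ENNReal.ofReal ((2 ^ (n + 1) * X) ^ γ)) y ∂μ ≤
      ENNReal.ofReal (2 ^ γ * (X ^ γ * G X) * r ^ n) := by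
    intro n
    rw [lintegral_indicator (hms _), setLIntegral_const, ← ofReal_measureReal,
      ← ENNReal.ofReal_mul (by positivity)]
    refine ENNReal.ofReal_le_ofReal ?_
    have e : (2 ^ (n + 1) * X) ^ γ * ((2 ^ (-β)) ^ n * G X) = 2 ^ γ * (X ^ γ * G X) * r ^ n := by
      rw [Real.mul_rpow (by positivity) hX0.le, hr, sub_eq_add_neg, Real.rpow_add two_pos, mul_pow,
        ← Real.rpow_natCast (2 ^ γ), ← Real.rpow_natCast 2 (n + 1), ← Real.rpow_mul two_pos.le,
        ← Real.rpow_mul two_pos.le, Nat.cast_add, Nat.cast_one, add_mul, Real.rpow_add two_pos,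
        one_mul, mul_comm γ]
      ring
    rw [← e]
    have h1 := (measureReal_lt_abs_le_tailSum (μ := μ) (v := v) (2 ^ n * X)).trans (hG n)
    gcongr
  calc ∫⁻ y in {y | X < |v y|}, ENNReal.ofReal (|v y| ^ γ) ∂μ
      ≤ ∫⁻ y in {y | X < |v y|}, ∑' n : ℕ, {y | 2 ^ n * X < |v y|}.indicator
        (fun _ => ENNReal.ofReal ((2 ^ (n + 1) * X) ^ γ)) y ∂μ :=
        setLIntegral_mono' (hms X) hpt
    _ ≤ ∫⁻ y, ∑' n : ℕ, {y | 2 ^ n * X < |v y|}.indicator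
        (fun _ => ENNReal.ofReal ((2 ^ (n + 1) * X) ^ γ)) y ∂μ := setLIntegral_le_lintegral _ _
    _ = ∑' n : ℕ, ∫⁻ y, {y | 2 ^ n * X < |v y|}.indicator
        (fun _ => ENNReal.ofReal ((2 ^ (n + 1) * X) ^ γ)) y ∂μ :=
        lintegral_tsum fun n => (measurable_const.indicator (hms _)).aemeasurable
    _ ≤ ∑' n : ℕ, ENNReal.ofReal (2 ^ γ * (X ^ γ * G X) * r ^ n) := ENNReal.tsum_le_tsum hterm
    _ = ENNReal.ofReal (2 ^ γ * (X ^ γ * G X) * (1 - r)⁻¹) := by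
        have hs := (hasSum_geometric_of_lt_one hr0.le hr1).mul_left (2 ^ γ * (X ^ γ * G X))
        have hG0 : 0 ≤ G X := tailSum_nonneg X
        rw [← ENNReal.ofReal_tsum_of_nonneg (fun n => by positivity) hs.summable, hs.tsum_eq]
    _ = _ := by congr 1; ring

theorem integrable_abs_rpow (h : HypH1 μ v α p q ℓ) (hv : Measurable v) {γ : ℝ} (hγ0 : 0 < γ)
    (hγ : γ < α) : Integrable (fun y => |v y| ^ γ) μ := by
  obtain ⟨x₀, K, hx₀, hK, hle⟩ := h.exists_lintegral_rpow_le hv hγ0 hγ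
  refine ⟨(hv.abs.pow_const γ).aestronglyMeasurable, ?_⟩
  rw [hasFiniteIntegral_iff_ofReal (Eventually.of_forall fun y => by positivity)]
  have hms : MeasurableSet {y | x₀ < |v y|} := measurableSet_lt measurable_const hv.abs
  rw [← lintegral_add_compl _ hms]
  refine ENNReal.add_lt_top.2 ⟨(hle x₀ le_rfl).trans_lt ENNReal.ofReal_lt_top, ?_⟩
  refine (setLIntegral_mono' (g := fun _ => ENNReal.ofReal (x₀ ^ γ)) hms.compl fun y hy => ?_).trans_lt
    ?_
  · exact ENNReal.ofReal_le_ofReal (Real.rpow_le_rpow (abs_nonneg _) (not_lt.1 hy) hγ0.le)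
  · rw [setLIntegral_const]
    exact ENNReal.mul_lt_top ENNReal.ofReal_lt_top (measure_lt_top _ _)

theorem integrable_abs (h : HypH1 μ v α p q ℓ) (hv : Measurable v) (hα : 1 < α) :
    Integrable (fun y => |v y|) μ := by
  simpa using h.integrable_abs_rpow hv one_pos hα

theorem exists_setIntegral_abs_le (h : HypH1 μ v α p q ℓ) (hv : Measurable v) (hα : 1 < α) :
    ∃ x₀ K : ℝ, 0 < x₀ ∧ 0 < K ∧ ∀ X, x₀ ≤ X →
      ∫ y in {y | X < |v y|}, |v y| ∂μ ≤ K * (X * tailSum μ v X) := by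
  obtain ⟨x₀, K, hx₀, hK, hle⟩ := h.exists_lintegral_rpow_le hv one_pos hα
  refine ⟨x₀, K, hx₀, hK, fun X hX => ?_⟩
  have h1 := hle X hX
  simp only [Real.rpow_one] at h1
  rw [integral_eq_lintegral_of_nonneg_ae (Eventually.of_forall fun y => abs_nonneg _)
    hv.abs.aestronglyMeasurable]
  refine ENNReal.toReal_le_of_le_ofReal ?_ h1
  have := tailSum_nonneg (μ := μ) (v := v) X
  have := hx₀.trans_le hX
  positivity

theorem integral_abs_mul_min_le (h : HypH1 μ v α p q ℓ) (hv : Measurable v) (hα : 1 < α) {X : ℝ}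
    (hX : 0 < X) : ∫ y, |v y| * min 1 (|v y| / X) ∂μ ≤
      X⁻¹ * ∫ y, min |v y| X ^ 2 ∂μ + ∫ y in {y | X < |v y|}, |v y| ∂μ := by
  have hms : MeasurableSet {y | X < |v y|} := measurableSet_lt measurable_const hv.abs
  have hi := h.integrable_abs hv hα
  rw [← integral_const_mul, ← integral_indicator hms, ← integral_add
    ((integrable_min_pow hv 2 hX.le).const_mul _) (hi.indicator hms)]
  refine integral_mono_of_nonneg (Eventually.of_forall fun y => ?_)
    (((integrable_min_pow hv 2 hX.le).const_mul _).add (hi.indicator hms))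
    (Eventually.of_forall fun y => ?_)
  · have : 0 ≤ min 1 (|v y| / X) := le_min zero_le_one (by positivity)
    exact mul_nonneg (abs_nonneg _) this
  · by_cases hy : X < |v y|
    · simp only [indicator_of_mem (show y ∈ {y | X < |v y|} from hy)]
      have h1 : |v y| * min 1 (|v y| / X) ≤ |v y| * 1 := by
        gcongr; exact min_le_left _ _
      have h2 : 0 ≤ X⁻¹ * min |v y| X ^ 2 := by positivity
      linarith
    · simp only [indicator_of_notMem (show y ∉ {y | X < |v y|} from hy), add_zero]
      rw [min_eq_left (not_lt.1 hy)]
      calc |v y| * min 1 (|v y| / X) ≤ |v y| * (|v y| / X) := by gcongr; exact min_le_right _ _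
        _ = _ := by ring

/-- At index `2`, the truncated second moments and the tails are dominated by `∫ ℓ(u)/u du`. -/
theorem exists_le_ellHat (h : HypH1 μ v 2 p q ℓ) (hv : Measurable v)
    (hv2 : ∫⁻ y, ENNReal.ofReal (v y ^ 2) ∂μ = ∞)
    (hℓ : ∀ x : ℝ, 1 ≤ x → IntervalIntegrable (fun u => ℓ u / u) volume 1 x) :
    ∃ x₁ K : ℝ, 0 < x₁ ∧ 0 < K ∧ ∀ X, x₁ ≤ X →
      1 + ∫ y, min |v y| X ^ 2 ∂μ + X ^ 2 * tailSum μ v X ≤ K * ellHat ℓ X := by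
  obtain ⟨x₂, hx₂⟩ := eventually_atTop.1 h.eventually_bounds
  set x₀ := max x₂ 1 with hx₀
  have hx₀1 : 1 ≤ x₀ := le_max_right _ _
  have hx₀2 : ∀ x, x₀ ≤ x → x₂ ≤ x := fun x hx => (le_max_left _ _).trans hx
  set G := tailSum μ v
  set f : ℝ → ℝ := fun u => ℓ u / u with hf
  have hint : ∀ a b, 1 ≤ a → 1 ≤ b → IntervalIntegrable f volume a b := fun a b ha hb =>
    (hℓ a ha).symm.trans (hℓ b hb)
  have hfpos : ∀ u, x₀ ≤ u → 0 ≤ f u := fun u hu =>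
    div_nonneg (hx₂ u (hx₀2 u hu)).1.le (by linarith)
  set J : ℝ → ℝ := fun x => ∫ u in x₀..x, f u with hJ
  have hJadd : ∀ x y, x₀ ≤ x → x ≤ y → J y = J x + ∫ u in x..y, f u := fun x y hx hxy =>
    (intervalIntegral.integral_add_adjacent_intervals (hint _ _ hx₀1 (by linarith))
      (hint _ _ (by linarith) (by linarith))).symm
  have hInonneg : ∀ x y, x₀ ≤ x → x ≤ y → 0 ≤ ∫ u in x..y, f u := fun x y hx hxy =>
    intervalIntegral.integral_nonneg hxy fun u hu => hfpos u (hx.trans hu.1)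
  -- On `[x, 2x]` the tail bound gives `ℓ(u)/u ≥ u G(u)/2 ≥ x G(2x)/2`; integration over length `x`
  -- yields the factor `8`.
  have hGJ : ∀ x, x₀ ≤ x → (2 * x) ^ 2 * G (2 * x) ≤ 8 * ∫ u in x..2 * x, f u := by
    intro x hx
    have hx0 : 0 < x := by linarith
    have h1 : ∫ u in x..2 * x, x * G (2 * x) / 2 ≤ ∫ u in x..2 * x, f u := by
      refine intervalIntegral.integral_mono_on (by linarith) (by simp)
        (hint _ _ (by linarith) (by linarith)) fun u hu => ?_
      have hu0 : 0 < u := hx0.trans_le hu.1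
      have hb := (hx₂ u (hx₀2 u (hx.trans hu.1))).2.2
      have hg : G (2 * x) ≤ G u := tailSum_anti hu.2
      have hG0 : 0 ≤ G (2 * x) := tailSum_nonneg _
      have e : ℓ u * u ^ (-2 : ℝ) = f u / u := by
        rw [Real.rpow_neg hu0.le, Real.rpow_two]
        simp only [hf]; field_simp
      rw [e] at hb
      have h2 : u * G (2 * x) ≤ 2 * f u := by
        calc u * G (2 * x) ≤ u * (2 * (f u / u)) := by gcongr; exact hg.trans hb
          _ = 2 * f u := by field_simp
      have h3 : x * G (2 * x) ≤ u * G (2 * x) := by gcongr; exact hu.1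
      linarith
    rw [intervalIntegral.integral_const, smul_eq_mul] at h1
    nlinarith
  -- Passing from truncation at `2X` to `4X` costs `4 (2X)² G(2X)`, at most 32 times the increment
  -- of `J` on `[X, 2X]`. Truncating at twice the argument of `J` aligns the two increments.
  have hMle : ∀ X, x₀ ≤ X →
      ∫ y, min |v y| (2 * X) ^ 2 ∂μ ≤ (4 * x₀) ^ 2 + 32 * J X := by
    refine dyadic_induction (by linarith) (fun x h1 h2 => ?_) fun x h1 ih => ?_
    · refine (integral_min_pow_le 2 (by linarith)).trans ?_
      have h3 : 0 ≤ J x := hInonneg _ _ le_rfl h1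
      have h4 : (2 * x) ^ 2 ≤ (4 * x₀) ^ 2 := pow_le_pow_left₀ (by linarith) (by linarith) 2
      linarith
    · have h3 := integral_min_two_mul_pow_le (μ := μ) hv 2 (X := 2 * x) (by linarith)
      have h4 := hGJ x h1
      rw [hJadd x (2 * x) h1 (by linarith)]
      have e : (2 * (2 * x)) ^ 2 * G (2 * x) = 4 * ((2 * x) ^ 2 * G (2 * x)) := by ring
      rw [e] at h3
      linarith
  have hJmono : ∀ x y, x₀ ≤ x → x ≤ y → J x ≤ J y := fun x y hx hxy => by
    rw [hJadd x y hx hxy]; linarith [hInonneg x y hx hxy]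
  -- If `J` stayed bounded, so would the truncated second moments, and by Fatou's lemma `v²` would
  -- be integrable.
  have hJtop : ∀ b : ℝ, ∃ x, x₀ ≤ x ∧ b ≤ J x := by
    intro b
    by_contra! hcon
    have hbd : ∀ n : ℕ, ∫⁻ y, ENNReal.ofReal (min |v y| (2 * (x₀ + n)) ^ 2) ∂μ ≤
        ENNReal.ofReal ((4 * x₀) ^ 2 + 32 * b) := by
      intro n
      have hn : (0 : ℝ) ≤ n := Nat.cast_nonneg n
      rw [← ofReal_integral_eq_lintegral_ofReal (integrable_min_pow hv 2 (by linarith))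
        (Eventually.of_forall fun y => sq_nonneg _)]
      refine ENNReal.ofReal_le_ofReal ((hMle _ (by linarith)).trans ?_)
      linarith [hcon (x₀ + n) (by linarith)]
    have hlim : ∀ y, Tendsto (fun n : ℕ => ENNReal.ofReal (min |v y| (2 * (x₀ + n)) ^ 2)) atTop
        (𝓝 (ENNReal.ofReal (v y ^ 2))) := by
      intro y
      refine tendsto_const_nhds.congr' ?_
      filter_upwards [eventually_ge_atTop ⌈|v y|⌉₊] with n hn
      have h1 : |v y| ≤ n := (Nat.le_ceil _).trans (by exact_mod_cast hn)
      rw [min_eq_left (by linarith [(Nat.cast_nonneg n : (0 : ℝ) ≤ n)]), sq_abs]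
    have h1 : ∫⁻ y, ENNReal.ofReal (v y ^ 2) ∂μ ≤ ENNReal.ofReal ((4 * x₀) ^ 2 + 32 * b) := by
      calc ∫⁻ y, ENNReal.ofReal (v y ^ 2) ∂μ
          = ∫⁻ y, liminf (fun n : ℕ => ENNReal.ofReal (min |v y| (2 * (x₀ + n)) ^ 2)) atTop ∂μ :=
            lintegral_congr fun y => (hlim y).liminf_eq.symm
        _ ≤ liminf (fun n : ℕ => ∫⁻ y, ENNReal.ofReal (min |v y| (2 * (x₀ + n)) ^ 2) ∂μ) atTop :=
            lintegral_liminf_le fun n =>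
              ((hv.abs.min measurable_const).pow_const 2).ennreal_ofReal
        _ ≤ _ := liminf_le_of_frequently_le' (Frequently.of_forall hbd)
    rw [hv2] at h1
    exact absurd h1 (by simp)
  -- Below `x₀` nothing is known about the sign or size of `ℓ`, so this part of `ellHat` is an
  -- uncontrolled constant. It is absorbed by `J`, which tends to infinity.
  set c₀ := 1 + ∫ u in (1 : ℝ)..x₀, f u with hc₀
  obtain ⟨x₃, hx₃, hx₃J⟩ := hJtop (2 * |c₀| + 1)
  set A := (4 * x₀) ^ 2 + 1 with hA
  have hA0 : 0 < A := by positivity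
  refine ⟨2 * x₃, 2 * (A + 40), by linarith, by linarith, fun X hX => ?_⟩
  have hX₀ : x₀ ≤ X / 2 := by linarith
  have hXJ : 2 * |c₀| + 1 ≤ J X := hx₃J.trans (hJmono _ _ hx₃ (by linarith))
  have h1 := hMle (X / 2) hX₀
  have h2 := hGJ (X / 2) hX₀
  rw [mul_div_cancel₀ X two_ne_zero] at h1 h2
  have h3 := hJadd (X / 2) X hX₀ (by linarith)
  have h4 := hInonneg (X / 2) X hX₀ (by linarith)
  have h5 : 0 ≤ J (X / 2) := hInonneg _ _ le_rfl hX₀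
  have h6 : ellHat ℓ X = c₀ + J X + ∫ u in X..(1 + X), f u := by
    rw [ellHat, hc₀, hJ]
    rw [add_assoc, add_assoc, intervalIntegral.integral_add_adjacent_intervals
      (hint _ _ hx₀1 (by linarith)) (hint _ _ (by linarith) (by linarith)),
      intervalIntegral.integral_add_adjacent_intervals
      (hint _ _ le_rfl (by linarith)) (hint _ _ (by linarith) (by linarith))]
  have h7 := hInonneg X (1 + X) (by linarith) (by linarith)
  have h8 : J X / 2 ≤ ellHat ℓ X := by
    rw [h6]; linarith [neg_abs_le c₀]
  have h9 : 1 ≤ J X := by linarith [abs_nonneg c₀]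
  calc _ ≤ A + 40 * J X := by linarith
    _ ≤ (A + 40) * J X := by nlinarith
    _ ≤ _ := by nlinarith

/-- The modulus of continuity for `α < 1`. -/
theorem exists_integral_min_le (h : HypH1 μ v α p q ℓ) (hv : Measurable v) (hα : α < 1) :
    ∃ ε C : ℝ, 0 < ε ∧ 0 < C ∧ ∀ s : ℝ, 0 < s → s < ε →
      s + ∫ y, min 1 (s * |v y|) ∂μ ≤ C * (s ^ α * ℓ (1 / s)) := by
  obtain ⟨x₀, K, hx₀, hK, hle⟩ := h.exists_integral_min_pow_le hv (n := 1) (by simpa using hα)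
  obtain ⟨x₁, hx₁⟩ := eventually_atTop.1 h.eventually_bounds
  refine ⟨(max x₀ x₁)⁻¹, 2 * K, inv_pos.2 (lt_max_of_lt_left hx₀), by positivity,
    fun s hs hsε => ?_⟩
  -- The truncation level is `X = 1/s`, since `min 1 (s|v|) = s · min |v| (1/s)`.
  have hX : max x₀ x₁ ≤ 1 / s := by
    rw [one_div]
    exact ((lt_inv_comm₀ (lt_max_of_lt_left hx₀) hs).2 hsε).le
  have h1 := hle (1 / s) ((le_max_left _ _).trans hX)
  have h2 := (hx₁ (1 / s) ((le_max_right _ _).trans hX)).2.2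
  have hpow : (1 / s) ^ (-α) = s ^ α := by
    rw [one_div, Real.rpow_neg (inv_nonneg.2 hs.le), Real.inv_rpow hs.le, inv_inv]
  rw [hpow] at h2
  simp only [pow_one] at h1
  have e : ∫ y, min 1 (s * |v y|) ∂μ = s * ∫ y, min |v y| (1 / s) ∂μ := by
    rw [← integral_const_mul]
    congr 1; ext y
    rw [mul_min_of_nonneg _ _ hs.le, mul_one_div_cancel hs.ne', min_comm]
  rw [e]
  calc s + s * ∫ y, min |v y| (1 / s) ∂μ = s * (1 + ∫ y, min |v y| (1 / s) ∂μ) := by ring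
    _ ≤ s * (K * (1 / s * tailSum μ v (1 / s))) := by gcongr
    _ = K * tailSum μ v (1 / s) := by field_simp
    _ ≤ K * (2 * (ℓ (1 / s) * s ^ α)) := by gcongr
    _ = _ := by ring

/-- The modulus of continuity of the derivative for `1 < α ≤ 2`. -/
theorem exists_integral_abs_mul_min_le (h : HypH1 μ v α p q ℓ) (hv : Measurable v) (hα : 1 < α)
    (hα2 : α ≤ 2) (hv2 : ∫⁻ y, ENNReal.ofReal (v y ^ 2) ∂μ = ∞)
    (hℓ : α = 2 → ∀ x : ℝ, 1 ≤ x → IntervalIntegrable (fun u => ℓ u / u) volume 1 x) :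
    ∃ ε C : ℝ, 0 < ε ∧ 0 < C ∧ ∀ s : ℝ, 0 < s → s < ε →
      s + ∫ y, |v y| * min 1 (s * |v y|) ∂μ ≤ C * (s ^ (α - 1) * ellZero α ℓ (1 / s)) := by
  obtain ⟨x₀, K, hx₀, hK, hle⟩ := h.exists_setIntegral_abs_le hv hα
  have key : ∃ x₁ C : ℝ, 0 < x₁ ∧ 0 < C ∧ ∀ X, x₁ ≤ X →
      X⁻¹ * (1 + ∫ y, min |v y| X ^ 2 ∂μ) + K * (X * tailSum μ v X) ≤
        C * (X⁻¹ ^ (α - 1) * ellZero α ℓ X) := by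
    rcases eq_or_ne α 2 with rfl | hne
    · obtain ⟨x₁, C, hx₁, hC, hbd⟩ := h.exists_le_ellHat hv hv2 (hℓ rfl)
      refine ⟨x₁, (1 + K) * C, hx₁, by positivity, fun X hX => ?_⟩
      have hX0 : 0 < X := hx₁.trans_le hX
      have hb := hbd X hX
      have hM0 : 0 ≤ ∫ y, min |v y| X ^ 2 ∂μ := integral_nonneg fun y => sq_nonneg _
      have hG0 : 0 ≤ X ^ 2 * tailSum μ v X := mul_nonneg (sq_nonneg _) (tailSum_nonneg _)
      rw [show (2 : ℝ) - 1 = 1 by norm_num, Real.rpow_one, ellZero, if_pos rfl]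
      have e : K * (X * tailSum μ v X) = X⁻¹ * (K * (X ^ 2 * tailSum μ v X)) := by field_simp
      rw [e, ← mul_add]
      calc _ ≤ X⁻¹ * ((1 + K) * (C * ellHat ℓ X)) := by
            gcongr
            nlinarith
        _ = _ := by ring
    · have hlt : α < 2 := lt_of_le_of_ne hα2 hne
      obtain ⟨x₁, K', hx₁, hK', hbd⟩ := h.exists_integral_min_pow_le hv (n := 2) (by simpa using hlt)
      obtain ⟨x₂, hx₂⟩ := eventually_atTop.1 h.eventually_bounds
      refine ⟨max x₁ x₂, 2 * (K' + K), lt_max_of_lt_left hx₁, by positivity, fun X hX => ?_⟩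
      have hX0 : 0 < X := hx₁.trans_le ((le_max_left _ _).trans hX)
      have h1 := hbd X ((le_max_left _ _).trans hX)
      have h2 := (hx₂ X ((le_max_right _ _).trans hX)).2.2
      rw [ellZero, if_neg hne]
      have e : X * X ^ (-α) = X⁻¹ ^ (α - 1) := by
        rw [Real.inv_rpow hX0.le, ← Real.rpow_neg hX0.le, neg_sub, sub_eq_add_neg,
          Real.rpow_add hX0, Real.rpow_one]
      rw [← e]
      calc _ ≤ X⁻¹ * (K' * (X ^ 2 * tailSum μ v X)) + K * (X * tailSum μ v X) := by gcongr
        _ = (K' + K) * X * tailSum μ v X := by field_simp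
        _ ≤ (K' + K) * X * (2 * (ℓ X * X ^ (-α))) := by gcongr
        _ = _ := by ring
  obtain ⟨x₁, C, hx₁, hC, hbd⟩ := key
  refine ⟨(max x₀ x₁)⁻¹, C, inv_pos.2 (lt_max_of_lt_left hx₀), hC, fun s hs hsε => ?_⟩
  have hX : max x₀ x₁ ≤ 1 / s := by
    rw [one_div]
    exact ((lt_inv_comm₀ (lt_max_of_lt_left hx₀) hs).2 hsε).le
  have h1 := h.integral_abs_mul_min_le hv hα (X := 1 / s) (by positivity)
  have h2 := hle (1 / s) ((le_max_left _ _).trans hX)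
  have h3 := hbd (1 / s) ((le_max_right _ _).trans hX)
  have e : ∀ y, |v y| / (1 / s) = s * |v y| := fun y => by field_simp
  simp only [e] at h1
  rw [one_div] at h1 h2 h3
  rw [inv_inv] at h1 h3
  rw [one_div]
  calc _ ≤ s * (1 + ∫ y, min |v y| s⁻¹ ^ 2 ∂μ) + K * (s⁻¹ * tailSum μ v s⁻¹) := by linarith
    _ ≤ _ := h3

end HypH1

end Tails
end

noncomputable section

/-! ### Smoothness of the perturbed transfer operators -/

section Characters

/-- The character `x ↦ e^{itx}`. -/
def character (t x : ℝ) : ℂ := Complex.exp (Complex.I * (t * x))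

/-- Twice the truncation of `s ↦ |h| s` at `1`. -/
def truncatedLinear (h s : ℝ) : ℝ := 2 * min 1 (|h| * s)

theorem character_add (t h x : ℝ) : character (t + h) x = character t x * character h x := by
  rw [character, character, character, ← Complex.exp_add]
  push_cast; ring_nf

theorem norm_character (t x : ℝ) : ‖character t x‖ = 1 := by
  rw [character, ← Complex.ofReal_mul, Complex.norm_exp_I_mul_ofReal]

theorem hasDerivAt_character (t x : ℝ) :
    HasDerivAt (character t) (Complex.I * t * character t x) x := by
  have h1 : HasDerivAt (fun y : ℝ => Complex.I * ((t : ℂ) * (y : ℂ))) (Complex.I * (t * 1)) x :=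
    ((Complex.ofRealCLM.hasDerivAt (x := x)).const_mul (t : ℂ)).const_mul Complex.I
  exact h1.cexp.congr_deriv (by simp only [character]; ring)

theorem truncatedLinear_nonneg (h : ℝ) {s : ℝ} (hs : 0 ≤ s) : 0 ≤ truncatedLinear h s :=
  mul_nonneg two_pos.le (le_min zero_le_one (by positivity))

theorem truncatedLinear_mono (h : ℝ) {s r : ℝ} (hsr : s ≤ r) :
    truncatedLinear h s ≤ truncatedLinear h r := by
  unfold truncatedLinear; gcongr

theorem truncatedLinear_le_two (h s : ℝ) : truncatedLinear h s ≤ 2 := by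
  unfold truncatedLinear
  linarith [min_le_left 1 (|h| * s)]

theorem norm_character_sub_one_le_mul (h x : ℝ) : ‖character h x - 1‖ ≤ |h| * |x| := by
  have := Real.norm_exp_I_mul_ofReal_sub_one_le (x := h * x)
  rwa [Complex.ofReal_mul, Real.norm_eq_abs, abs_mul] at this

theorem norm_character_sub_one_le (h x : ℝ) : ‖character h x - 1‖ ≤ truncatedLinear h |x| := by
  have h1 := norm_character_sub_one_le_mul h x
  have h2 : ‖character h x - 1‖ ≤ 2 := by
    refine (norm_sub_le _ _).trans ?_
    rw [norm_character, norm_one]; norm_num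
  rw [truncatedLinear]
  rcases min_cases 1 (|h| * |x|) with ⟨he, _⟩ | ⟨he, _⟩ <;> rw [he]
  · linarith
  · linarith [norm_nonneg (character h x - 1)]

/-- For `|hx| ≤ 1` this is the second order Taylor bound. For `|hx| ≥ 1` the truncation equals `2`
and the triangle inequality suffices. A quadratic bound would be useless, since `v²` is not
integrable. -/
theorem norm_character_sub_one_sub_le (h x : ℝ) :
    ‖character h x - 1 - Complex.I * (h * x)‖ ≤ |h| * |x| * truncatedLinear h |x| := by
  have hn : ‖Complex.I * ((h : ℂ) * x)‖ = |h| * |x| := by simp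
  rcases le_total (|h| * |x|) 1 with hle | hge
  · have h1 := Complex.norm_exp_sub_one_sub_id_le (x := Complex.I * ((h : ℂ) * x)) (by rwa [hn])
    rw [hn] at h1
    rw [truncatedLinear, min_eq_right hle]
    refine h1.trans ?_
    nlinarith [sq_nonneg (|h| * |x|)]
  · rw [truncatedLinear, min_eq_left hge, mul_one]
    refine (norm_sub_le _ _).trans ?_
    rw [hn]
    linarith [norm_character_sub_one_le_mul h x]

theorem norm_character_add_sub_le (t h x : ℝ) :
    ‖character (t + h) x - character t x‖ ≤ truncatedLinear h |x| := by
  rw [character_add, ← mul_sub_one, norm_mul, norm_character, one_mul]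
  exact norm_character_sub_one_le h x

end Characters

section MultiplierOperators

variable {μ : Measure ℝ} {T v : ℝ → ℝ} {F F' : ℝ → ℂ} {a : ℝ → ℝ} {A A' : BV μ →L[ℂ] BV μ}
  {V₁ C₀ : ℝ}

/-- `A` is the composition of the transfer operator with multiplication by `F ∘ v`. -/
def IsMultiplierOperator (μ : Measure ℝ) (T v : ℝ → ℝ) (F : ℝ → ℂ) (A : BV μ →L[ℂ] BV μ) : Prop :=
  ∀ φ, IsTransferOf μ T (fun x => F (v x) * (BV.incl μ φ : ℝ → ℂ) x) (BV.incl μ (A φ))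

/-- The operators defined by multipliers exist, with explicit bounds. -/
def HasMultiplierBound (μ : Measure ℝ) (T v : ℝ → ℝ) (V₁ C₀ : ℝ) : Prop :=
  ∀ (F F' : ℝ → ℂ) (a : ℝ → ℝ),
    (∀ x, HasDerivAt F (F' x) x) → (∀ x, ‖F x‖ ≤ a |x|) → (∀ x, ‖F' x‖ ≤ a |x|) →
    (∀ x y, 0 ≤ x → x ≤ y → a x ≤ a y) → Integrable (fun x => a (|v x| + V₁)) μ →
    ∃ A : BV μ →L[ℂ] BV μ, IsMultiplierOperator μ T v F A ∧ ‖A‖ ≤ C₀ * ∫ x, a (|v x| + V₁) ∂μ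

namespace IsMultiplierOperator

theorem unique (h : IsMultiplierOperator μ T v F A) (h' : IsMultiplierOperator μ T v F A') :
    A = A' :=
  ContinuousLinearMap.ext fun φ => BV.ext_ae ((h φ).unique (h' φ))

theorem const_smul (c : ℂ) (h : IsMultiplierOperator μ T v F A) :
    IsMultiplierOperator μ T v (fun x => c * F x) (c • A) := fun φ => by
  refine ((h φ).const_mul c).congr (Eventually.of_forall fun x => (mul_assoc _ _ _).symm) ?_
  rw [smul_apply, map_smul]
  exact (Lp.coeFn_smul c (BV.incl μ (A φ))).symm

theorem sub (hT : Measurable T) {G : ℝ → ℂ} (hF : Integrable (fun x => F (v x)) μ)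
    (hG : Integrable (fun x => G (v x)) μ) (h : IsMultiplierOperator μ T v F A)
    (h' : IsMultiplierOperator μ T v G A') :
    IsMultiplierOperator μ T v (fun x => F x - G x) (A - A') := fun φ => by
  refine ((h φ).add hT (BV.integrable_mul hF φ) ((BV.integrable_mul hG φ).const_mul (-1))
    ((h' φ).const_mul (-1))).congr (Eventually.of_forall fun x => by simp only; ring) ?_
  rw [sub_apply, map_sub]
  filter_upwards [Lp.coeFn_sub (BV.incl μ (A φ)) (BV.incl μ (A' φ))] with x hx
  rw [hx, Pi.sub_apply]; ring

/-- Uniqueness identifies the given operator with the one the bound produces, so sums and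
differences of the `R t` inherit the estimate of their own multiplier and not merely the sum of
separate ones. -/
theorem norm_le (hb : HasMultiplierBound μ T v V₁ C₀) (h : IsMultiplierOperator μ T v F A)
    (hF : ∀ x, HasDerivAt F (F' x) x) (hFa : ∀ x, ‖F x‖ ≤ a |x|) (hF'a : ∀ x, ‖F' x‖ ≤ a |x|)
    (ha : ∀ x y, 0 ≤ x → x ≤ y → a x ≤ a y) (hint : Integrable (fun x => a (|v x| + V₁)) μ) :
    ‖A‖ ≤ C₀ * ∫ x, a (|v x| + V₁) ∂μ := by
  obtain ⟨A', hA', hle⟩ := hb F F' a hF hFa hF'a ha hint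
  rwa [h.unique hA']

end IsMultiplierOperator

variable [IsProbabilityMeasure μ]

theorem measurable_character (t : ℝ) : Measurable (character t) :=
  (continuous_iff_continuousAt.2 fun x => (hasDerivAt_character t x).continuousAt).measurable

theorem integrable_character_comp (hv : Measurable v) (t : ℝ) :
    Integrable (fun x => character t (v x)) μ :=
  Integrable.of_bound ((measurable_character t).comp hv).aestronglyMeasurable 1
    (Eventually.of_forall fun _ => (norm_character t _).le)

omit [IsProbabilityMeasure μ] in
theorem integrable_mul_character_comp (hv : Measurable v) (hvi : Integrable (fun x => |v x|) μ)
    (t : ℝ) : Integrable (fun x => Complex.I * (v x) * character t (v x)) μ :=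
  hvi.mono' (((Complex.measurable_ofReal.comp hv).const_mul Complex.I).mul
    ((measurable_character t).comp hv)).aestronglyMeasurable
    (Eventually.of_forall fun x => by
      rw [norm_mul, norm_character, norm_mul, Complex.norm_I, Complex.norm_real]; simp)

theorem hasDerivAt_mul_character (t x : ℝ) :
    HasDerivAt (fun x : ℝ => Complex.I * x * character t x)
      (Complex.I * character t x + Complex.I * x * (Complex.I * t * character t x)) x := by
  have h1 : HasDerivAt (fun x : ℝ => Complex.I * (x : ℂ)) (Complex.I * 1) x :=
    (Complex.ofRealCLM.hasDerivAt (x := x)).const_mul Complex.I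
  simpa using h1.fun_mul (hasDerivAt_character t x)

theorem measurable_truncatedLinear_comp (h : ℝ) {w : ℝ → ℝ} (hw : Measurable w) :
    Measurable fun x => truncatedLinear h (w x) :=
  (measurable_const.min (hw.const_mul _)).const_mul _

namespace HasMultiplierBound

variable (hb : HasMultiplierBound μ T v V₁ C₀) (hT : Measurable T) (hv : Measurable v)
  (hV₁ : 0 ≤ V₁) (hC₀ : 0 ≤ C₀) {t h : ℝ}
include hb

theorem exists_character (t : ℝ) : ∃ A, IsMultiplierOperator μ T v (character t) A ∧
    ‖A‖ ≤ C₀ * (1 + |t|) := by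
  obtain ⟨A, hA, hle⟩ := hb (character t) _ (fun _ => 1 + |t|) (hasDerivAt_character t)
    (fun x => by rw [norm_character]; linarith [abs_nonneg t])
    (fun x => by
      rw [norm_mul, norm_character, norm_mul, Complex.norm_I, Complex.norm_real, Real.norm_eq_abs]
      linarith) (fun _ _ _ _ => le_rfl) (integrable_const _)
  exact ⟨A, hA, by simpa using hle⟩

theorem exists_mul_character (hvi : Integrable (fun x => |v x|) μ) (t : ℝ) :
    ∃ A, IsMultiplierOperator μ T v (fun x => Complex.I * x * character t x) A ∧
      ‖A‖ ≤ C₀ * ((1 + |t|) * ∫ x, (1 + (|v x| + V₁)) ∂μ) := by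
  obtain ⟨A, hA, hle⟩ := hb (fun x => Complex.I * x * character t x) _
    (fun s => (1 + |t|) * (1 + s)) (hasDerivAt_mul_character t)
    (fun x => by
      rw [norm_mul, norm_character, norm_mul, Complex.norm_I, Complex.norm_real, Real.norm_eq_abs]
      nlinarith [abs_nonneg t, abs_nonneg x, mul_nonneg (abs_nonneg t) (abs_nonneg x)])
    (fun x => by
      refine (norm_add_le _ _).trans ?_
      simp only [norm_mul, norm_character, Complex.norm_I, Complex.norm_real, Real.norm_eq_abs]
      nlinarith [abs_nonneg t, abs_nonneg x, mul_nonneg (abs_nonneg t) (abs_nonneg x)])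
    (fun x y hx hxy => by gcongr)
    (((integrable_const _).add (hvi.add (integrable_const _))).const_mul _)
  rw [integral_const_mul] at hle
  exact ⟨A, hA, hle⟩

variable {R R' : ℝ → BV μ →L[ℂ] BV μ} (hR : ∀ t, IsMultiplierOperator μ T v (character t) (R t))
  (hR' : ∀ t, IsMultiplierOperator μ T v (fun x => Complex.I * x * character t x) (R' t))
include hT hv hV₁

-- For `|t| ≤ 1` the derivative in `x` of the multiplier `e^{i(t+h)x} - e^{itx}` is bounded like the
-- multiplier itself, up to an extra `|h|`; this gives the choice of `a`.
include hR in
theorem norm_sub_le (ht : |t| ≤ 1) :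
    ‖R (t + h) - R t‖ ≤ C₀ * ∫ x, (truncatedLinear h (|v x| + V₁) + |h|) ∂μ := by
  refine ((hR (t + h)).sub hT (integrable_character_comp hv _) (integrable_character_comp hv _)
    (hR t)).norm_le hb (a := fun s => truncatedLinear h s + |h|)
    (fun x => (hasDerivAt_character (t + h) x).sub (hasDerivAt_character t x))
    (fun x => ?_) (fun x => ?_) (fun x y _ hxy => ?_) ?_
  · exact (norm_character_add_sub_le t h x).trans (by linarith [abs_nonneg h])
  · have e : Complex.I * ((t + h : ℝ) : ℂ) * character (t + h) x - Complex.I * t * character t x =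
        Complex.I * t * (character (t + h) x - character t x) +
          Complex.I * h * character (t + h) x := by push_cast; ring
    rw [e]
    refine (norm_add_le _ _).trans ?_
    simp only [norm_mul, norm_character, Complex.norm_I, Complex.norm_real, Real.norm_eq_abs]
    have h1 := norm_character_add_sub_le t h x
    nlinarith [norm_nonneg (character (t + h) x - character t x)]
  · have := truncatedLinear_mono h hxy
    linarith
  · refine Integrable.of_bound ((measurable_truncatedLinear_comp h
      (hv.abs.add_const V₁)).add_const _).aestronglyMeasurable (2 + |h|)
      (Eventually.of_forall fun x => ?_)
    have h1 := truncatedLinear_le_two h (|v x| + V₁)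
    have h2 := truncatedLinear_nonneg h (s := |v x| + V₁) (by positivity)
    rw [Real.norm_of_nonneg (by positivity)]
    linarith

include hR hR' in
theorem norm_sub_sub_smul_le (hvi : Integrable (fun x => |v x|) μ) (ht : |t| ≤ 1) :
    ‖R (t + h) - R t - h • R' t‖ ≤
      C₀ * (|h| * ∫ x, (|v x| + V₁ + 1) * truncatedLinear h (|v x| + V₁) ∂μ) := by
  rw [← integral_const_mul]
  have hop : IsMultiplierOperator μ T v
      (fun x => character (t + h) x - character t x - h * (Complex.I * x * character t x))
      (R (t + h) - R t - h • R' t) := by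
    rw [← Complex.coe_smul]
    exact IsMultiplierOperator.sub (v := v) (F := fun x => character (t + h) x - character t x)
      (G := fun x => h * (Complex.I * x * character t x)) hT
      ((integrable_character_comp hv _).sub (integrable_character_comp hv _))
      ((integrable_mul_character_comp hv hvi t).const_mul (h : ℂ))
      ((hR (t + h)).sub hT (integrable_character_comp hv _) (integrable_character_comp hv _) (hR t))
      ((hR' t).const_smul (h : ℂ))
  refine hop.norm_le hb (a := fun s => |h| * ((s + 1) * truncatedLinear h s))
    (fun x => ((hasDerivAt_character (t + h) x).fun_sub (hasDerivAt_character t x)).fun_sub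
      ((hasDerivAt_mul_character t x).const_mul (h : ℂ)))
    (fun x => ?_) (fun x => ?_) (fun x y hx hxy => ?_) ?_
  · have e : character (t + h) x - character t x - h * (Complex.I * x * character t x) =
        character t x * (character h x - 1 - Complex.I * (h * x)) := by
      rw [character_add]; ring
    rw [e, norm_mul, norm_character, one_mul]
    refine (norm_character_sub_one_sub_le h x).trans ?_
    have := truncatedLinear_nonneg h (abs_nonneg x)
    rw [mul_assoc]
    gcongr; linarith
  · have e : Complex.I * ((t + h : ℝ) : ℂ) * character (t + h) x - Complex.I * t * character t x -
        h * (Complex.I * character t x + Complex.I * x * (Complex.I * t * character t x)) =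
        Complex.I * t * character t x * (character h x - 1 - Complex.I * (h * x)) +
          Complex.I * h * character t x * (character h x - 1) := by
      rw [character_add]; push_cast; ring
    rw [e]
    refine (norm_add_le _ _).trans ?_
    simp only [norm_mul, norm_character, Complex.norm_I, Complex.norm_real, Real.norm_eq_abs,
      one_mul, mul_one]
    have h1 := norm_character_sub_one_sub_le h x
    have h2 := norm_character_sub_one_le h x
    calc _ ≤ 1 * (|h| * |x| * truncatedLinear h |x|) + |h| * truncatedLinear h |x| := by gcongr
      _ = _ := by ring
  · have h1 := truncatedLinear_mono h hxy
    have h2 := truncatedLinear_nonneg h hx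
    gcongr
    linarith
  · have hw : Measurable fun x => |v x| + V₁ := hv.abs.add_const V₁
    refine Integrable.mono' (((hvi.add (integrable_const (V₁ + 1))).const_mul (|h| * 2)))
      (((hw.add_const 1).mul (measurable_truncatedLinear_comp h hw)).const_mul
        _).aestronglyMeasurable (Eventually.of_forall fun x => ?_)
    have h1 := truncatedLinear_le_two h (|v x| + V₁)
    have h2 := truncatedLinear_nonneg h (s := |v x| + V₁) (by positivity)
    rw [Real.norm_of_nonneg (by positivity)]
    calc _ ≤ |h| * ((|v x| + V₁ + 1) * 2) := by gcongr
      _ = _ := by simp only [Pi.add_apply]; ring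

-- Here the multiplier is the increment in `t` of `ixe^{itx}`. The function `a` is linear growth
-- times truncation, plus a term of order `|h|` for differentiating in `x`; a first moment of `v`
-- makes it integrable.
include hR' in
theorem norm_deriv_sub_le (hvi : Integrable (fun x => |v x|) μ) (ht : |t| ≤ 1) :
    ‖R' (t + h) - R' t‖ ≤ C₀ * ∫ x, ((1 + (|v x| + V₁)) * truncatedLinear h (|v x| + V₁) +
      |h| * (|v x| + V₁)) ∂μ := by
  refine ((hR' (t + h)).sub hT (integrable_mul_character_comp hv hvi _)
    (integrable_mul_character_comp hv hvi _) (hR' t)).norm_le hb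
    (a := fun s => (1 + s) * truncatedLinear h s + |h| * s)
    (fun x => (hasDerivAt_mul_character (t + h) x).sub (hasDerivAt_mul_character t x))
    (fun x => ?_) (fun x => ?_) (fun x y hx hxy => ?_) ?_
  · rw [← mul_sub, norm_mul, norm_mul, Complex.norm_I, one_mul, Complex.norm_real, Real.norm_eq_abs]
    have h1 := norm_character_add_sub_le t h x
    have h2 := truncatedLinear_nonneg h (abs_nonneg x)
    have h3 : |x| * ‖character (t + h) x - character t x‖ ≤ |x| * truncatedLinear h |x| := by gcongr
    have h4 : 0 ≤ |h| * |x| := by positivity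
    linarith
  · have e : Complex.I * character (t + h) x +
          Complex.I * x * (Complex.I * ((t + h : ℝ) : ℂ) * character (t + h) x) -
        (Complex.I * character t x + Complex.I * x * (Complex.I * t * character t x)) =
        Complex.I * (character (t + h) x - character t x) +
          (Complex.I * x * (Complex.I * t) * (character (t + h) x - character t x) +
          Complex.I * x * (Complex.I * h) * character (t + h) x) := by push_cast; ring
    rw [e]
    refine (norm_add_le _ _).trans ((add_le_add_right (norm_add_le _ _) _).trans ?_)
    simp only [norm_mul, norm_character, Complex.norm_I, Complex.norm_real, Real.norm_eq_abs,
      one_mul, mul_one]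
    have h1 := norm_character_add_sub_le t h x
    calc _ ≤ truncatedLinear h |x| + (|x| * 1 * truncatedLinear h |x| + |x| * |h|) := by gcongr
      _ = _ := by ring
  · have h1 := truncatedLinear_mono h hxy
    have h2 := truncatedLinear_nonneg h hx
    gcongr
    linarith
  · have hw : Measurable fun x => |v x| + V₁ := hv.abs.add_const V₁
    refine Integrable.mono' ((hvi.add (integrable_const (V₁ + 1))).const_mul (2 + |h|))
      (((hw.const_add 1).mul (measurable_truncatedLinear_comp h hw)).add
        (hw.const_mul _)).aestronglyMeasurable (Eventually.of_forall fun x => ?_)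
    have h1 := truncatedLinear_le_two h (|v x| + V₁)
    have h2 := truncatedLinear_nonneg h (s := |v x| + V₁) (by positivity)
    rw [Real.norm_of_nonneg (by positivity)]
    calc _ ≤ (1 + (|v x| + V₁)) * 2 + |h| * (|v x| + (V₁ + 1)) := by gcongr; linarith
      _ = _ := by simp only [Pi.add_apply]; ring

end HasMultiplierBound

end MultiplierOperators
end

/-! ### Moduli of continuity of `R` and `R'`, and (H2) -/

noncomputable section

theorem truncatedLinear_add_le (h : ℝ) (s : ℝ) {V : ℝ} (hV : 0 ≤ V) :
    truncatedLinear h (s + V) ≤ 2 * min 1 (|h| * s) + 2 * (|h| * V) := by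
  have h1 : 0 ≤ |h| * V := by positivity
  have h2 : min 1 (|h| * s + |h| * V) ≤ min 1 (|h| * s) + |h| * V := by
    rcases min_cases 1 (|h| * s) with ⟨he, _⟩ | ⟨he, _⟩ <;> rw [he]
    · linarith [min_le_left 1 (|h| * s + |h| * V)]
    · exact min_le_right _ _
  rw [truncatedLinear, mul_add]
  linarith

theorem truncatedLinear_le_rpow (h : ℝ) {s δ : ℝ} (hs : 0 ≤ s) (hδ0 : 0 ≤ δ) (hδ1 : δ ≤ 1) :
    truncatedLinear h s ≤ 2 * (|h| ^ δ * s ^ δ) := by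
  rw [← Real.mul_rpow (abs_nonneg h) hs, truncatedLinear]
  have hy : 0 ≤ |h| * s := by positivity
  rcases le_total (|h| * s) 1 with hle | hge
  · rw [min_eq_right hle]
    have := Real.rpow_le_rpow_of_exponent_ge' hy hle hδ0 hδ1
    rw [Real.rpow_one] at this
    linarith
  · rw [min_eq_left hge]
    linarith [Real.one_le_rpow hge hδ0]

theorem integrable_add_const_rpow {X : Type*} [MeasurableSpace X] {μ : Measure X}
    [IsFiniteMeasure μ] {w : X → ℝ} (hw : Measurable w) (hw0 : ∀ x, 0 ≤ w x) {γ c : ℝ}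
    (hγ : 0 ≤ γ) (hc : 0 ≤ c) (hi : Integrable (fun x => w x ^ γ) μ) :
    Integrable (fun x => (w x + c) ^ γ) μ := by
  refine ((hi.const_mul (2 ^ γ)).add (integrable_const ((2 * c) ^ γ))).mono'
    ((hw.add_const c).pow_const γ).aestronglyMeasurable (Eventually.of_forall fun x => ?_)
  have hx := hw0 x
  rw [Real.norm_of_nonneg (by positivity), Pi.add_apply, ← Real.mul_rpow two_pos.le hx]
  rcases le_total (w x) c with hle | hge
  · have h1 : (w x + c) ^ γ ≤ (2 * c) ^ γ := Real.rpow_le_rpow (by positivity) (by linarith) hγ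
    have h2 : 0 ≤ (2 * w x) ^ γ := by positivity
    linarith
  · have h1 : (w x + c) ^ γ ≤ (2 * w x) ^ γ := Real.rpow_le_rpow (by positivity) (by linarith) hγ
    have h2 : 0 ≤ (2 * c) ^ γ := by positivity
    linarith

namespace HasMultiplierBound

variable {μ : Measure ℝ} [IsProbabilityMeasure μ] {T v : ℝ → ℝ} {V₁ C₀ : ℝ} {t h : ℝ}
  {R R' : ℝ → BV μ →L[ℂ] BV μ}

section

variable (hb : HasMultiplierBound μ T v V₁ C₀) (hT : Measurable T) (hv : Measurable v)
  (hV₁ : 0 ≤ V₁) (hC₀ : 0 ≤ C₀) (hR : ∀ t, IsMultiplierOperator μ T v (character t) (R t))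
  (hR' : ∀ t, IsMultiplierOperator μ T v (fun x => Complex.I * x * character t x) (R' t))
include hb hT hv hV₁ hC₀

omit hT hv hV₁ in
include hR in
theorem norm_le (ht : |t| ≤ 1) : ‖R t‖ ≤ C₀ * 2 := by
  obtain ⟨A, hA, hle⟩ := hb.exists_character t
  rw [(hR t).unique hA]
  exact hle.trans (by gcongr; linarith)

omit hT hv in
include hR' in
theorem norm_deriv_le (hvi : Integrable (fun x => |v x|) μ) (ht : |t| ≤ 1) :
    ‖R' t‖ ≤ C₀ * (2 * ∫ x, (1 + (|v x| + V₁)) ∂μ) := by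
  obtain ⟨A, hA, hle⟩ := hb.exists_mul_character hvi t
  rw [(hR' t).unique hA]
  have : 0 ≤ ∫ x, (1 + (|v x| + V₁)) ∂μ := integral_nonneg fun x => by positivity
  exact hle.trans (by gcongr; linarith)

include hR in
theorem norm_sub_le_integral_min (ht : |t| ≤ 1) :
    ‖R (t + h) - R t‖ ≤ C₀ * ((2 + 2 * V₁) * (|h| + ∫ x, min 1 (|h| * |v x|) ∂μ)) := by
  refine (hb.norm_sub_le hT hv hV₁ hR ht).trans (mul_le_mul_of_nonneg_left ?_ hC₀)
  have hmin : ∀ x, 0 ≤ min 1 (|h| * |v x|) := fun x => le_min zero_le_one (by positivity)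
  have hi : Integrable (fun x => min 1 (|h| * |v x|)) μ :=
    Integrable.of_bound (measurable_const.min (hv.abs.const_mul _)).aestronglyMeasurable 1
      (Eventually.of_forall fun x => by
        rw [Real.norm_of_nonneg (hmin x)]; exact min_le_left _ _)
  calc ∫ x, (truncatedLinear h (|v x| + V₁) + |h|) ∂μ
      ≤ ∫ x, (2 * min 1 (|h| * |v x|) + (2 * (|h| * V₁) + |h|)) ∂μ := by
        refine integral_mono_of_nonneg (Eventually.of_forall fun x => ?_)
          ((hi.const_mul 2).add (integrable_const _)) (Eventually.of_forall fun x => ?_)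
        · have := truncatedLinear_nonneg h (s := |v x| + V₁) (by positivity)
          simp only [Pi.zero_apply]; positivity
        · have := truncatedLinear_add_le h |v x| hV₁
          simp only; linarith
    _ = 2 * ∫ x, min 1 (|h| * |v x|) ∂μ + (2 * (|h| * V₁) + |h|) := by
        rw [integral_add (hi.const_mul 2) (integrable_const _), integral_const_mul]; simp
    _ ≤ _ := by
        have h1 : 0 ≤ ∫ x, min 1 (|h| * |v x|) ∂μ := integral_nonneg hmin
        nlinarith [abs_nonneg h, mul_nonneg hV₁ h1]

include hR' in
theorem exists_norm_deriv_sub_le (hvi : Integrable (fun x => |v x|) μ) : ∃ D : ℝ, 0 ≤ D ∧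
    ∀ t h, |t| ≤ 1 → ‖R' (t + h) - R' t‖ ≤
      D * (|h| + ∫ x, |v x| * min 1 (|h| * |v x|) ∂μ) := by
  set b := ∫ x, ((4 * V₁ + 3) * |v x| + (2 * V₁ * (1 + V₁) + V₁)) ∂μ with hbdef
  have hbi : Integrable (fun x => (4 * V₁ + 3) * |v x| + (2 * V₁ * (1 + V₁) + V₁)) μ :=
    (hvi.const_mul _).add (integrable_const _)
  have hb0 : 0 ≤ b := integral_nonneg fun x => by positivity
  refine ⟨C₀ * (2 + b), by positivity, fun t h ht => ?_⟩
  rw [mul_assoc]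
  refine (hb.norm_deriv_sub_le hT hv hV₁ hR' hvi ht).trans (mul_le_mul_of_nonneg_left ?_ hC₀)
  have hmin : ∀ x, 0 ≤ min 1 (|h| * |v x|) := fun x => le_min zero_le_one (by positivity)
  have hi : Integrable (fun x => |v x| * min 1 (|h| * |v x|)) μ :=
    hvi.mono' (hv.abs.mul (measurable_const.min (hv.abs.const_mul _))).aestronglyMeasurable
      (Eventually.of_forall fun x => by
        rw [Real.norm_of_nonneg (mul_nonneg (abs_nonneg _) (hmin x))]
        exact mul_le_of_le_one_right (abs_nonneg _) (min_le_left _ _))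
  calc ∫ x, ((1 + (|v x| + V₁)) * truncatedLinear h (|v x| + V₁) + |h| * (|v x| + V₁)) ∂μ
      ≤ ∫ x, (2 * (|v x| * min 1 (|h| * |v x|)) +
          |h| * ((4 * V₁ + 3) * |v x| + (2 * V₁ * (1 + V₁) + V₁))) ∂μ := by
        refine integral_mono_of_nonneg (Eventually.of_forall fun x => ?_)
          ((hi.const_mul 2).add (hbi.const_mul _)) (Eventually.of_forall fun x => ?_)
        · have := truncatedLinear_nonneg h (s := |v x| + V₁) (by positivity)
          simp only [Pi.zero_apply]; positivity
        · have h1 := truncatedLinear_add_le h |v x| hV₁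
          have h2 : (1 + (|v x| + V₁)) * truncatedLinear h (|v x| + V₁) ≤
              (1 + (|v x| + V₁)) * (2 * min 1 (|h| * |v x|) + 2 * (|h| * V₁)) := by gcongr
          have h3 : (1 + V₁) * min 1 (|h| * |v x|) ≤ (1 + V₁) * (|h| * |v x|) := by
            gcongr; exact min_le_right _ _
          simp only; linarith
    _ = 2 * ∫ x, |v x| * min 1 (|h| * |v x|) ∂μ + |h| * b := by
        rw [integral_add (hi.const_mul 2) (hbi.const_mul _), integral_const_mul, integral_const_mul]
    _ ≤ _ := by
        have h1 : 0 ≤ ∫ x, |v x| * min 1 (|h| * |v x|) ∂μ :=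
          integral_nonneg fun x => mul_nonneg (abs_nonneg _) (hmin x)
        nlinarith [abs_nonneg h, mul_nonneg hb0 h1]

-- The inequality `min(1, y) ≤ y^δ` trades part of the modulus of continuity for a moment of order
-- `1 + δ`. With `δ = α' - 1` this order is below `α`, which gives a pure power `|s|^{α'-1}` without
-- the slowly varying factor.
include hR' in
theorem exists_norm_deriv_sub_le_rpow {δ : ℝ} (hδ0 : 0 < δ) (hδ1 : δ ≤ 1)
    (hvi : Integrable (fun x => |v x|) μ) (hvδ : Integrable (fun x => |v x| ^ (1 + δ)) μ) :
    ∃ D : ℝ, 0 ≤ D ∧ ∀ s, |s| ≤ 1 → ‖R' s - R' 0‖ ≤ D * |s| ^ δ := by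
  have hwi : Integrable (fun x => (|v x| + (V₁ + 1)) ^ (1 + δ)) μ :=
    integrable_add_const_rpow hv.abs (fun x => abs_nonneg _) (by linarith) (by linarith) hvδ
  have hb0 : 0 ≤ ∫ x, (|v x| + (V₁ + 1)) ^ (1 + δ) ∂μ := integral_nonneg fun x => by positivity
  refine ⟨C₀ * (3 * ∫ x, (|v x| + (V₁ + 1)) ^ (1 + δ) ∂μ), by positivity, fun s hs => ?_⟩
  have h0 := hb.norm_deriv_sub_le hT hv hV₁ hR' (t := 0) (h := s) hvi (by simp)
  rw [zero_add] at h0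
  refine h0.trans ?_
  rw [mul_assoc]
  refine mul_le_mul_of_nonneg_left ?_ hC₀
  rw [mul_right_comm, ← integral_const_mul]
  refine integral_mono_of_nonneg (Eventually.of_forall fun x => ?_) (hwi.const_mul _)
    (Eventually.of_forall fun x => ?_)
  · have := truncatedLinear_nonneg s (s := |v x| + V₁) (by positivity)
    simp only [Pi.zero_apply]; positivity
  · set w := |v x| + V₁ with hw
    have hw0 : 0 ≤ w := by positivity
    have e : |v x| + (V₁ + 1) = 1 + w := by rw [hw]; ring
    simp only [e]
    have h1 := truncatedLinear_le_rpow s hw0 hδ0.le hδ1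
    have h2 : w ^ δ ≤ (1 + w) ^ δ := Real.rpow_le_rpow hw0 (by linarith) hδ0.le
    have h3 : (1 + w) * (1 + w) ^ δ = (1 + w) ^ (1 + δ) := by
      rw [Real.rpow_add (by linarith), Real.rpow_one]
    have h4 : |s| ≤ |s| ^ δ := by
      have := Real.rpow_le_rpow_of_exponent_ge' (abs_nonneg s) hs hδ0.le hδ1
      rwa [Real.rpow_one] at this
    have h5 : w ≤ (1 + w) ^ (1 + δ) := by
      calc w ≤ (1 + w) ^ (1 : ℝ) := by rw [Real.rpow_one]; linarith
        _ ≤ _ := Real.rpow_le_rpow_of_exponent_le (by linarith) (by linarith)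
    calc (1 + w) * truncatedLinear s w + |s| * w
        ≤ (1 + w) * (2 * (|s| ^ δ * (1 + w) ^ δ)) + |s| ^ δ * (1 + w) ^ (1 + δ) := by
          gcongr
          exact h1.trans (by gcongr)
      _ = _ := by rw [← h3]; ring

-- The remainder is `|h|` times an integral that tends to `0` with `h` by dominated convergence: the
-- truncation is bounded by `2`, vanishes pointwise in the limit, and `|v|` is integrable.
omit hC₀ in
include hR hR' in
theorem hasDerivAt (hvi : Integrable (fun x => |v x|) μ) (ht : |t| ≤ 1) :
    HasDerivAt R (R' t) t := by
  have hw : Measurable fun x => |v x| + V₁ := hv.abs.add_const V₁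
  have hlim : Tendsto (fun h => ∫ x, (|v x| + V₁ + 1) * truncatedLinear h (|v x| + V₁) ∂μ) (𝓝 0)
      (𝓝 (∫ _, (0 : ℝ) ∂μ)) := by
    refine tendsto_integral_filter_of_dominated_convergence (fun x => (|v x| + V₁ + 1) * 2)
      (Eventually.of_forall fun h => ((hw.add_const 1).mul
        (measurable_truncatedLinear_comp h hw)).aestronglyMeasurable)
      (Eventually.of_forall fun h => Eventually.of_forall fun x => ?_)
      (((hvi.add (integrable_const V₁)).add (integrable_const 1)).mul_const 2)
      (Eventually.of_forall fun x => ?_)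
    · have h1 := truncatedLinear_le_two h (|v x| + V₁)
      have h2 := truncatedLinear_nonneg h (s := |v x| + V₁) (by positivity)
      rw [Real.norm_of_nonneg (by positivity)]
      gcongr
    · have hc : Continuous fun h : ℝ => (|v x| + V₁ + 1) * truncatedLinear h (|v x| + V₁) := by
        unfold truncatedLinear; fun_prop
      have := hc.tendsto 0
      simpa [truncatedLinear] using this
  rw [integral_zero] at hlim
  rw [hasDerivAt_iff_isLittleO_nhds_zero, Asymptotics.isLittleO_iff]
  intro c hc
  have hlim' := hlim.const_mul C₀
  rw [mul_zero] at hlim'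
  filter_upwards [hlim'.eventually (gt_mem_nhds hc)] with h hh
  refine (hb.norm_sub_sub_smul_le hT hv hV₁ hR hR' hvi ht).trans ?_
  rw [mul_left_comm, mul_comm, Real.norm_eq_abs]
  gcongr

end

theorem hypH2 (hb : HasMultiplierBound μ T v V₁ C₀) (hT : Measurable T) (hv : Measurable v)
    (hV₁ : 0 ≤ V₁) (hC₀ : 0 ≤ C₀)
    (hR : ∀ t, IsMultiplierOperator μ T v (character t) (R t)) {α p q : ℝ} {ℓ : ℝ → ℝ}
    (hv2 : ∫⁻ x, ENNReal.ofReal (v x ^ 2) ∂μ = ∞) (hα : α ∈ Ioo (0 : ℝ) 1 ∪ Ioc (1 : ℝ) 2)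
    (hH1 : HypH1 μ v α p q ℓ)
    (hℓ : α = 2 → ∀ x : ℝ, 1 ≤ x → IntervalIntegrable (fun u => ℓ u / u) volume 1 x) :
    HypH2 α ℓ R := by
  rcases hα with ⟨hα0, hα1⟩ | ⟨hα1, hα2⟩
  · obtain ⟨ε, C, hε, hC, hle⟩ := hH1.exists_integral_min_le hv hα1
    have hnot : ¬ 1 < α := not_lt.2 hα1.le
    refine ⟨min ε 1, lt_min hε one_pos, fun h => absurd h hnot,
      ⟨C₀ * 2 + C₀ * ((2 + 2 * V₁) * C) + 1, by positivity, fun t h ht hh => ?_⟩,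
      fun h => absurd h hnot⟩
    have ht1 : |t| ≤ 1 := ht.le.trans (min_le_right _ _)
    refine ⟨?_, fun h => absurd h hnot, fun _ => ?_, fun h => absurd h hnot⟩
    · have : 0 ≤ C₀ * ((2 + 2 * V₁) * C) := by positivity
      linarith [hb.norm_le hC₀ hR ht1]
    · rcases eq_or_ne h 0 with rfl | hne
      · simp [Real.zero_rpow hα0.ne']
      have hpos : 0 < |h| := abs_pos.2 hne
      have h1 := hle |h| hpos (hh.trans_le (min_le_left _ _))
      have hint0 : 0 ≤ ∫ x, min 1 (|h| * |v x|) ∂μ :=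
        integral_nonneg fun x => le_min zero_le_one (by positivity)
      -- The sign of `ℓ(1/|h|)` is read off from `h1`, whose left side is nonnegative; it is needed
      -- to enlarge the constant.
      have h2 : 0 ≤ |h| ^ α * ℓ (1 / |h|) := by
        by_contra! hneg
        have := mul_neg_of_pos_of_neg hC hneg
        linarith
      calc _ ≤ C₀ * ((2 + 2 * V₁) * (|h| + ∫ x, min 1 (|h| * |v x|) ∂μ)) :=
            hb.norm_sub_le_integral_min hT hv hV₁ hC₀ hR ht1
        _ ≤ C₀ * ((2 + 2 * V₁) * (C * (|h| ^ α * ℓ (1 / |h|)))) := by gcongr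
        _ = C₀ * ((2 + 2 * V₁) * C) * (|h| ^ α * ℓ (1 / |h|)) := by ring
        _ ≤ _ := by
            gcongr
            linarith
  · obtain ⟨ε, C, hε, hC, hle⟩ := hH1.exists_integral_abs_mul_min_le hv hα1 hα2 hv2 hℓ
    have hvi := hH1.integrable_abs hv hα1
    choose R' hR' _ using hb.exists_mul_character hvi
    have hderiv : ∀ t : ℝ, |t| ≤ 1 → HasDerivAt R (R' t) t := fun t ht =>
      hb.hasDerivAt hT hv hV₁ hR hR' hvi ht
    -- With `ε ≤ 1/2` all points with `|t| < 2ε`, and all sums `|t| + |h|`, stay in the range `[-1,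
    -- 1]` where the operator estimates hold.
    have hε2 : min ε (1 / 2) ≤ 1 / 2 := min_le_right _ _
    obtain ⟨D, hD0, hD⟩ := hb.exists_norm_deriv_sub_le hT hv hV₁ hC₀ hR' hvi
    have hnot : ¬ α < 1 := not_lt.2 hα1.le
    have hE0 : 0 ≤ ∫ x, (1 + (|v x| + V₁)) ∂μ := integral_nonneg fun x => by positivity
    set E := C₀ * (2 * ∫ x, (1 + (|v x| + V₁)) ∂μ) with hE
    have hE0' : 0 ≤ E := by positivity
    refine ⟨min ε (1 / 2), lt_min hε (by norm_num), fun _ t ht =>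
      (hderiv t (by linarith)).differentiableAt,
      ⟨C₀ * 2 + E + D * C + 1, by positivity, fun t h ht hh => ?_⟩, fun _ α' h1 h2 => ?_⟩
    · have ht1 : |t| ≤ 1 := by linarith
      have hth1 : |t + h| ≤ 1 := (abs_add_le _ _).trans (by linarith)
      have hDC : 0 ≤ D * C := by positivity
      refine ⟨?_, fun _ => ?_, fun h => absurd h hnot, fun _ => ?_⟩
      · linarith [hb.norm_le hC₀ hR ht1]
      · rw [(hderiv t ht1).deriv]
        linarith [hb.norm_deriv_le hV₁ hC₀ hR' hvi ht1, mul_nonneg hC₀ two_pos.le]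
      · rw [(hderiv t ht1).deriv, (hderiv _ hth1).deriv]
        rcases eq_or_ne h 0 with rfl | hne
        · simp [Real.zero_rpow (sub_pos.2 hα1).ne']
        have hpos : 0 < |h| := abs_pos.2 hne
        have h1 := hle |h| hpos (hh.trans_le (min_le_left _ _))
        have hint0 : 0 ≤ ∫ x, |v x| * min 1 (|h| * |v x|) ∂μ :=
          integral_nonneg fun x => mul_nonneg (abs_nonneg _) (le_min zero_le_one (by positivity))
        have h2 : 0 ≤ |h| ^ (α - 1) * ellZero α ℓ (1 / |h|) := by
          by_contra! hneg
          have := mul_neg_of_pos_of_neg hC hneg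
          linarith
        calc _ ≤ D * (|h| + ∫ x, |v x| * min 1 (|h| * |v x|) ∂μ) := hD t h ht1
          _ ≤ D * (C * (|h| ^ (α - 1) * ellZero α ℓ (1 / |h|))) := by gcongr
          _ = D * C * (|h| ^ (α - 1) * ellZero α ℓ (1 / |h|)) := by ring
          _ ≤ _ := by
              gcongr
              linarith [mul_nonneg hC₀ two_pos.le]
    · obtain ⟨D', hD'0, hD'⟩ := hb.exists_norm_deriv_sub_le_rpow hT hv hV₁ hC₀ hR'
        (δ := α' - 1) (by linarith) (by linarith) hvi
        (by simpa using hH1.integrable_abs_rpow hv (by linarith) h2)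
      refine ⟨D' + 1, by positivity, fun t h ht hh => ?_⟩
      rw [(hderiv 0 (by simp)).deriv]
      have hbound : ∀ s ∈ uIcc t (t + h), |s| ≤ |t| + |h| := by
        intro s hs
        have h3 : |s - t| ≤ |h| := by
          have := abs_sub_left_of_mem_uIcc hs
          simpa using this
        calc |s| = |t + (s - t)| := by ring_nf
          _ ≤ |t| + |s - t| := abs_add_le _ _
          _ ≤ _ := by gcongr
      have hsum : |t| + |h| ≤ 1 := by linarith
      -- Estimate (iii) is the mean value inequality for `s ↦ R s - s • R' 0` between `t` and `t +
      -- h`, where the derivative is at most `D' (|t| + |h|)^{α'-1}`. Subadditivity of the power,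
      -- whose exponent is at most 1, separates `t` and `h`.
      have hmv := (convex_uIcc t (t + h)).norm_image_sub_le_of_norm_hasDerivWithin_le
        (f := fun s => R s - s • R' 0) (f' := fun s => R' s - R' 0)
        (C := D' * (|t| + |h|) ^ (α' - 1))
        (fun s hs => by
          have h4 := (hderiv s ((hbound s hs).trans hsum)).sub
            ((hasDerivAt_id s).smul_const (R' 0))
          rw [one_smul] at h4
          exact h4.hasDerivWithinAt)
        (fun s hs => (hD' s ((hbound s hs).trans hsum)).trans (by
          gcongr
          exact hbound s hs)) left_mem_uIcc right_mem_uIcc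
      have e : R (t + h) - (t + h) • R' 0 - (R t - t • R' 0) = R (t + h) - R t - h • R' 0 := by
        rw [add_smul]; abel
      simp only [e, add_sub_cancel_left, Real.norm_eq_abs] at hmv
      refine hmv.trans ?_
      have h5 := Real.rpow_add_le_add_rpow (abs_nonneg t) (abs_nonneg h)
        (by linarith : 0 ≤ α' - 1) (by linarith)
      have h6 : 0 ≤ |t| ^ (α' - 1) + |h| ^ (α' - 1) := by positivity
      calc D' * (|t| + |h|) ^ (α' - 1) * |h|
          ≤ D' * (|t| ^ (α' - 1) + |h| ^ (α' - 1)) * |h| := by gcongr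
        _ = D' * (|h| * (|t| ^ (α' - 1) + |h| ^ (α' - 1))) := by ring
        _ ≤ _ := by gcongr; linarith

end HasMultiplierBound
end

/-! ### Assembly: density, multiplier operators and spectral gap -/

theorem mainTheorem5
    (T : ℝ → ℝ) (𝓘 : Set (Set ℝ)) (hT : IsAFU T 𝓘) (hmix : IsTopMixing T 𝓘)
    (μ : Measure ℝ) [IsProbabilityMeasure μ] (hac : μ ≪ volume.restrict (Icc 0 1))
    (hinv : MeasurePreserving T μ μ)
    (v : ℝ → ℝ) (hv : Measurable v) (hv2 : ∫⁻ x, ENNReal.ofReal (v x ^ 2) ∂μ = ∞)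
    (hvar : (⨆ I ∈ 𝓘, essVar μ v I) < ∞)
    (α : ℝ) (hα : α ∈ Ioo (0 : ℝ) 1 ∪ Ioc (1 : ℝ) 2)
    (p q : ℝ) (ℓ : ℝ → ℝ) (hH1 : HypH1 μ v α p q ℓ)
    (hℓ : α = 2 → ∀ x : ℝ, 1 ≤ x → IntervalIntegrable (fun u => ℓ u / u) volume 1 x) :
    HypH1 μ v α p q ℓ ∧ IsBanachInLinfty μ (BV.incl μ) ∧
      ∃ R : ℝ → BV μ →L[ℂ] BV μ,
        IsPerturbedTransfer μ T v (BV.incl μ) R ∧ HypH2 α ℓ R ∧ HypH3 (R 0) := by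
  obtain ⟨ρ, C, hρ, h⟩ := hT.exists_piecewiseExpanding
  obtain ⟨g, c, M, V, hc, hV, hgm, -, -, ⟨g', hg', hle, hge, hvarg⟩, hμ⟩ :=
    h.exists_density hρ hac hinv hmix
  have hd : HasBVDensity μ g' c M V :=
    { pos := hc
      nonneg := hV
      aemeasurable := hgm.aemeasurable.congr hg'.symm
      le := hle
      ge := hge
      eVariationOn_le := hvarg
      eq_withDensity := hμ.trans
        (withDensity_congr_ae (hg'.symm.mono fun x hx => congrArg ENNReal.ofReal hx)) }
  obtain ⟨V₁, C₀, hV₁, hC₀, hb⟩ := h.exists_multiplier_operator hinv.measurable hd hv hvar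
  have hb' : HasMultiplierBound μ T v V₁ C₀ := hb
  choose R hR _ using hb'.exists_character
  refine ⟨hH1, BV.isBanachInLinfty, R, fun t f => hR t f,
    hb'.hypH2 hinv.measurable hv hV₁ hC₀ hR hv2 hα hH1 hℓ,
    h.hypH3 hρ hmix hd hinv (R 0) fun φ => ?_⟩
  simpa [character] using hR 0 φ
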